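/- Let $n\ge 2$, $b\in(-1,1)$, $p\ge 1$. Write $X=(x,y)\in\mathbb R^n\times\mathbb R$, and set $B_1^+=\{|X|<1,\ y>0\}$, $S_1^+=\{|X|=1,\ y>0\}$, $B_1'=\{x\in\mathbb R^n:|x|<1\}$ (identified with $B_1'\times\{0\}$). Let $\Delta_b w=y^{-b}\operatorname{div}(y^b\nabla w)$ (in the sense of distributions) and $\partial_y^b w(x,0)=\lim_{y\to0^+}y^b\partial_y w(x,y)$. Let $\mathcal H=\{w\in H^1(B_1^+;y^b):\Delta_b w\in L^2(B_1^+;y^b)\}$ with norm $\|w\|_{\mathcal H}^2=\int_{B_1^+}y^b(w^2+|\nabla w|^2+|\Delta_b w|^2)\,dX$. Values of $w\in\mathcal H$ on $S_1^+$ and $B_1'$ are understood as traces. The conditions $\partial_y^b w=0$ on $B_1'$ and $\partial_\nu w=0$ on $S_1^+$ are understood weakly: $\int_{B_1^+}y^b(\nabla w\cdot\nabla\varphi+\varphi\,\Delta_b w)\,dX=0$ for all $\varphi\in C_c^\infty(\overline{B_1^+}\setminus\overline{S_1^+})$, respectively for all $\varphi\in C_c^\infty(\overline{B_1^+}\setminus\overline{B_1'})$;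 $\partial_\nu w=\partial_\nu g$ means $\partial_\nu(w-g)=0$. Assume: (H.1) $g\in\mathcal H$, the trace of $g$ on $B_1'$ is in $L^p(B_1')$, and $\partial_y^b g=0$ on $B_1'$. (H.2) $f:B_1'\times\mathbb R\to\mathbb R$ is Carathéodory and, for some constant $C$, $|f(x,\zeta)|\le C(1+|\zeta|^{p-1})$ for a.e. $x\in B_1'$ and all $\zeta\in\mathbb R$. (H.3) With $F(x,\zeta)=-2\int_0^\zeta f(x,\sigma)\,d\sigma$ there is a constant $c>0$ such that $F(x,\zeta)\ge c|\zeta|^p$ for a.e. $x\in B_1'$ and all $\zeta\in\mathbb R$. Let $$\mathcal J(w)=\int_{B_1^+}y^b|\Delta_b w|^2\,dX+\int_{B_1'}F(x,w)\,dx\in[0,\infty],$$ $$\mathcal A=\{w\in\mathcal H: w=g \text{ and } \partial_\nu w=\partial_\nu g\text{ on }S_1^+,\ \partial_y^b w=0\text{ on }B_1'\}.$$ Then $\mathcal J$ admits a global minimizer over $\mathcal A$: there is $u\in\mathcal A$ with $\mathcal J(u)<\infty$ and $\mathcal J(u)\le\mathcal J(w)$ for all $w\in\mathcal A$. Moreover,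 every such minimizer $u$ is a weak solution of $$\Delta_b^2u=0\text{ in }B_1^+,\quad u=g,\ \partial_\nu u=\partial_\nu g\text{ on }S_1^+,\quad \partial_y^b u=0,\ \partial_y^b\Delta_b u=f(\cdot,u)\text{ on }B_1',$$ that is, $u\in\mathcal H$ has trace in $L^p(B_1')$, satisfies $u=g$ and $\partial_\nu u=\partial_\nu g$ on $S_1^+$ and $\partial_y^b u=0$ on $B_1'$, and $$\int_{B_1^+}y^b\,\Delta_b u\,\Delta_b\phi\,dX=\int_{B_1'}f(x,u)\,\phi\,dx$$ for every $\phi\in\mathcal H_{0,S_1^+}$ whose trace is in $L^p(B_1')$, where $\mathcal H_{0,S_1^+}$ is the closure in $\|\cdot\|_{\mathcal H}$ of the set of $\phi\in C_c^\infty(\overline{B_1^+}\setminus\overline{S_1^+})\cap\mathcal H$ with $\partial_y^b\phi=0$ on $B_1'$. -/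

import Mathlib

open MeasureTheory Filter Topology
open scoped ENNReal ContDiff Gradient

noncomputable section

namespace WeightedBilaplace

/-- The ambient space `ℝ^{n+1}`; a point is `X = (x, y)`, the last coordinate being `y`. -/
abbrev Amb (n : ℕ) : Type := EuclideanSpace ℝ (Fin (n + 1))

/-- The thin space `ℝ^n`. -/
abbrev Thin (n : ℕ) : Type := EuclideanSpace ℝ (Fin n)

/-- The coordinate `y` of `X = (x, y)`. -/
def ycoord {n : ℕ} (X : Amb n) : ℝ := X (Fin.last n)

/-- The point `(x, y)`. -/
def pt {n : ℕ} (x : Thin n) (y : ℝ) : Amb n :=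
  WithLp.toLp 2 (Fin.snoc (α := fun _ => ℝ) (WithLp.ofLp x) y)

/-- The open half ball `B_1^+ = {X : |X| < 1, y > 0}`. -/
def halfBall (n : ℕ) : Set (Amb n) := {X | ‖X‖ < 1 ∧ 0 < ycoord X}

/-- The flat part `B_1'` of the boundary of `B_1^+`, as a subset of `ℝ^n`. -/
def flatBall (n : ℕ) : Set (Thin n) := Metric.ball 0 1

/-- The measure `y^b dX` on `B_1^+`. -/
def wMeas (n : ℕ) (b : ℝ) : Measure (Amb n) :=
  (volume.restrict (halfBall n)).withDensity (fun X => ENNReal.ofReal (ycoord X ^ b))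

/-- Smooth compactly supported functions on `ℝ^{n+1}` with support in `U`. The sets `U` used below:

* `U = B_1^+`: the space `C_c^∞(B_1^+)`;
* `U = B_1`: the restrictions to `B_1^+` form `C_c^∞(closure B_1^+ \ closure S_1^+)`;
* `U = {y > 0}`: the restrictions to `B_1^+` form `C_c^∞(closure B_1^+ \ closure B_1')`. -/
structure IsTest {n : ℕ} (U : Set (Amb n)) (φ : Amb n → ℝ) : Prop where
  smooth : ContDiff ℝ ∞ φ
  compact : HasCompactSupport φ
  supp : tsupport φ ⊆ U

/-- `G` is the weak (distributional) gradient of `w` in `B_1^+`. -/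
structure IsWeakGrad {n : ℕ} (w : Amb n → ℝ) (G : Amb n → Amb n) : Prop where
  locInt_fun : LocallyIntegrableOn w (halfBall n)
  locInt_grad : LocallyIntegrableOn G (halfBall n)
  parts : ∀ φ : Amb n → ℝ, IsTest (halfBall n) φ →
    ∫ X in halfBall n, w X • ∇ φ X = - ∫ X in halfBall n, φ X • G X

open Classical in
/-- The weak gradient `∇w` in `B_1^+` (unique up to null sets; `0` if there is none). -/
def weakGrad {n : ℕ} (w : Amb n → ℝ) : Amb n → Amb n :=
  if h : ∃ G, IsWeakGrad w G then h.choose else 0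

/-- `h = Δ_b w = y^{-b} div (y^b ∇w)` in `B_1^+`, in the sense of distributions. -/
structure IsWeakLap {n : ℕ} (b : ℝ) (w h : Amb n → ℝ) : Prop where
  locInt : LocallyIntegrableOn h (halfBall n)
  parts : ∀ φ : Amb n → ℝ, IsTest (halfBall n) φ →
    ∫ X, inner ℝ (weakGrad w X) (∇ φ X) ∂(wMeas n b) = - ∫ X, h X * φ X ∂(wMeas n b)

open Classical in
/-- The distribution `Δ_b w` as a function (unique up to null sets; `0` if there is none). -/
def weakLap {n : ℕ} (b : ℝ) (w : Amb n → ℝ) : Amb n → ℝ :=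
  if h : ∃ v, IsWeakLap b w v then h.choose else 0

/-- The weighted Sobolev space `H^1(B_1^+; y^b)`. -/
structure MemH1 {n : ℕ} (b : ℝ) (w : Amb n → ℝ) : Prop where
  memLp : MemLp w 2 (wMeas n b)
  weakDiff : ∃ G, IsWeakGrad w G
  grad_memLp : MemLp (weakGrad w) 2 (wMeas n b)

/-- The space `ℋ = {w ∈ H^1(B_1^+; y^b) : Δ_b w ∈ L^2(B_1^+; y^b)}`. -/
structure MemH {n : ℕ} (b : ℝ) (w : Amb n → ℝ) : Prop where
  memH1 : MemH1 b w
  weakLap_exists : ∃ h, IsWeakLap b w h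
  lap_memLp : MemLp (weakLap b w) 2 (wMeas n b)

/-- The norm `‖w‖_ℋ`. -/
def normH {n : ℕ} (b : ℝ) (w : Amb n → ℝ) : ℝ :=
  Real.sqrt (∫ X, (w X ^ 2 + ‖weakGrad w X‖ ^ 2 + weakLap b w X ^ 2) ∂(wMeas n b))

/-- `T` is the trace of `w` on `B_1'`: the Gauss-Green formula holds in the `y` direction (the
outer normal on `B_1'` is `-e_{n+1}`) for all test functions that vanish near `S_1^+`. -/
structure IsFlatTrace {n : ℕ} (w : Amb n → ℝ) (T : Thin n → ℝ) : Prop where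
  locInt : LocallyIntegrableOn T (flatBall n)
  gaussGreen : ∀ φ : Amb n → ℝ, IsTest (Metric.ball 0 1) φ →
    ∫ X in halfBall n, (w X * ycoord (∇ φ X) + φ X * ycoord (weakGrad w X))
      = - ∫ x in flatBall n, T x * φ (pt x 0)

open Classical in
/-- The trace of `w` on `B_1'` (unique up to null sets; `0` if there is none, which does not
happen for functions in `H^1(B_1^+; y^b)`, `-1 < b < 1`). -/
def flatTrace {n : ℕ} (w : Amb n → ℝ) : Thin n → ℝ :=
  if h : ∃ T, IsFlatTrace w T then h.choose else 0

/-- `w ∈ L^p(B_1')`: the trace of `w` on `B_1'` exists and belongs to `L^p(B_1')`. -/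
def TraceMemLp {n : ℕ} (p : ℝ) (w : Amb n → ℝ) : Prop :=
  ∃ T, IsFlatTrace w T ∧ MemLp T (ENNReal.ofReal p) (volume.restrict (flatBall n))

/-- `w = 0` on `S_1^+` in the sense of traces: the boundary term on `S_1^+` in the Gauss-Green
formula vanishes, for all test functions that vanish near the closure of `B_1'`. -/
def LateralZero {n : ℕ} (w : Amb n → ℝ) : Prop :=
  ∀ φ : Amb n → ℝ, IsTest {X | 0 < ycoord X} φ →
    ∫ X in halfBall n, (w X • ∇ φ X + φ X • weakGrad w X) = 0

/-- `∂_ν w = 0` on `S_1^+`, in the sense of (weak) normal traces: the boundary term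
`∫_{S_1^+} y^b ∂_ν w φ` in Green's formula vanishes, for all test functions that vanish near the
closure of `B_1'`. -/
def LateralNormalZero {n : ℕ} (b : ℝ) (w : Amb n → ℝ) : Prop :=
  ∀ φ : Amb n → ℝ, IsTest {X | 0 < ycoord X} φ →
    ∫ X, inner ℝ (weakGrad w X) (∇ φ X) ∂(wMeas n b)
      + ∫ X, weakLap b w X * φ X ∂(wMeas n b) = 0

/-- `∂_y^b w = 0` on `B_1'`, in the weak sense: the boundary term `-∫_{B_1'} ∂_y^b w φ` in Green's
formula vanishes, for all test functions that vanish near `S_1^+`. -/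
def FlatConormalZero {n : ℕ} (b : ℝ) (w : Amb n → ℝ) : Prop :=
  ∀ φ : Amb n → ℝ, IsTest (Metric.ball 0 1) φ →
    ∫ X, inner ℝ (weakGrad w X) (∇ φ X) ∂(wMeas n b)
      + ∫ X, weakLap b w X * φ X ∂(wMeas n b) = 0

/-- The smooth functions `φ ∈ C_c^∞(closure B_1^+ \ closure S_1^+)` of finite `ℋ` norm with
`∂_y^b φ(x, 0) = lim_{y → 0+} y^b ∂_y φ(x, y) = 0` on `B_1'`. -/
structure IsCore {n : ℕ} (b : ℝ) (φ : Amb n → ℝ) : Prop where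
  test : IsTest (Metric.ball 0 1) φ
  memH : MemH b φ
  conormal : ∀ x ∈ flatBall n,
    Tendsto (fun y : ℝ => y ^ b * ycoord (∇ φ (pt x y))) (𝓝[>] 0) (𝓝 0)

/-- The space `ℋ_{0,S_1^+}`: the closure in `ℋ` of the functions in `IsCore`. -/
def MemH0 {n : ℕ} (b : ℝ) (φ : Amb n → ℝ) : Prop :=
  MemH b φ ∧ ∀ ε : ℝ, 0 < ε → ∃ ψ, IsCore b ψ ∧ normH b (φ - ψ) < ε

/-- `F(x, ζ) = -2 ∫_0^ζ f(x, σ) dσ`. -/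
def primF {n : ℕ} (f : Thin n → ℝ → ℝ) (x : Thin n) (ζ : ℝ) : ℝ :=
  -2 * ∫ σ in (0 : ℝ)..ζ, f x σ

/-- Assumption on the boundary datum: `g ∈ ℋ ∩ L^p(B_1')` and `∂_y^b g = 0` on `B_1'`. -/
structure DatumHyp {n : ℕ} (b p : ℝ) (g : Amb n → ℝ) : Prop where
  memH : MemH b g
  trace : TraceMemLp p g
  conormal : FlatConormalZero b g

/-- `f : B_1' × ℝ → ℝ` is Carathéodory. -/
structure IsCaratheodory {n : ℕ} (f : Thin n → ℝ → ℝ) : Prop where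
  meas : ∀ ζ : ℝ, AEMeasurable (fun x => f x ζ) (volume.restrict (flatBall n))
  cont : ∀ᵐ x ∂(volume.restrict (flatBall n)), Continuous (f x)

/-- Growth: `|f(x, ζ)| ≤ C (1 + |ζ|^{p-1})`. -/
def GrowthHyp {n : ℕ} (p : ℝ) (f : Thin n → ℝ → ℝ) : Prop :=
  ∃ C : ℝ, ∀ᵐ x ∂(volume.restrict (flatBall n)), ∀ ζ : ℝ, |f x ζ| ≤ C * (1 + |ζ| ^ (p - 1))

/-- Coercivity: `F(x, ζ) ≥ c |ζ|^p` for a positive constant `c`. -/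
def CoercHyp {n : ℕ} (p : ℝ) (f : Thin n → ℝ → ℝ) : Prop :=
  ∃ c : ℝ, 0 < c ∧
    ∀ᵐ x ∂(volume.restrict (flatBall n)), ∀ ζ : ℝ, c * |ζ| ^ p ≤ primF f x ζ

/-- The energy `J(w) = ∫_{B_1^+} y^b |Δ_b w|^2 dX + ∫_{B_1'} F(x, w) dx` as an element of
`[0, ∞]`, for `F ≥ 0` (which `CoercHyp` guarantees almost everywhere). -/
def energy {n : ℕ} (b : ℝ) (f : Thin n → ℝ → ℝ) (w : Amb n → ℝ) : ℝ≥0∞ :=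
  (∫⁻ X, ENNReal.ofReal (weakLap b w X ^ 2) ∂(wMeas n b))
    + ∫⁻ x in flatBall n, ENNReal.ofReal (primF f x (flatTrace w x))

/-- The admissible class `𝒜`: all `w ∈ ℋ` with `w = g` and `∂_ν w = ∂_ν g` on `S_1^+` and
`∂_y^b w = 0` on `B_1'`. -/
structure Admissible {n : ℕ} (b : ℝ) (g w : Amb n → ℝ) : Prop where
  memH : MemH b w
  lateral : LateralZero (w - g)
  lateralNormal : LateralNormalZero b (w - g)
  conormal : FlatConormalZero b w

/-- `u` is a weak solution of `Δ_b^2 u = 0` in `B_1^+`, `∂_y^b u = 0` and `∂_y^b Δ_b u = f(·, u)`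
on `B_1'`. -/
structure IsWeakSol {n : ℕ} (b p : ℝ) (f : Thin n → ℝ → ℝ) (u : Amb n → ℝ) : Prop where
  memH : MemH b u
  trace : TraceMemLp p u
  weak : ∀ φ : Amb n → ℝ, MemH0 b φ → TraceMemLp p φ →
    ∫ X, weakLap b u X * weakLap b φ X ∂(wMeas n b)
      = ∫ x in flatBall n, f x (flatTrace u x) * flatTrace φ x

/-- `u` is a weak solution of the full boundary value problem: in addition `u = g` and
`∂_ν u = ∂_ν g` on `S_1^+`, and `∂_y^b u = 0` on `B_1'`, in the sense of traces. -/
structure IsWeakSolBVP {n : ℕ} (b p : ℝ) (f : Thin n → ℝ → ℝ) (g u : Amb n → ℝ) : Prop where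
  weakSol : IsWeakSol b p f u
  lateral : LateralZero (u - g)
  lateralNormal : LateralNormalZero b (u - g)
  conormal : FlatConormalZero b u

/-- `u` is a global minimizer of the energy over the admissible class. -/
structure IsGlobalMin {n : ℕ} (b : ℝ) (f : Thin n → ℝ → ℝ) (g u : Amb n → ℝ) : Prop where
  adm : Admissible b g u
  finite : energy b f u < ⊤
  le : ∀ w : Amb n → ℝ, Admissible b g w → energy b f u ≤ energy b f w

end WeightedBilaplace

end

/-! The proof is the direct method in the affine class `g + v`, where `v` has zero Dirichlet and
Neumann data on the sphere and zero conormal derivative on the flat part. Since `weakGrad` and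
`weakLap` are obtained by choice, the argument runs on a `Triple` of a function, a gradient and a
weighted Laplacian, all in `L²(y^b)` and tied together by integral identities; uniqueness a.e.
translates back to the definitions.

Coercivity: for such `v`, Green's formula gives `‖∇v‖² = -∫ y^b v Δ_b v`, and with the Poincaré
inequality the norm of `Δ_b v` controls all of `v` (`green`, `eLpNorm_le_grad`, `norm_grad_le`).
Both rest on the density of test functions supported in the open unit ball (`exists_test_approx`).
The approximations are averages whose kernel looks only upward, into `y > 0`. Near the flat part no
extension of `v` is then needed, and the average of the zero extension can be differentiated through
the Dirichlet condition on the sphere; a slight dilation pulls its support inside the ball. The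
averages are bounded on `L²(y^b)` because the mean of the weight over points below height `y` is at
most a constant times `y^b` (`exists_hw_average_le`).

Compactness: the flat trace of a function vanishing on the sphere differs in `L²` from its average
at scale `ε` by at most a multiple of `ε^((1-b)/2) ‖∇v‖`. At fixed `ε` the averages of a bounded,
weakly convergent sequence converge strongly, hence so do the traces (`tendsto_trace`). Along a
minimizing sequence the Laplacians converge weakly and the traces a.e. on a subsequence. Weak lower
semicontinuity of the norm and Fatou's lemma, with `F ≥ 0`, make the limit a minimizer.

Euler-Lagrange: elements of `MemH0` satisfy all the homogeneous boundary conditions. This is shown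
for the smooth core with cutoffs (`IsCore.normZ_lateral`, `IsCore.normZ_flat`), and the conditions
survive weak limits. Hence `u + tφ` is admissible for every `t`. Coercivity of `F` puts the trace of
`u` in `L^p`, the growth bound allows differentiation under the integral, and the derivative of the
energy at `t = 0` vanishes. -/

noncomputable section

namespace WeightedBilaplace

variable {n : ℕ} {b : ℝ}

/-! ### The splitting `ℝ^{n+1} = ℝ^n × ℝ` -/

/-- The coordinate `y` as a continuous linear map. -/
def ycoordL (n : ℕ) : Amb n →L[ℝ] ℝ := EuclideanSpace.proj (Fin.last n)

@[fun_prop] lemma continuous_ycoord : Continuous (ycoord (n := n)) := (ycoordL n).continuous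

@[fun_prop] lemma measurable_ycoord : Measurable (ycoord (n := n)) := continuous_ycoord.measurable

lemma ycoord_add (X Y : Amb n) : ycoord (X + Y) = ycoord X + ycoord Y := (ycoordL n).map_add X Y

lemma ycoord_sub (X Y : Amb n) : ycoord (X - Y) = ycoord X - ycoord Y := (ycoordL n).map_sub X Y

lemma ycoord_smul (c : ℝ) (X : Amb n) : ycoord (c • X) = c * ycoord X := (ycoordL n).map_smul c X

lemma abs_ycoord_le (X : Amb n) : |ycoord X| ≤ ‖X‖ := PiLp.norm_apply_le X (Fin.last n)

@[simp] lemma ycoord_pt (x : Thin n) (y : ℝ) : ycoord (pt x y) = y := by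
  simp [ycoord, pt]

lemma norm_pt_sq (x : Thin n) (y : ℝ) : ‖pt x y‖ ^ 2 = ‖x‖ ^ 2 + y ^ 2 := by
  simp [EuclideanSpace.norm_sq_eq, pt, Fin.sum_univ_castSucc]

lemma pt_add (x x' : Thin n) (y y' : ℝ) : pt (x + x') (y + y') = pt x y + pt x' y' := by
  ext i
  refine Fin.lastCases ?_ (fun j => ?_) i <;> simp [pt]

lemma pt_smul (c : ℝ) (x : Thin n) (y : ℝ) : pt (c • x) (c * y) = c • pt x y := by
  ext i
  refine Fin.lastCases ?_ (fun j => ?_) i <;> simp [pt]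

/-- `pt` as a continuous linear map. -/
def ptL (n : ℕ) : (Thin n × ℝ) →L[ℝ] Amb n :=
  LinearMap.toContinuousLinearMap
    { toFun := fun p => pt p.1 p.2
      map_add' := fun _ _ => pt_add _ _ _ _
      map_smul' := fun _ _ => pt_smul _ _ _ }

lemma measurePreserving_pt :
    MeasurePreserving (fun p : Thin n × ℝ => pt p.1 p.2) (volume.prod volume) volume := by
  have h1 := (volume_preserving_piFinSuccAbove (fun _ : Fin (n + 1) => ℝ) (Fin.last n)).symm
  have h2 := (EuclideanSpace.volume_preserving_symm_measurableEquiv_toLp (Fin (n + 1))).symm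
  have h3 := EuclideanSpace.volume_preserving_symm_measurableEquiv_toLp (Fin n)
  have h4 : MeasurePreserving (fun p : Thin n × ℝ =>
      (p.2, (MeasurableEquiv.toLp 2 (Fin n → ℝ)).symm p.1)) (volume.prod volume)
      (volume.prod volume) :=
    ((MeasurePreserving.id volume).prod h3).comp Measure.measurePreserving_swap
  have e : (fun p : Thin n × ℝ => pt p.1 p.2) =
      (MeasurableEquiv.toLp 2 (Fin (n + 1) → ℝ)).symm.symm ∘
      (MeasurableEquiv.piFinSuccAbove (fun _ => ℝ) (Fin.last n)).symm ∘
      fun p => (p.2, (MeasurableEquiv.toLp 2 (Fin n → ℝ)).symm p.1) := by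
    funext p
    ext i
    refine Fin.lastCases ?_ (fun j => ?_) i <;>
      simp [pt, MeasurableEquiv.piFinSuccAbove, Fin.insertNthEquiv]
  rw [e]
  exact h2.comp (h1.comp h4)

lemma exists_pt (X : Amb n) : ∃ x y, pt x y = X := by
  refine ⟨WithLp.toLp 2 fun i => X i.castSucc, ycoord X, ?_⟩
  ext i
  refine Fin.lastCases ?_ (fun j => ?_) i <;> simp [pt, ycoord]

lemma pt_injective : Function.Injective (fun p : Thin n × ℝ => pt p.1 p.2) := by
  intro p q h
  have h' : ptL n (p - q) = 0 := by
    rw [map_sub, sub_eq_zero]; exact h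
  have h2 := norm_pt_sq (p - q).1 (p - q).2
  have h3 : pt (p - q).1 (p - q).2 = 0 := h'
  rw [h3] at h2
  have h4 : (p - q).1 = 0 := by
    rw [← norm_eq_zero]
    nlinarith [sq_nonneg ‖(p - q).1‖, sq_nonneg (p - q).2, norm_zero (E := Amb n)]
  have h5 : (p - q).2 = 0 := by
    nlinarith [sq_nonneg ‖(p - q).1‖, sq_nonneg (p - q).2, norm_zero (E := Amb n)]
  exact sub_eq_zero.1 (Prod.ext h4 h5)

lemma measurableEmbedding_pt : MeasurableEmbedding (fun p : Thin n × ℝ => pt p.1 p.2) :=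
  (ptL n).continuous.measurableEmbedding pt_injective

/-- The height is the outer variable because the weight depends on it alone. `integral_amb` uses the
opposite order, which suits integrating `∂_y` along vertical lines. -/
lemma lintegral_amb {F : Amb n → ℝ≥0∞} (hF : Measurable F) :
    ∫⁻ X, F X = ∫⁻ y : ℝ, ∫⁻ x : Thin n, F (pt x y) := by
  rw [← measurePreserving_pt.lintegral_comp hF, lintegral_prod_symm']
  exact hF.comp (ptL n).continuous.measurable

lemma integral_amb {E : Type*} [NormedAddCommGroup E] [NormedSpace ℝ E] {F : Amb n → E}
    (hF : Integrable F) :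
    ∫ X, F X = ∫ x : Thin n, ∫ y : ℝ, F (pt x y) := by
  rw [← measurePreserving_pt.integral_comp measurableEmbedding_pt, integral_prod]
  exact (measurePreserving_pt.integrable_comp_emb measurableEmbedding_pt).2 hF

/-- Integrals of functions of `y` over subsets of a cylinder over the unit ball. -/
lemma setLIntegral_ycoord_le {S : Set (Amb n)} (hS : MeasurableSet S) {I : Set ℝ}
    (hI : MeasurableSet I) (hSI : ∀ x y, pt x y ∈ S → x ∈ flatBall n ∧ y ∈ I) {F : ℝ → ℝ≥0∞}
    (hF : Measurable F) :
    ∫⁻ X in S, F (ycoord X) ≤ volume (flatBall n) * ∫⁻ y in I, F y := by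
  rw [← lintegral_indicator hS, lintegral_amb (F := S.indicator fun X => F (ycoord X))
    ((hF.comp measurable_ycoord).indicator hS)]
  calc _ ≤ ∫⁻ y : ℝ, ∫⁻ x : Thin n, (flatBall n).indicator 1 x * I.indicator F y := by
        refine lintegral_mono fun y => lintegral_mono fun x => ?_
        by_cases h : pt x y ∈ S
        · simp [Set.indicator_of_mem h, Set.indicator_of_mem (hSI x y h).1,
            Set.indicator_of_mem (hSI x y h).2]
        · simp [Set.indicator_of_notMem h]
    _ = _ := by
        have hm : MeasurableSet (flatBall n) := Metric.isOpen_ball.measurableSet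
        rw [← lintegral_indicator hI, ← lintegral_const_mul _ (hF.indicator hI)]
        congr 1; ext y
        rw [lintegral_mul_const _ (measurable_one.indicator hm), lintegral_indicator_one hm]

/-! ### The weighted measure -/

lemma isOpen_halfBall : IsOpen (halfBall n) :=
  (isOpen_lt continuous_norm continuous_const).inter (isOpen_lt continuous_const continuous_ycoord)

lemma measurableSet_halfBall : MeasurableSet (halfBall n) := isOpen_halfBall.measurableSet

lemma mem_flatBall_of_pt_mem {x : Thin n} {y : ℝ} (h : pt x y ∈ halfBall n) :
    x ∈ flatBall n ∧ y ∈ Set.Ioo (0 : ℝ) 1 := by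
  have h2 := norm_pt_sq x y
  have h1 := h.1
  have h0 : 0 < y := by simpa using h.2
  have h3 : ‖pt x y‖ ^ 2 < 1 := by nlinarith [norm_nonneg (pt x y)]
  refine ⟨?_, h0, ?_⟩
  · simp only [flatBall, Metric.mem_ball, dist_zero_right]
    nlinarith [norm_nonneg x]
  · nlinarith [norm_nonneg x]

lemma measurable_weight : Measurable (fun X : Amb n => ENNReal.ofReal (ycoord X ^ b)) := by
  fun_prop

lemma lintegral_wMeas {F : Amb n → ℝ≥0∞} (hF : Measurable F) :
    ∫⁻ X, F X ∂(wMeas n b) = ∫⁻ X in halfBall n, ENNReal.ofReal (ycoord X ^ b) * F X :=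
  lintegral_withDensity_eq_lintegral_mul _ measurable_weight hF

/-- The weight is positive on the half ball, so weighted and Lebesgue null sets coincide there.
Weighted and unweighted identities can therefore share representatives. -/
lemma ae_wMeas_iff {P : Amb n → Prop} :
    (∀ᵐ X ∂(wMeas n b), P X) ↔ ∀ᵐ X ∂(volume.restrict (halfBall n)), P X := by
  rw [wMeas, ae_withDensity_iff measurable_weight]
  refine eventually_congr ?_
  filter_upwards [ae_restrict_mem measurableSet_halfBall] with X hX
  have : ENNReal.ofReal (ycoord X ^ b) ≠ 0 := by
    simpa using Real.rpow_pos_of_pos hX.2 b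
  simp [this]

lemma ae_mem_halfBall : ∀ᵐ X ∂(wMeas n b), X ∈ halfBall n :=
  ae_wMeas_iff.2 (ae_restrict_mem measurableSet_halfBall)

lemma ae_eq_wMeas_iff {E : Type*} {u v : Amb n → E} :
    u =ᵐ[wMeas n b] v ↔ u =ᵐ[volume.restrict (halfBall n)] v := ae_wMeas_iff

lemma integral_wMeas {E : Type*} [NormedAddCommGroup E] [NormedSpace ℝ E] (F : Amb n → E) :
    ∫ X, F X ∂(wMeas n b) = ∫ X in halfBall n, ycoord X ^ b • F X := by
  rw [wMeas, integral_withDensity_eq_integral_toReal_smul₀ measurable_weight.aemeasurable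
    (ae_of_all _ fun _ => ENNReal.ofReal_lt_top)]
  refine setIntegral_congr_fun measurableSet_halfBall fun X hX => ?_
  rw [ENNReal.toReal_ofReal (Real.rpow_nonneg hX.2.le b)]

lemma integrable_wMeas_iff {E : Type*} [NormedAddCommGroup E] [NormedSpace ℝ E] {F : Amb n → E} :
    Integrable F (wMeas n b) ↔ IntegrableOn (fun X => ycoord X ^ b • F X) (halfBall n) := by
  rw [wMeas, integrable_withDensity_iff_integrable_smul' measurable_weight
    (ae_of_all _ fun _ => ENNReal.ofReal_lt_top)]
  refine integrable_congr ?_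
  filter_upwards [ae_restrict_mem measurableSet_halfBall] with X hX
  rw [ENNReal.toReal_ofReal (Real.rpow_nonneg hX.2.le b)]

/-- The half ball lies in the cylinder over the unit ball with heights in `(0, 1)`, so only
integrability of `t^a` at `0` matters. It is needed for the exponents `b`, `-b` and later `β - 1`.
-/
lemma integrableOn_rpow_halfBall {a : ℝ} (ha : -1 < a) :
    IntegrableOn (fun X : Amb n => ycoord X ^ a) (halfBall n) := by
  refine ⟨Measurable.aestronglyMeasurable (by fun_prop), ?_⟩
  rw [hasFiniteIntegral_iff_enorm]
  have h1 : ∫⁻ X in halfBall n, ‖ycoord X ^ a‖ₑ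
      ≤ volume (flatBall n) * ∫⁻ y in Set.Ioo (0 : ℝ) 1, ‖y ^ a‖ₑ :=
    setLIntegral_ycoord_le measurableSet_halfBall measurableSet_Ioo
      (fun x y => mem_flatBall_of_pt_mem) (F := fun y => ‖y ^ a‖ₑ) (by fun_prop)
  refine h1.trans_lt (ENNReal.mul_lt_top measure_ball_lt_top ?_)
  have := (intervalIntegral.integrableOn_Ioo_rpow_iff (s := a) (t := 1) one_pos).2 ha
  exact this.2

lemma isFiniteMeasure_wMeas (hb : -1 < b) : IsFiniteMeasure (wMeas n b) := by
  refine isFiniteMeasure_withDensity ?_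
  have h := (integrableOn_rpow_halfBall (n := n) hb).2
  rw [hasFiniteIntegral_iff_enorm] at h
  refine (lt_of_le_of_lt ?_ h).ne
  refine lintegral_mono fun X => ?_
  exact Real.ofReal_le_enorm _

lemma memLp_rpow_neg (hb' : b < 1) : MemLp (fun X : Amb n => ycoord X ^ (-b)) 2 (wMeas n b) := by
  rw [memLp_two_iff_integrable_sq, integrable_wMeas_iff]
  · refine (integrableOn_rpow_halfBall (n := n) (a := -b) (by linarith)).congr_fun ?_
      measurableSet_halfBall
    intro X hX
    simp only [smul_eq_mul]
    rw [← Real.rpow_natCast, ← Real.rpow_mul hX.2.le, ← Real.rpow_add hX.2]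
    congr 1; push_cast; ring
  · exact Measurable.aestronglyMeasurable (by fun_prop)

variable {E : Type*} [NormedAddCommGroup E] [NormedSpace ℝ E]

/-- Cauchy-Schwarz against `y^(-b)`, which lies in `L²(y^b)` because `b < 1`. It makes the
unweighted Gauss-Green integrals converge up to the flat boundary. -/
lemma MemLp.integrableOn_halfBall (hb' : b < 1) {u : Amb n → E} (hu : MemLp u 2 (wMeas n b)) :
    IntegrableOn u (halfBall n) := by
  have h : Integrable (fun X => ycoord X ^ (-b) • u X) (wMeas n b) :=
    memLp_one_iff_integrable.1 (hu.smul (memLp_rpow_neg hb'))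
  rw [integrable_wMeas_iff] at h
  refine IntegrableOn.congr_fun h ?_ measurableSet_halfBall
  intro X hX
  simp only
  rw [smul_smul, ← Real.rpow_add hX.2]; simp

lemma MemLp.locallyIntegrableOn_halfBall (hb' : b < 1) {u : Amb n → E}
    (hu : MemLp u 2 (wMeas n b)) : LocallyIntegrableOn u (halfBall n) :=
  (MemLp.integrableOn_halfBall hb' hu).locallyIntegrableOn

/-! ### Gradients and test functions -/

lemma ycoord_gradient (φ : Amb n → ℝ) (X : Amb n) :
    ycoord (∇ φ X) = fderiv ℝ φ X (pt 0 1) := by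
  rw [← inner_gradient_left]
  simp only [ycoord, pt, PiLp.inner_apply, Fin.sum_univ_castSucc]
  simp

lemma norm_gradient (φ : Amb n → ℝ) (X : Amb n) : ‖∇ φ X‖ = ‖fderiv ℝ φ X‖ := by
  simp [gradient]

lemma gradient_mul {φ ψ : Amb n → ℝ} {X : Amb n} (hφ : DifferentiableAt ℝ φ X)
    (hψ : DifferentiableAt ℝ ψ X) :
    ∇ (fun X => φ X * ψ X) X = φ X • ∇ ψ X + ψ X • ∇ φ X := by
  simp [gradient, fderiv_fun_mul hφ hψ]

lemma continuous_gradient {φ : Amb n → ℝ} (hφ : ContDiff ℝ 1 φ) : Continuous (∇ φ) :=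
  (LinearIsometryEquiv.continuous _).comp (hφ.continuous_fderiv one_ne_zero)

lemma support_gradient_subset (φ : Amb n → ℝ) : Function.support (∇ φ) ⊆ tsupport φ := by
  intro X hX
  refine support_fderiv_subset ℝ (f := φ) ?_
  intro h
  exact hX (by simp [gradient, h])

lemma gradient_eq_zero_of_notMem_tsupport {φ : Amb n → ℝ} {X : Amb n} (hX : X ∉ tsupport φ) :
    ∇ φ X = 0 := by
  by_contra h
  exact hX (support_gradient_subset φ h)

namespace IsTest

variable {U V : Set (Amb n)} {φ ψ : Amb n → ℝ}

lemma mono (h : IsTest U φ) (hUV : U ⊆ V) : IsTest V φ := ⟨h.smooth, h.compact, h.supp.trans hUV⟩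

lemma differentiable (h : IsTest U φ) : Differentiable ℝ φ := h.smooth.differentiable (by simp)

lemma continuous (h : IsTest U φ) : Continuous φ := h.smooth.continuous

lemma continuous_gradient (h : IsTest U φ) : Continuous (∇ φ) :=
  WeightedBilaplace.continuous_gradient (h.smooth.of_le (by exact_mod_cast le_top))

lemma hasCompactSupport_gradient (h : IsTest U φ) : HasCompactSupport (∇ φ) :=
  h.compact.mono' (support_gradient_subset φ)

lemma zero_of_notMem (h : IsTest U φ) {X : Amb n} (hX : X ∉ U) : φ X = 0 :=
  image_eq_zero_of_notMem_tsupport fun h' => hX (h.supp h')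

lemma gradient_zero_of_notMem (h : IsTest U φ) {X : Amb n} (hX : X ∉ U) : ∇ φ X = 0 :=
  gradient_eq_zero_of_notMem_tsupport fun h' => hX (h.supp h')

lemma memLp (h : IsTest U φ) {μ : Measure (Amb n)} [IsFiniteMeasureOnCompacts μ] {p : ℝ≥0∞} :
    MemLp φ p μ := h.continuous.memLp_of_hasCompactSupport h.compact

lemma memLp_gradient (h : IsTest U φ) {μ : Measure (Amb n)} [IsFiniteMeasureOnCompacts μ]
    {p : ℝ≥0∞} : MemLp (∇ φ) p μ :=
  h.continuous_gradient.memLp_of_hasCompactSupport h.hasCompactSupport_gradient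

lemma add (h : IsTest U φ) (h' : IsTest U ψ) : IsTest U (φ + ψ) :=
  ⟨h.smooth.add h'.smooth, h.compact.add h'.compact,
    (tsupport_add φ ψ).trans (Set.union_subset h.supp h'.supp)⟩

lemma mul_left (h : IsTest U φ) (hψ : ContDiff ℝ ∞ ψ) : IsTest U (fun X => ψ X * φ X) :=
  ⟨hψ.mul h.smooth, h.compact.mul_left, (tsupport_mul_subset_right).trans h.supp⟩

lemma const_smul (h : IsTest U φ) (c : ℝ) : IsTest U (c • φ) :=
  ⟨h.smooth.const_smul c, h.compact.smul_left (f := fun _ => c),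
    (tsupport_smul_subset_right (fun _ => c) φ).trans h.supp⟩

lemma mul (h : IsTest U φ) (h' : IsTest V ψ) : IsTest (U ∩ V) (fun X => φ X * ψ X) :=
  ⟨h.smooth.mul h'.smooth, h.compact.mul_right,
    Set.subset_inter (tsupport_mul_subset_left.trans h.supp)
      (tsupport_mul_subset_right.trans h'.supp)⟩

end IsTest

lemma halfBall_eq_inter : halfBall n = Metric.ball 0 1 ∩ {X | 0 < ycoord X} := by
  ext X; simp [halfBall]

/-- Smooth cutoffs in the unit ball. -/
lemma exists_cutoff {K : Set (Amb n)} (hK : IsCompact K) (hK1 : K ⊆ Metric.ball 0 1) :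
    ∃ η : Amb n → ℝ, IsTest (Metric.ball 0 1) η ∧ ∀ X ∈ K, η =ᶠ[𝓝 X] 1 := by
  obtain ⟨r, hr, hKr⟩ := exists_lt_subset_ball hK.isClosed hK1
  -- `r` may be nonpositive; the maximum provides a positive inner radius still below `1`.
  set s := max r (1 / 2)
  have hs : s < 1 := max_lt hr (by norm_num)
  have hs0 : 0 < s := lt_of_lt_of_le (by norm_num) (le_max_right _ _)
  let f : ContDiffBump (0 : Amb n) := ⟨s, (1 + s) / 2, hs0, by linarith⟩
  refine ⟨f, ⟨f.contDiff, f.hasCompactSupport, ?_⟩, fun X hX => ?_⟩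
  · rw [f.tsupport_eq]
    exact Metric.closedBall_subset_ball (by change (1 + s) / 2 < 1; linarith)
  · exact f.eventuallyEq_one_of_mem_ball
      (Metric.ball_subset_ball (le_max_left _ _) (hKr hX))

/-! ### Integrability -/

section Integrability

variable {α F : Type*} [MeasurableSpace α] {m : Measure α} [NormedAddCommGroup F]
  [InnerProductSpace ℝ F]

lemma integrable_inner_of_memLp {u v : α → F} (hu : MemLp u 2 m) (hv : MemLp v 2 m) :
    Integrable (fun a => inner ℝ (u a) (v a)) m := by
  refine (hu.norm.integrable_mul hv.norm).mono (hu.1.inner hv.1) (ae_of_all _ fun a => ?_)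
  simpa using norm_inner_le_norm (𝕜 := ℝ) (u a) (v a)

lemma integrable_mul_of_memLp {u v : α → ℝ} (hu : MemLp u 2 m) (hv : MemLp v 2 m) :
    Integrable (fun a => u a * v a) m := hu.integrable_mul hv

end Integrability

section Local

variable {E : Type*} [NormedAddCommGroup E] [NormedSpace ℝ E] {V : Type*} [NormedAddCommGroup V]
  [MeasurableSpace V] [BorelSpace V] {m : Measure V}

lemma integrable_smul_of_tsupport_subset {u : V → E} {U : Set V} (hU : MeasurableSet U)
    (hu : LocallyIntegrableOn u U m) {φ : V → ℝ} (hφ : Continuous φ) (hc : HasCompactSupport φ)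
    (hs : tsupport φ ⊆ U) : IntegrableOn (fun X => φ X • u X) U m := by
  have h1 : IntegrableOn (fun X => φ X • u X) (tsupport φ) m :=
    (hu.integrableOn_compact_subset hs hc).continuousOn_smul hφ.continuousOn hc
  refine h1.of_forall_sdiff_eq_zero hU fun X hX => ?_
  rw [image_eq_zero_of_notMem_tsupport hX.2, zero_smul]

end Local

lemma IntegrableOn.test_smul {E : Type*} [NormedAddCommGroup E] [NormedSpace ℝ E]
    {u : Amb n → E} {U S : Set (Amb n)} (hu : IntegrableOn u S) {φ : Amb n → ℝ}
    (hφ : IsTest U φ) : IntegrableOn (fun X => φ X • u X) S := by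
  have h1 : MemLp φ ⊤ (volume.restrict S) :=
    hφ.continuous.memLp_top_of_hasCompactSupport hφ.compact _
  exact memLp_one_iff_integrable.1 ((memLp_one_iff_integrable.2 hu).smul h1)

lemma IntegrableOn.smul_test_gradient {u : Amb n → ℝ} {U S : Set (Amb n)}
    (hu : IntegrableOn u S) {φ : Amb n → ℝ}
    (hφ : IsTest U φ) : IntegrableOn (fun X => u X • ∇ φ X) S := by
  have h1 : MemLp (∇ φ) ⊤ (volume.restrict S) :=
    hφ.continuous_gradient.memLp_top_of_hasCompactSupport hφ.hasCompactSupport_gradient _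
  exact memLp_one_iff_integrable.1 (h1.smul (memLp_one_iff_integrable.2 hu))

/-! ### Weak gradients and weak Laplacians -/

/-- The fundamental lemma of the calculus of variations on the open half ball. It makes the choice
in `weakGrad` immaterial. -/
lemma IsWeakGrad.ae_eq {w : Amb n → ℝ} {G G' : Amb n → Amb n} (h : IsWeakGrad w G)
    (h' : IsWeakGrad w G') : G =ᵐ[volume.restrict (halfBall n)] G' := by
  have key := isOpen_halfBall.ae_eq_zero_of_integral_contDiff_smul_eq_zero (μ := volume)
    (h.locInt_grad.sub h'.locInt_grad) fun φ hφ hc hs => by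
    have ht : IsTest (halfBall n) φ := ⟨hφ, hc, hs⟩
    have hi := integrable_smul_of_tsupport_subset measurableSet_halfBall h.locInt_grad
      hφ.continuous hc hs
    have hi' := integrable_smul_of_tsupport_subset measurableSet_halfBall h'.locInt_grad
      hφ.continuous hc hs
    rw [← setIntegral_eq_integral_of_forall_compl_eq_zero (s := halfBall n)]
    · simp only [Pi.sub_apply, smul_sub]
      rw [integral_sub hi hi', ← neg_inj, neg_sub, sub_eq_neg_add, ← h.parts φ ht, h'.parts φ ht]
      simp
    · intro X hX
      rw [ht.zero_of_notMem hX, zero_smul]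
  rw [EventuallyEq, ae_restrict_iff' measurableSet_halfBall]
  filter_upwards [key] with X hX hXB
  exact sub_eq_zero.1 (hX hXB)

lemma isWeakGrad_weakGrad {w : Amb n → ℝ} (h : ∃ G, IsWeakGrad w G) :
    IsWeakGrad w (weakGrad w) := by
  rw [weakGrad, dif_pos h]
  exact h.choose_spec

lemma isWeakLap_weakLap {w : Amb n → ℝ} (h : ∃ v, IsWeakLap b w v) :
    IsWeakLap b w (weakLap b w) := by
  rw [weakLap, dif_pos h]
  exact h.choose_spec

lemma continuousOn_weight : ContinuousOn (fun X : Amb n => ycoord X ^ b) (halfBall n) :=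
  continuous_ycoord.continuousOn.rpow_const fun _ hX => Or.inl hX.2.ne'

/-- The fundamental lemma is applied to `y^b (h - h')`, and the positive weight is then divided out.
-/
lemma IsWeakLap.ae_eq {w h h' : Amb n → ℝ} (hw : IsWeakLap b w h) (hw' : IsWeakLap b w h') :
    h =ᵐ[wMeas n b] h' := by
  have l := hw.locInt.continuousOn_smul isOpen_halfBall.isLocallyClosed
    (continuousOn_weight (b := b))
  have l' :=
    hw'.locInt.continuousOn_smul isOpen_halfBall.isLocallyClosed
    (continuousOn_weight (b := b))
  have key := isOpen_halfBall.ae_eq_zero_of_integral_contDiff_smul_eq_zero (μ := volume)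
    (l.sub l') fun φ hφ hc hs => by
    have ht : IsTest (halfBall n) φ := ⟨hφ, hc, hs⟩
    have hi := integrable_smul_of_tsupport_subset measurableSet_halfBall l hφ.continuous hc hs
    have hi' := integrable_smul_of_tsupport_subset measurableSet_halfBall l' hφ.continuous hc hs
    rw [← setIntegral_eq_integral_of_forall_compl_eq_zero (s := halfBall n)]
    · simp only [Pi.sub_apply, smul_sub]
      rw [integral_sub hi hi']
      have e : ∀ k : Amb n → ℝ, ∫ X in halfBall n, φ X • ycoord X ^ b • k X
          = ∫ X, k X * φ X ∂(wMeas n b) := fun k => by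
        rw [integral_wMeas]
        refine setIntegral_congr_fun measurableSet_halfBall fun X _ => ?_
        simp only [smul_eq_mul]; ring
      have h1 := hw.parts φ ht
      rw [hw'.parts φ ht] at h1
      rw [e, e]; linarith
    · intro X hX
      rw [ht.zero_of_notMem hX, zero_smul]
  rw [ae_eq_wMeas_iff, EventuallyEq, ae_restrict_iff' measurableSet_halfBall]
  filter_upwards [key] with X hX hXB
  have h1 := hX hXB
  simp only [Pi.sub_apply, smul_eq_mul, ← mul_sub] at h1
  have h2 := (mul_eq_zero.1 h1).resolve_left (Real.rpow_pos_of_pos hXB.2 b).ne'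
  linarith

/-- `v` has weak gradient `G` and weak weighted Laplacian `h`, all in `L^2(y^b)`. -/
structure Triple (b : ℝ) (v : Amb n → ℝ) (G : Amb n → Amb n) (h : Amb n → ℝ) : Prop where
  memLp : MemLp v 2 (wMeas n b)
  memLp_grad : MemLp G 2 (wMeas n b)
  memLp_lap : MemLp h 2 (wMeas n b)
  parts_grad : ∀ φ : Amb n → ℝ, IsTest (halfBall n) φ →
    ∫ X in halfBall n, (v X • ∇ φ X + φ X • G X) = 0
  parts_lap : ∀ φ : Amb n → ℝ, IsTest (halfBall n) φ →
    ∫ X, (inner ℝ (G X) (∇ φ X) + h X * φ X) ∂(wMeas n b) = 0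

/-! ### Integrability and linearity of the Gauss-Green and Green pairings. -/

section Pairings

variable {v v' h h' φ : Amb n → ℝ} {G G' : Amb n → Amb n} {U : Set (Amb n)}

lemma integrableOn_pairing (hb' : b < 1) (hv : MemLp v 2 (wMeas n b))
    (hG : MemLp G 2 (wMeas n b)) (hφ : IsTest U φ) :
    IntegrableOn (fun X => v X • ∇ φ X + φ X • G X) (halfBall n) :=
  (IntegrableOn.smul_test_gradient (MemLp.integrableOn_halfBall hb' hv) hφ).add
    (IntegrableOn.test_smul (MemLp.integrableOn_halfBall hb' hG) hφ)

lemma integrable_pairing (hb : -1 < b) (hG : MemLp G 2 (wMeas n b))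
    (hh : MemLp h 2 (wMeas n b)) (hφ : IsTest U φ) :
    Integrable (fun X => inner ℝ (G X) (∇ φ X) + h X * φ X) (wMeas n b) := by
  have := isFiniteMeasure_wMeas (n := n) hb
  exact (integrable_inner_of_memLp hG hφ.memLp_gradient).add (integrable_mul_of_memLp hh hφ.memLp)

lemma integral_pairing_eq (hb : -1 < b) (hG : MemLp G 2 (wMeas n b))
    (hh : MemLp h 2 (wMeas n b)) (hφ : IsTest U φ) :
    ∫ X, (inner ℝ (G X) (∇ φ X) + h X * φ X) ∂(wMeas n b) =
      ∫ X, inner ℝ (G X) (∇ φ X) ∂(wMeas n b) + ∫ X, h X * φ X ∂(wMeas n b) := by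
  have := isFiniteMeasure_wMeas (n := n) hb
  exact integral_add (integrable_inner_of_memLp hG hφ.memLp_gradient)
    (integrable_mul_of_memLp hh hφ.memLp)

lemma integral_pairing_add (hb' : b < 1) (hv : MemLp v 2 (wMeas n b))
    (hG : MemLp G 2 (wMeas n b)) (hv' : MemLp v' 2 (wMeas n b))
    (hG' : MemLp G' 2 (wMeas n b)) (hφ : IsTest U φ) (c : ℝ) :
    ∫ X in halfBall n, ((v + c • v') X • ∇ φ X + φ X • (G + c • G') X) =
      (∫ X in halfBall n, (v X • ∇ φ X + φ X • G X))
        + c • ∫ X in halfBall n, (v' X • ∇ φ X + φ X • G' X) := by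
  have hi : IntegrableOn (fun X => c • (v' X • ∇ φ X + φ X • G' X)) (halfBall n) :=
    (integrableOn_pairing hb' hv' hG' hφ).smul c
  rw [← integral_smul, ← integral_add (integrableOn_pairing hb' hv hG hφ) hi]
  congr 1; ext1 X
  simp only [Pi.add_apply, Pi.smul_apply, smul_eq_mul]
  module

lemma integral_wpairing_add (hb : -1 < b) (hG : MemLp G 2 (wMeas n b))
    (hh : MemLp h 2 (wMeas n b)) (hG' : MemLp G' 2 (wMeas n b))
    (hh' : MemLp h' 2 (wMeas n b)) (hφ : IsTest U φ) (c : ℝ) :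
    ∫ X, (inner ℝ ((G + c • G') X) (∇ φ X) + (h + c • h') X * φ X) ∂(wMeas n b) =
      ∫ X, (inner ℝ (G X) (∇ φ X) + h X * φ X) ∂(wMeas n b)
        + c • ∫ X, (inner ℝ (G' X) (∇ φ X) + h' X * φ X) ∂(wMeas n b) := by
  have hi : Integrable (fun X => c • (inner ℝ (G' X) (∇ φ X) + h' X * φ X)) (wMeas n b) :=
    (integrable_pairing hb hG' hh' hφ).smul c
  rw [← integral_smul, ← integral_add (integrable_pairing hb hG hh hφ) hi]
  congr 1; ext1 X
  simp only [Pi.add_apply, Pi.smul_apply, smul_eq_mul, inner_add_left, inner_smul_left]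
  simp only [conj_trivial]; ring

end Pairings

namespace Triple

variable {v v' h h' : Amb n → ℝ} {G G' : Amb n → Amb n}

lemma isWeakGrad (hb' : b < 1) (t : Triple b v G h) : IsWeakGrad v G where
  locInt_fun := MemLp.locallyIntegrableOn_halfBall hb' t.memLp
  locInt_grad := MemLp.locallyIntegrableOn_halfBall hb' t.memLp_grad
  parts φ hφ := by
    have h := t.parts_grad φ hφ
    rw [integral_add (IntegrableOn.smul_test_gradient (MemLp.integrableOn_halfBall hb' t.memLp) hφ)
      (IntegrableOn.test_smul (MemLp.integrableOn_halfBall hb' t.memLp_grad) hφ)] at h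
    exact eq_neg_of_add_eq_zero_left h

lemma weakGrad_ae_eq (hb' : b < 1) (t : Triple b v G h) : weakGrad v =ᵐ[wMeas n b] G :=
  ae_eq_wMeas_iff.2 ((isWeakGrad_weakGrad ⟨G, t.isWeakGrad hb'⟩).ae_eq (t.isWeakGrad hb'))

lemma congr (t : Triple b v G h) (hv : v =ᵐ[wMeas n b] v') (hG : G =ᵐ[wMeas n b] G')
    (hh : h =ᵐ[wMeas n b] h') : Triple b v' G' h' where
  memLp := t.memLp.ae_eq hv
  memLp_grad := t.memLp_grad.ae_eq hG
  memLp_lap := t.memLp_lap.ae_eq hh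
  parts_grad φ hφ := by
    rw [← t.parts_grad φ hφ]
    refine integral_congr_ae ?_
    filter_upwards [ae_eq_wMeas_iff.1 hv, ae_eq_wMeas_iff.1 hG] with X h1 h2
    rw [h1, h2]
  parts_lap φ hφ := by
    rw [← t.parts_lap φ hφ]
    refine integral_congr_ae ?_
    filter_upwards [hG, hh] with X h1 h2
    rw [h1, h2]

lemma isWeakLap (hb : -1 < b) (hb' : b < 1) (t : Triple b v G h) : IsWeakLap b v h where
  locInt := MemLp.locallyIntegrableOn_halfBall hb' t.memLp_lap
  parts φ hφ := by
    -- `IsWeakLap` is phrased with the chosen `weakGrad v`, so `G` is replaced by it first.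
    have t' := t.congr (ae_eq_refl _) (t.weakGrad_ae_eq hb').symm (ae_eq_refl _)
    have h := t'.parts_lap φ hφ
    rw [integral_pairing_eq hb t'.memLp_grad t.memLp_lap hφ] at h
    exact eq_neg_of_add_eq_zero_left h

lemma weakLap_ae_eq (hb : -1 < b) (hb' : b < 1) (t : Triple b v G h) :
    weakLap b v =ᵐ[wMeas n b] h :=
  (isWeakLap_weakLap ⟨h, t.isWeakLap hb hb'⟩).ae_eq (t.isWeakLap hb hb')

lemma memH (hb : -1 < b) (hb' : b < 1) (t : Triple b v G h) : MemH b v where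
  memH1 := ⟨t.memLp, ⟨G, t.isWeakGrad hb'⟩, t.memLp_grad.ae_eq (t.weakGrad_ae_eq hb').symm⟩
  weakLap_exists := ⟨h, t.isWeakLap hb hb'⟩
  lap_memLp := t.memLp_lap.ae_eq (t.weakLap_ae_eq hb hb').symm

lemma add_smul (hb : -1 < b) (hb' : b < 1) (t : Triple b v G h) (t' : Triple b v' G' h') (c : ℝ) :
    Triple b (v + c • v') (G + c • G') (h + c • h') where
  memLp := t.memLp.add (t'.memLp.const_smul c)
  memLp_grad := t.memLp_grad.add (t'.memLp_grad.const_smul c)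
  memLp_lap := t.memLp_lap.add (t'.memLp_lap.const_smul c)
  parts_grad φ hφ := by
    rw [integral_pairing_add hb' t.memLp t.memLp_grad t'.memLp t'.memLp_grad hφ,
      t.parts_grad φ hφ, t'.parts_grad φ hφ, smul_zero, add_zero]
  parts_lap φ hφ := by
    rw [integral_wpairing_add hb t.memLp_grad t.memLp_lap t'.memLp_grad t'.memLp_lap hφ,
      t.parts_lap φ hφ, t'.parts_lap φ hφ, smul_zero, add_zero]

end Triple

lemma MemH.triple (hb : -1 < b) (hb' : b < 1) {w : Amb n → ℝ} (hw : MemH b w) :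
    Triple b w (weakGrad w) (weakLap b w) where
  memLp := hw.memH1.memLp
  memLp_grad := hw.memH1.grad_memLp
  memLp_lap := hw.lap_memLp
  parts_grad φ hφ := by
    rw [integral_add (IntegrableOn.smul_test_gradient
      (MemLp.integrableOn_halfBall hb' hw.memH1.memLp) hφ)
      (IntegrableOn.test_smul (MemLp.integrableOn_halfBall hb' hw.memH1.grad_memLp) hφ),
      (isWeakGrad_weakGrad hw.memH1.weakDiff).parts φ hφ, neg_add_cancel]
  parts_lap φ hφ := by
    rw [integral_pairing_eq hb hw.memH1.grad_memLp hw.lap_memLp hφ,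
      (isWeakLap_weakLap hw.weakLap_exists).parts φ hφ, neg_add_cancel]

lemma MemH.add_smul {w w' : Amb n → ℝ} (hb : -1 < b) (hb' : b < 1) (hw : MemH b w)
    (hw' : MemH b w') (c : ℝ) :
    MemH b (w + c • w') :=
  ((hw.triple hb hb').add_smul hb hb' (hw'.triple hb hb') c).memH hb hb'


/-! ### The boundary conditions in terms of triples -/

/-- The lateral Dirichlet condition for `v` with gradient `G`. -/
def LatZ (v : Amb n → ℝ) (G : Amb n → Amb n) : Prop :=
  ∀ φ : Amb n → ℝ, IsTest {X | 0 < ycoord X} φ →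
    ∫ X in halfBall n, (v X • ∇ φ X + φ X • G X) = 0

/-- The Neumann condition for the field `G` with weighted divergence `h`, for tests in `U`. -/
def NormZ (b : ℝ) (U : Set (Amb n)) (G : Amb n → Amb n) (h : Amb n → ℝ) : Prop :=
  ∀ φ : Amb n → ℝ, IsTest U φ →
    ∫ X, (inner ℝ (G X) (∇ φ X) + h X * φ X) ∂(wMeas n b) = 0

section BC

variable {v v' h h' : Amb n → ℝ} {G G' : Amb n → Amb n} {U : Set (Amb n)}

lemma LatZ.congr (l : LatZ v G) (hv : v =ᵐ[wMeas n b] v') (hG : G =ᵐ[wMeas n b] G') :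
    LatZ v' G' := fun φ hφ => by
  rw [← l φ hφ]
  refine integral_congr_ae ?_
  filter_upwards [ae_eq_wMeas_iff.1 hv, ae_eq_wMeas_iff.1 hG] with X h1 h2
  rw [h1, h2]

lemma NormZ.congr (l : NormZ b U G h) (hG : G =ᵐ[wMeas n b] G') (hh : h =ᵐ[wMeas n b] h') :
    NormZ b U G' h' := fun φ hφ => by
  rw [← l φ hφ]
  refine integral_congr_ae ?_
  filter_upwards [hG, hh] with X h1 h2
  rw [h1, h2]

lemma normZ_iff (hb : -1 < b) (hG : MemLp G 2 (wMeas n b)) (hh : MemLp h 2 (wMeas n b)) :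
    NormZ b U G h ↔ ∀ φ : Amb n → ℝ, IsTest U φ →
      ∫ X, inner ℝ (G X) (∇ φ X) ∂(wMeas n b) + ∫ X, h X * φ X ∂(wMeas n b) = 0 :=
  forall₂_congr fun φ hφ => by rw [integral_pairing_eq hb hG hh hφ]

lemma lateralZero_iff (hb' : b < 1) (t : Triple b v G h) : LateralZero v ↔ LatZ v G :=
  ⟨fun l => LatZ.congr (b := b) l (ae_eq_refl _) (t.weakGrad_ae_eq hb'),
    fun l => LatZ.congr (b := b) l (ae_eq_refl _) (t.weakGrad_ae_eq hb').symm⟩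

lemma normZ_weak_iff (hb : -1 < b) (hb' : b < 1) (t : Triple b v G h) :
    NormZ b U (weakGrad v) (weakLap b v) ↔ NormZ b U G h :=
  ⟨fun l => l.congr (t.weakGrad_ae_eq hb') (t.weakLap_ae_eq hb hb'),
    fun l => l.congr (t.weakGrad_ae_eq hb').symm (t.weakLap_ae_eq hb hb').symm⟩

lemma lateralNormalZero_iff (hb : -1 < b) (hb' : b < 1) (t : Triple b v G h) :
    LateralNormalZero b v ↔ NormZ b {X | 0 < ycoord X} G h := by
  have m := t.memH hb hb'
  rw [← normZ_weak_iff hb hb' t, normZ_iff hb m.memH1.grad_memLp m.lap_memLp]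
  rfl

lemma flatConormalZero_iff (hb : -1 < b) (hb' : b < 1) (t : Triple b v G h) :
    FlatConormalZero b v ↔ NormZ b (Metric.ball 0 1) G h := by
  have m := t.memH hb hb'
  rw [← normZ_weak_iff hb hb' t, normZ_iff hb m.memH1.grad_memLp m.lap_memLp]
  rfl

lemma LatZ.add_smul (hb' : b < 1) (t : Triple b v G h) (t' : Triple b v' G' h') (l : LatZ v G)
    (l' : LatZ v' G') (c : ℝ) : LatZ (v + c • v') (G + c • G') := fun φ hφ => by
  rw [integral_pairing_add hb' t.memLp t.memLp_grad t'.memLp t'.memLp_grad hφ,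
      l φ hφ, l' φ hφ, smul_zero, add_zero]

lemma NormZ.add_smul (hb : -1 < b) (t : Triple b v G h) (t' : Triple b v' G' h')
    (l : NormZ b U G h) (l' : NormZ b U G' h') (c : ℝ) :
    NormZ b U (G + c • G') (h + c • h') := fun φ hφ => by
  rw [integral_wpairing_add hb t.memLp_grad t.memLp_lap t'.memLp_grad t'.memLp_lap hφ,
      l φ hφ, l' φ hφ, smul_zero, add_zero]

end BC

section LinearBC

variable {w w' : Amb n → ℝ}

lemma LateralZero.add_smul (hb : -1 < b) (hb' : b < 1) (hw : MemH b w) (hw' : MemH b w')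
    (l : LateralZero w) (l' : LateralZero w') (c : ℝ) : LateralZero (w + c • w') :=
  (lateralZero_iff hb' ((hw.triple hb hb').add_smul hb hb' (hw'.triple hb hb') c)).2
    (LatZ.add_smul hb' (hw.triple hb hb') (hw'.triple hb hb') l l' c)

lemma LateralNormalZero.add_smul (hb : -1 < b) (hb' : b < 1) (hw : MemH b w) (hw' : MemH b w')
    (l : LateralNormalZero b w) (l' : LateralNormalZero b w') (c : ℝ) :
    LateralNormalZero b (w + c • w') :=
  (lateralNormalZero_iff hb hb' ((hw.triple hb hb').add_smul hb hb' (hw'.triple hb hb') c)).2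
    (((lateralNormalZero_iff hb hb' (hw.triple hb hb')).1 l).add_smul hb (hw.triple hb hb')
      (hw'.triple hb hb') ((lateralNormalZero_iff hb hb' (hw'.triple hb hb')).1 l') c)

lemma FlatConormalZero.add_smul (hb : -1 < b) (hb' : b < 1) (hw : MemH b w) (hw' : MemH b w')
    (l : FlatConormalZero b w) (l' : FlatConormalZero b w') (c : ℝ) :
    FlatConormalZero b (w + c • w') :=
  (flatConormalZero_iff hb hb' ((hw.triple hb hb').add_smul hb hb' (hw'.triple hb hb') c)).2
    (((flatConormalZero_iff hb hb' (hw.triple hb hb')).1 l).add_smul hb (hw.triple hb hb')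
      (hw'.triple hb hb') ((flatConormalZero_iff hb hb' (hw'.triple hb hb')).1 l') c)

end LinearBC

/-! ### Change of variables -/

lemma lintegral_comp_add_smul {V : Type*} [NormedAddCommGroup V] [NormedSpace ℝ V]
    [MeasurableSpace V] [BorelSpace V] [FiniteDimensional ℝ V] (m : Measure V)
    [m.IsAddHaarMeasure] {F : V → ℝ≥0∞} (hF : Measurable F) (a : V) {r : ℝ} (hr : r ≠ 0) :
    ∫⁻ x, F (a + r • x) ∂m = ENNReal.ofReal |(r ^ Module.finrank ℝ V)⁻¹| * ∫⁻ x, F x ∂m := by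
  have h1 : ∫⁻ x, F (a + r • x) ∂m = ∫⁻ x, F (a + x) ∂(Measure.map (fun x => r • x) m) := by
    rw [lintegral_map (by fun_prop) (by fun_prop)]
  rw [h1, Measure.map_addHaar_smul m hr, lintegral_smul_measure, lintegral_add_left_eq_self,
    smul_eq_mul]

lemma integral_comp_add_smul {V E : Type*} [NormedAddCommGroup V] [NormedSpace ℝ V]
    [MeasurableSpace V] [BorelSpace V] [FiniteDimensional ℝ V] (m : Measure V)
    [m.IsAddHaarMeasure] [NormedAddCommGroup E] [NormedSpace ℝ E] (F : V → E) (a : V) (r : ℝ) :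
    ∫ x, F (a + r • x) ∂m = |(r ^ Module.finrank ℝ V)⁻¹| • ∫ x, F x ∂m := by
  rw [Measure.integral_comp_smul m (fun x => F (a + x)) r, integral_add_left_eq_self]

/-- Cauchy-Schwarz against the constant `1`, that is, Jensen's inequality; it will be used for the
averaging measure `nu`. -/
lemma sq_lintegral_le {α : Type*} [MeasurableSpace α] {m : Measure α} [IsProbabilityMeasure m]
    {F : α → ℝ≥0∞} (hF : AEMeasurable F m) : (∫⁻ x, F x ∂m) ^ 2 ≤ ∫⁻ x, F x ^ 2 ∂m := by
  have h := ENNReal.lintegral_mul_le_Lp_mul_Lq m (Real.HolderConjugate.two_two) hF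
    (aemeasurable_const (b := (1 : ℝ≥0∞)))
  simp only [Pi.mul_apply, mul_one, ENNReal.one_rpow, lintegral_const, measure_univ] at h
  calc (∫⁻ x, F x ∂m) ^ 2 ≤ ((∫⁻ x, F x ^ (2 : ℝ) ∂m) ^ (1 / 2 : ℝ)) ^ 2 := by gcongr
    _ = ∫⁻ x, F x ^ 2 ∂m := by
      rw [← ENNReal.rpow_natCast, ← ENNReal.rpow_mul]
      simp

/-! ### One-dimensional weight estimates -/

/-- The weight `y^b` on the half line, extended by zero. -/
def hw (b : ℝ) : ℝ → ℝ≥0∞ := (Set.Ioi 0).indicator fun t => ENNReal.ofReal (t ^ b)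

lemma measurable_hw : Measurable (hw b) :=
  Measurable.indicator (by fun_prop) measurableSet_Ioi

lemma hw_of_pos {t : ℝ} (ht : 0 < t) : hw b t = ENNReal.ofReal (t ^ b) :=
  Set.indicator_of_mem (Set.mem_Ioi.2 ht) _

lemma hw_of_nonpos {t : ℝ} (ht : t ≤ 0) : hw b t = 0 :=
  Set.indicator_of_notMem (by simpa using ht) _

lemma lintegral_Iio_hw (hb : -1 < b) {y : ℝ} (hy : 0 < y) :
    ∫⁻ t in Set.Iio y, hw b t = ENNReal.ofReal (y ^ (b + 1) / (b + 1)) := by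
  rw [hw, lintegral_indicator measurableSet_Ioi, Measure.restrict_restrict measurableSet_Ioi,
    Set.Ioi_inter_Iio]
  have hi := (intervalIntegral.integrableOn_Ioo_rpow_iff (s := b) hy).2 hb
  rw [← ofReal_integral_eq_lintegral_ofReal hi]
  · congr 1
    rw [← integral_Ioc_eq_integral_Ioo, ← intervalIntegral.integral_of_le hy.le,
      integral_rpow (Or.inl hb), Real.zero_rpow (by linarith), sub_zero]
  · filter_upwards [ae_restrict_mem measurableSet_Ioo] with t ht
    exact Real.rpow_nonneg ht.1.le b

/-- A one-sided Muckenhoupt bound, uniform in the scale; the three summands of the constant serve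
three cases. For `b ≥ 0` the weight is increasing. For `b < 0` and `y ≥ 6ε`, the points `y - εs`
stay above `y/2`. For `b < 0` and `y < 6ε`, the average is at most `ε⁻¹ ∫₀^y t^b dt = y^(b+1) /
(ε(b+1))`, finite because `b > -1`, and `y/ε < 6`. -/
lemma exists_hw_average_le (hb : -1 < b) : ∃ C : ℝ≥0∞, C ≠ ⊤ ∧ ∀ ε y : ℝ, 0 < ε → 0 < y →
    ∫⁻ s in Set.Ioo (1 : ℝ) 3, hw b (y - ε * s) ≤ C * hw b y := by
  have hvol : volume (Set.Ioo (1 : ℝ) 3) = 2 := by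
    rw [Real.volume_Ioo]; norm_num
  have hb1 : 0 < b + 1 := by linarith
  refine ⟨2 + 2 * ENNReal.ofReal (2 ^ (-b)) + ENNReal.ofReal (6 / (b + 1)), by finiteness,
    fun ε y hε hy => ?_⟩
  rw [hw_of_pos hy]
  rcases le_or_gt 0 b with h0 | h0
  · calc _ ≤ ∫⁻ s in Set.Ioo (1 : ℝ) 3, ENNReal.ofReal (y ^ b) := by
          refine setLIntegral_mono measurable_const fun s hs => ?_
          rcases le_or_gt (y - ε * s) 0 with h | h
          · rw [hw_of_nonpos h]; exact zero_le
          · rw [hw_of_pos h]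
            refine ENNReal.ofReal_le_ofReal (Real.rpow_le_rpow h.le ?_ h0)
            nlinarith [hs.1]
      _ = 2 * ENNReal.ofReal (y ^ b) := by
          rw [setLIntegral_const, hvol, mul_comm]
      _ ≤ _ := by gcongr; rw [add_assoc]; exact le_self_add
  -- The threshold comes from `s < 3`: if `6ε ≤ y`, then `εs ≤ y/2`.
  · rcases le_or_gt (6 * ε) y with h | h
    · calc _ ≤ ∫⁻ s in Set.Ioo (1 : ℝ) 3, ENNReal.ofReal ((y / 2) ^ b) := by
            refine setLIntegral_mono measurable_const fun s hs => ?_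
            have h1 : y / 2 ≤ y - ε * s := by nlinarith [hs.2]
            rw [hw_of_pos (by linarith)]
            exact ENNReal.ofReal_le_ofReal (Real.rpow_le_rpow_of_nonpos (by linarith) h1 h0.le)
        _ = 2 * ENNReal.ofReal (2 ^ (-b)) * ENNReal.ofReal (y ^ b) := by
            rw [setLIntegral_const, hvol, Real.div_rpow hy.le (by norm_num),
              Real.rpow_neg (by norm_num), mul_comm, mul_assoc, ← ENNReal.ofReal_mul (by positivity)]
            congr 2; field_simp
        _ ≤ _ := by
            gcongr
            exact le_trans (by rw [add_comm]; exact le_self_add) (le_self_add)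
    · calc _ ≤ ∫⁻ s : ℝ, (Set.Iio y).indicator (hw b) (y + (-ε) • s) := by
            rw [← lintegral_indicator measurableSet_Ioo]
            refine lintegral_mono fun s => ?_
            by_cases hs : s ∈ Set.Ioo (1 : ℝ) 3
            · have h1 : y + (-ε) • s = y - ε * s := by simp; ring
              rw [Set.indicator_of_mem hs, h1, Set.indicator_of_mem]
              simp only [Set.mem_Iio]; nlinarith [hs.1]
            · rw [Set.indicator_of_notMem hs]; exact zero_le
        _ = ENNReal.ofReal ε⁻¹ * ENNReal.ofReal (y ^ (b + 1) / (b + 1)) := by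
            rw [lintegral_comp_add_smul volume (measurable_hw.indicator measurableSet_Iio) y
              (neg_ne_zero.2 hε.ne'), lintegral_indicator measurableSet_Iio,
              lintegral_Iio_hw hb hy]
            simp [abs_of_pos hε]
        _ ≤ ENNReal.ofReal (6 / (b + 1)) * ENNReal.ofReal (y ^ b) := by
            rw [← ENNReal.ofReal_mul (by positivity), ← ENNReal.ofReal_mul (by positivity)]
            refine ENNReal.ofReal_le_ofReal ?_
            rw [Real.rpow_add_one hy.ne']
            have : ε⁻¹ * (y ^ b * y / (b + 1)) = (y / ε) / (b + 1) * y ^ b := by field_simp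
            rw [this]
            gcongr
            rw [div_le_iff₀ hε]; exact h.le
        _ ≤ _ := by gcongr; exact le_add_self

/-! ### The averaging operators -/

/-- The bump function used for averaging; it lives at height `y ∈ (1, 3)`. -/
def upBump (n : ℕ) : ContDiffBump (pt (0 : Thin n) 2) := ⟨1 / 2, 1, by norm_num, by norm_num⟩

/-- The normalized bump. -/
def rho (n : ℕ) : Amb n → ℝ := (upBump n).normed volume

lemma contDiff_rho : ContDiff ℝ ∞ (rho n) := (upBump n).contDiff_normed

lemma continuous_rho : Continuous (rho n) := (contDiff_rho (n := n)).continuous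

lemma rho_nonneg (Z : Amb n) : 0 ≤ rho n Z := (upBump n).nonneg_normed Z

lemma integral_rho : ∫ Z, rho n Z = 1 := (upBump n).integral_normed

lemma tsupport_rho : tsupport (rho n) = Metric.closedBall (pt 0 2) 1 :=
  (upBump n).tsupport_normed_eq

lemma support_rho : Function.support (rho n) = Metric.ball (pt 0 2) 1 :=
  (upBump n).support_normed_eq

lemma hasCompactSupport_rho : HasCompactSupport (rho n) := (upBump n).hasCompactSupport_normed

lemma integrable_rho : Integrable (rho n) :=
  continuous_rho.integrable_of_hasCompactSupport hasCompactSupport_rho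

lemma norm_pt_zero (y : ℝ) : ‖pt (0 : Thin n) y‖ = |y| := by
  rw [← abs_norm, ← sq_eq_sq_iff_abs_eq_abs, norm_pt_sq]; simp

lemma ycoord_of_mem_closedBall {Z : Amb n} (hZ : Z ∈ Metric.closedBall (pt (0 : Thin n) 2) 1) :
    1 ≤ ycoord Z := by
  have h := abs_ycoord_le (Z - pt 0 2)
  rw [← dist_eq_norm, ycoord_sub, ycoord_pt] at h
  linarith [(abs_le.1 (h.trans (Metric.mem_closedBall.1 hZ))).1]

lemma norm_of_mem_closedBall {Z : Amb n} (hZ : Z ∈ Metric.closedBall (pt (0 : Thin n) 2) 1) :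
    ‖Z‖ ≤ 3 := by
  have h1 := norm_add_le (Z - pt 0 2) (pt 0 2)
  rw [sub_add_cancel, norm_pt_zero, ← dist_eq_norm] at h1
  have h2 := Metric.mem_closedBall.1 hZ
  norm_num at h1
  linarith

lemma pt_mem_ball_two {x : Thin n} {y : ℝ} (h : pt x y ∈ Metric.ball (pt (0 : Thin n) 2) 1) :
    x ∈ flatBall n ∧ y ∈ Set.Ioo (1 : ℝ) 3 := by
  have h1 : pt x y - pt 0 2 = pt x (y - 2) := by
    rw [sub_eq_iff_eq_add, ← pt_add]; simp
  rw [Metric.mem_ball, dist_eq_norm, h1] at h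
  have h2 := norm_pt_sq x (y - 2)
  have h3 : ‖pt x (y - 2)‖ ^ 2 < 1 := by nlinarith [norm_nonneg (pt x (y - 2))]
  refine ⟨?_, ?_, ?_⟩
  · simp only [flatBall, Metric.mem_ball, dist_zero_right]
    nlinarith [norm_nonneg x]
  · nlinarith [norm_nonneg x]
  · nlinarith [norm_nonneg x]

/-- The probability measure with density `rho`. -/
def nu (n : ℕ) : Measure (Amb n) := volume.withDensity fun Z => ENNReal.ofReal (rho n Z)

lemma measurable_ofReal_rho : Measurable fun Z => ENNReal.ofReal (rho n Z) :=
  continuous_rho.measurable.ennreal_ofReal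

instance : IsProbabilityMeasure (nu n) := ⟨by
  rw [nu, withDensity_apply _ MeasurableSet.univ, Measure.restrict_univ,
    ← ofReal_integral_eq_lintegral_ofReal integrable_rho (ae_of_all _ rho_nonneg), integral_rho,
    ENNReal.ofReal_one]⟩

lemma ae_nu_mem : ∀ᵐ Z ∂(nu n), Z ∈ Metric.ball (pt (0 : Thin n) 2) 1 := by
  rw [nu, ae_withDensity_iff measurable_ofReal_rho]
  refine ae_of_all _ fun Z hZ => ?_
  rw [← support_rho]
  intro h
  exact hZ (by rw [h, ENNReal.ofReal_zero])

/-- The density `rho` is bounded and supported in the cylinder over the unit ball with heights in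
`(1, 3)`, so averages of functions of the height reduce to one-dimensional integrals. -/
lemma exists_lintegral_nu_le (n : ℕ) : ∃ C : ℝ≥0∞, C ≠ ⊤ ∧ ∀ F : ℝ → ℝ≥0∞, Measurable F →
    ∫⁻ Z, F (ycoord Z) ∂(nu n) ≤ C * ∫⁻ s in Set.Ioo (1 : ℝ) 3, F s := by
  obtain ⟨B, hB⟩ := (continuous_rho (n := n)).bounded_above_of_compact_support
    hasCompactSupport_rho
  refine ⟨ENNReal.ofReal B * volume (flatBall n),
    ENNReal.mul_ne_top ENNReal.ofReal_ne_top measure_ball_lt_top.ne, fun F hF => ?_⟩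
  have hm : Measurable fun Z : Amb n => F (ycoord Z) := hF.comp measurable_ycoord
  rw [nu, lintegral_withDensity_eq_lintegral_mul _ measurable_ofReal_rho hm]
  calc _ ≤ ∫⁻ Z in Metric.ball (pt (0 : Thin n) 2) 1, ENNReal.ofReal B * F (ycoord Z) := by
        rw [← lintegral_indicator Metric.isOpen_ball.measurableSet]
        refine lintegral_mono fun Z => ?_
        by_cases hZ : Z ∈ Metric.ball (pt (0 : Thin n) 2) 1
        · rw [Set.indicator_of_mem hZ]
          simp only [Pi.mul_apply]
          gcongr
          exact (le_abs_self _).trans (hB Z)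
        · rw [← support_rho, Function.notMem_support] at hZ
          simp [hZ]
    _ ≤ _ := by
        rw [lintegral_const_mul _ hm, mul_assoc]
        gcongr
        exact setLIntegral_ycoord_le Metric.isOpen_ball.measurableSet measurableSet_Ioo
          (fun x y => pt_mem_ball_two) hF

section Avg

variable {E : Type*} [NormedAddCommGroup E] [NormedSpace ℝ E]

/-- Averages of the zero extension of `g|_{B_1^+}`. -/
def avg (l ε : ℝ) (g : Amb n → E) (X : Amb n) : E :=
  ∫ Z, rho n Z • (halfBall n).indicator g (l • X + ε • Z)

lemma enorm_avg_le (l ε : ℝ) {g : Amb n → E} (hg : StronglyMeasurable g) (X : Amb n) :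
    ‖avg l ε g X‖ₑ ≤ ∫⁻ Z, ‖(halfBall n).indicator g (l • X + ε • Z)‖ₑ ∂(nu n) := by
  refine (enorm_integral_le_lintegral_enorm _).trans (le_of_eq ?_)
  have hm : Measurable fun Z => ‖(halfBall n).indicator g (l • X + ε • Z)‖ₑ :=
    (hg.indicator measurableSet_halfBall).enorm.comp (by fun_prop)
  rw [nu, lintegral_withDensity_eq_lintegral_mul _ measurable_ofReal_rho hm]
  refine lintegral_congr fun Z => ?_
  simp only [Pi.mul_apply]
  rw [enorm_smul, Real.enorm_of_nonneg (rho_nonneg Z)]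

lemma stronglyMeasurable_avg (l ε : ℝ) {g : Amb n → E} (hg : StronglyMeasurable g) :
    StronglyMeasurable (avg l ε g) := by
  have h1 : StronglyMeasurable (Function.uncurry fun X Z : Amb n =>
      rho n Z • (halfBall n).indicator g (l • X + ε • Z)) := by
    refine StronglyMeasurable.smul ?_ ?_
    · exact continuous_rho.stronglyMeasurable.comp_measurable measurable_snd
    · exact (hg.indicator measurableSet_halfBall).comp_measurable (by fun_prop)
  exact h1.integral_prod_right

/-- Substitute `Y = l • X + W`. The Jacobian factor is at most `1`, and `l ∈ [1, 2]` with `b > -1`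
gives `l^b ≥ 1/2`, whence the factor `2`. -/
lemma lintegral_weight_shift_le (hb : -1 < b) {l : ℝ} (hl : 1 ≤ l) (hl2 : l ≤ 2)
    {F : Amb n → ℝ≥0∞} (hF : Measurable F) (W : Amb n) :
    ∫⁻ X, hw b (ycoord X) * F (l • X + W) ≤ 2 * ∫⁻ Y, hw b (ycoord (Y - W)) * F Y := by
  have hl0 : 0 < l := by linarith
  have hm : Measurable fun Y : Amb n => hw b (ycoord (Y - W)) * F Y :=
    (measurable_hw.comp (by fun_prop)).mul hF
  calc _ ≤ ∫⁻ X, 2 * (hw b (ycoord ((W + l • X) - W)) * F (W + l • X)) := by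
        refine lintegral_mono fun X => ?_
        simp only
        rw [add_comm (l • X) W, ← mul_assoc]
        gcongr
        rw [add_sub_cancel_left, ycoord_smul]
        rcases le_or_gt (ycoord X) 0 with h | h
        · rw [hw_of_nonpos h]; exact zero_le
        · rw [hw_of_pos h, hw_of_pos (by positivity), Real.mul_rpow hl0.le h.le]
          have h2 : (2 : ℝ≥0∞) = ENNReal.ofReal 2 := by simp
          rw [h2, ← ENNReal.ofReal_mul (by norm_num)]
          refine ENNReal.ofReal_le_ofReal ?_
          have h3 : (1 / 2 : ℝ) ≤ l ^ b := by
            calc (1 / 2 : ℝ) ≤ l ^ (-1 : ℝ) := by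
                  rw [Real.rpow_neg_one, ← one_div]; gcongr
              _ ≤ l ^ b := Real.rpow_le_rpow_of_exponent_le hl hb.le
          nlinarith [Real.rpow_pos_of_pos h b]
    _ = 2 * ∫⁻ X, (hw b (ycoord ((W + l • X) - W)) * F (W + l • X)) :=
        lintegral_const_mul _ (hm.comp (by fun_prop))
    _ ≤ _ := by
        gcongr 2 * ?_
        rw [lintegral_comp_add_smul volume hm W hl0.ne']
        refine mul_le_of_le_one_left (zero_le) ?_
        rw [← ENNReal.ofReal_one]
        refine ENNReal.ofReal_le_ofReal ?_
        rw [abs_of_pos (by positivity)]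
        exact inv_le_one_of_one_le₀ (one_le_pow₀ hl)

/-- Jensen moves the square inside the average, Tonelli exchanges the integrals, and a change of
variables transfers the shift from the function to the weight. As the kernel looks upward, the
weight is evaluated below `Y`, which is the direction in which `exists_hw_average_le` controls it.
The constant is independent of `l` and `ε`. -/
lemma exists_lintegral_avg_le (n : ℕ) (hb : -1 < b) : ∃ C : ℝ≥0∞, C ≠ ⊤ ∧
    ∀ (l ε : ℝ), 1 ≤ l → l ≤ 2 → 0 < ε → ∀ g : Amb n → E, StronglyMeasurable g →
      ∫⁻ X, ‖avg l ε g X‖ₑ ^ 2 ∂(wMeas n b) ≤ C * ∫⁻ X, ‖g X‖ₑ ^ 2 ∂(wMeas n b) := by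
  obtain ⟨C₁, hC₁, h₁⟩ := exists_hw_average_le hb
  obtain ⟨C₂, hC₂, h₂⟩ := exists_lintegral_nu_le n
  refine ⟨2 * (C₂ * C₁), by finiteness, fun l ε hl hl2 hε g hg => ?_⟩
  set F : Amb n → ℝ≥0∞ := (halfBall n).indicator fun X => ‖g X‖ₑ ^ 2 with hFdef
  have hF : Measurable F := (hg.enorm.pow_const 2).indicator measurableSet_halfBall
  have hFg : ∀ Y, ‖(halfBall n).indicator g Y‖ₑ ^ 2 = F Y := fun Y => by
    by_cases hY : Y ∈ halfBall n <;> simp [hFdef, hY]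
  have hgm := (stronglyMeasurable_avg l ε hg).enorm.pow_const 2
  rw [lintegral_wMeas hgm, lintegral_wMeas (hg.enorm.pow_const 2)]
  calc _ ≤ ∫⁻ X : Amb n, (∫⁻ Z, hw b (ycoord X) * F (l • X + ε • Z) ∂(nu n)) := by
        rw [← lintegral_indicator measurableSet_halfBall]
        refine lintegral_mono fun X => ?_
        by_cases hX : X ∈ halfBall n
        · have hm : Measurable fun Z => F (l • X + ε • Z) := hF.comp (by fun_prop)
          rw [Set.indicator_of_mem hX, lintegral_const_mul _ hm, hw_of_pos hX.2]
          gcongr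
          calc ‖avg l ε g X‖ₑ ^ 2 ≤
              (∫⁻ Z, ‖(halfBall n).indicator g (l • X + ε • Z)‖ₑ ∂(nu n)) ^ 2 := by
                gcongr; exact enorm_avg_le l ε hg X
            _ ≤ _ := by
                refine (sq_lintegral_le ?_).trans_eq (lintegral_congr fun Z => hFg _)
                exact ((hg.indicator measurableSet_halfBall).enorm.comp
                  (by fun_prop)).aemeasurable
        · rw [Set.indicator_of_notMem hX]; exact zero_le
    _ = ∫⁻ Z, (∫⁻ X : Amb n, hw b (ycoord X) * F (l • X + ε • Z)) ∂(nu n) := by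
        refine lintegral_lintegral_swap (Measurable.aemeasurable ?_)
        exact (measurable_hw.comp (by fun_prop)).mul (hF.comp (by fun_prop))
    _ ≤ ∫⁻ Z, 2 * (∫⁻ Y, hw b (ycoord (Y - ε • Z)) * F Y) ∂(nu n) :=
        lintegral_mono fun Z => lintegral_weight_shift_le hb hl hl2 hF _
    _ = 2 * ∫⁻ Y : Amb n, (∫⁻ Z, hw b (ycoord (Y - ε • Z)) ∂(nu n)) * F Y := by
        have hm : Measurable (Function.uncurry fun Z Y : Amb n =>
            hw b (ycoord (Y - ε • Z)) * F Y) :=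
          (measurable_hw.comp (by fun_prop)).mul (hF.comp (by fun_prop))
        rw [lintegral_const_mul _ hm.lintegral_prod_right, lintegral_lintegral_swap hm.aemeasurable]
        congr 1
        refine lintegral_congr fun Y => ?_
        have hm' : Measurable fun Z => hw b (ycoord (Y - ε • Z)) :=
          measurable_hw.comp (by fun_prop)
        rw [lintegral_mul_const _ hm']
    _ ≤ 2 * ∫⁻ Y, (C₂ * C₁) * (halfBall n).indicator
          (fun X => ENNReal.ofReal (ycoord X ^ b) * ‖g X‖ₑ ^ 2) Y := by
        gcongr 2 * ?_
        refine lintegral_mono fun Y => ?_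
        by_cases hY : Y ∈ halfBall n
        · rw [hFdef, Set.indicator_of_mem hY, Set.indicator_of_mem hY, ← mul_assoc]
          gcongr ?_ * _
          have e : ∀ Z, hw b (ycoord (Y - ε • Z)) = (fun s => hw b (ycoord Y - ε * s)) (ycoord Z) :=
            fun Z => by simp only [ycoord_sub, ycoord_smul]
          simp_rw [e]
          refine (h₂ (fun s => hw b (ycoord Y - ε * s)) (measurable_hw.comp (by fun_prop))).trans ?_
          rw [mul_assoc, ← hw_of_pos hY.2]
          gcongr
          exact h₁ ε _ hε hY.2
        · rw [hFdef, Set.indicator_of_notMem hY, mul_zero]; exact zero_le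
    _ = _ := by
        have hm : Measurable ((halfBall n).indicator
            (fun X => ENNReal.ofReal (ycoord X ^ b) * ‖g X‖ₑ ^ 2)) :=
          (measurable_weight.mul (hg.enorm.pow_const 2)).indicator measurableSet_halfBall
        rw [lintegral_const_mul _ hm, lintegral_indicator measurableSet_halfBall]
        ring

end Avg

/-! ### Convergence of the averages -/

section AvgConv

variable {E : Type*} [NormedAddCommGroup E] [NormedSpace ℝ E]

lemma eLpNorm_two_eq {α E : Type*} [NormedAddCommGroup E] [MeasurableSpace α]
    (m : Measure α) (g : α → E) :
    eLpNorm g 2 m = (∫⁻ X, ‖g X‖ₑ ^ 2 ∂m) ^ (1 / 2 : ℝ) := by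
  rw [eLpNorm_eq_lintegral_rpow_enorm_toReal (by norm_num) (by norm_num)]
  simp

lemma exists_eLpNorm_avg_le (n : ℕ) (hb : -1 < b) : ∃ C : ℝ≥0∞, C ≠ ⊤ ∧
    ∀ (l ε : ℝ), 1 ≤ l → l ≤ 2 → 0 < ε → ∀ g : Amb n → E, StronglyMeasurable g →
      eLpNorm (avg l ε g) 2 (wMeas n b) ≤ C * eLpNorm g 2 (wMeas n b) := by
  obtain ⟨C, hC, h⟩ := exists_lintegral_avg_le (E := E) n hb
  refine ⟨C ^ (1 / 2 : ℝ), ENNReal.rpow_ne_top_of_nonneg (by norm_num) hC,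
    fun l ε hl hl2 hε g hg => ?_⟩
  rw [eLpNorm_two_eq, eLpNorm_two_eq, ← ENNReal.mul_rpow_of_nonneg _ _ (by norm_num)]
  exact ENNReal.rpow_le_rpow (h l ε hl hl2 hε g hg) (by norm_num)

lemma integrable_comp_add_smul {V E : Type*} [NormedAddCommGroup E] [NormedAddCommGroup V]
    [NormedSpace ℝ V]
    [MeasurableSpace V] [BorelSpace V] [FiniteDimensional ℝ V] {m : Measure V}
    [m.IsAddHaarMeasure] {F : V → E} (hF : Integrable F m) (a : V) {r : ℝ} (hr : r ≠ 0) :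
    Integrable (fun x => F (a + r • x)) m :=
  (hF.comp_add_left a).comp_smul hr

lemma integrable_avg_integrand {g : Amb n → E} (hg : IntegrableOn g (halfBall n)) (l : ℝ) {ε : ℝ}
    (hε : 0 < ε) (X : Amb n) :
    Integrable fun Z => rho n Z • (halfBall n).indicator g (l • X + ε • Z) := by
  have h1 := integrable_comp_add_smul ((integrable_indicator_iff measurableSet_halfBall).2 hg)
    (l • X) hε.ne'
  exact memLp_one_iff_integrable.1 ((memLp_one_iff_integrable.2 h1).smul
    (continuous_rho.memLp_top_of_hasCompactSupport hasCompactSupport_rho _))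

lemma avg_sub {g g' : Amb n → E} (hg : IntegrableOn g (halfBall n))
    (hg' : IntegrableOn g' (halfBall n)) (l : ℝ) {ε : ℝ} (hε : 0 < ε) :
    avg l ε (g - g') = avg l ε g - avg l ε g' := by
  funext X
  rw [Pi.sub_apply, avg, avg, avg, ← integral_sub (integrable_avg_integrand hg l hε X)
    (integrable_avg_integrand hg' l hε X)]
  congr 1; ext1 Z
  rw [← smul_sub, ← Pi.sub_apply ((halfBall n).indicator g), ← Set.indicator_sub']

lemma norm_avg_le {g : Amb n → E} {B : ℝ} (hB : ∀ X, ‖g X‖ ≤ B) (l ε : ℝ) (X : Amb n) :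
    ‖avg l ε g X‖ ≤ B := by
  have h0 : 0 ≤ B := (norm_nonneg _).trans (hB 0)
  have h1 : ‖avg l ε g X‖ ≤ ∫ Z, rho n Z * B := by
    refine norm_integral_le_of_norm_le (integrable_rho.mul_const B) (ae_of_all _ fun Z => ?_)
    rw [norm_smul, Real.norm_of_nonneg (rho_nonneg Z)]
    refine mul_le_mul_of_nonneg_left ?_ (rho_nonneg Z)
    refine (norm_indicator_le_norm_self _ _).trans (hB _)
  rwa [integral_mul_const, integral_rho, one_mul] at h1

variable [CompleteSpace E]

lemma tendsto_avg_of_continuous {g : Amb n → E} (hg : Continuous g) {B : ℝ}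
    (hB : ∀ X, ‖g X‖ ≤ B) {l ε : ℕ → ℝ} (hl : Tendsto l atTop (𝓝 1)) (hε : Tendsto ε atTop (𝓝 0))
    {X : Amb n} (hX : X ∈ halfBall n) :
    Tendsto (fun k => avg (l k) (ε k) g X) atTop (𝓝 (g X)) := by
  have h1 : g X = ∫ Z, rho n Z • g X := by
    rw [integral_smul_const, integral_rho, one_smul]
  rw [h1]
  refine tendsto_integral_of_dominated_convergence (fun Z => rho n Z * B) (fun k => ?_)
    (integrable_rho.mul_const B) (fun k => ae_of_all _ fun Z => ?_) (ae_of_all _ fun Z => ?_)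
  · refine (continuous_rho.stronglyMeasurable.smul ?_).aestronglyMeasurable
    exact (hg.stronglyMeasurable.indicator measurableSet_halfBall).comp_measurable (by fun_prop)
  · rw [norm_smul, Real.norm_of_nonneg (rho_nonneg Z)]
    refine mul_le_mul_of_nonneg_left ?_ (rho_nonneg Z)
    exact (norm_indicator_le_norm_self _ _).trans (hB _)
  · refine Tendsto.const_smul ?_ _
    have h2 : Tendsto (fun k => l k • X + ε k • Z) atTop (𝓝 X) := by
      have := (hl.smul_const X).add (hε.smul_const Z)
      simpa using this
    have h3 : Tendsto ((halfBall n).indicator g) (𝓝 X) (𝓝 (g X)) := by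
      refine hg.continuousAt.tendsto.congr' ?_
      filter_upwards [isOpen_halfBall.mem_nhds hX] with Y hY
      rw [Set.indicator_of_mem hY]
    exact h3.comp h2

/-- The operators are uniformly bounded on `L²(y^b)` and converge on the dense class of continuous
compactly supported functions, where dominated convergence applies. -/
lemma tendsto_eLpNorm_avg_sub (hb : -1 < b) (hb' : b < 1) {g : Amb n → E}
    (hgm : StronglyMeasurable g) (hg : MemLp g 2 (wMeas n b)) {l ε : ℕ → ℝ}
    (hl1 : ∀ k, 1 ≤ l k) (hl2 : ∀ k, l k ≤ 2) (hl : Tendsto l atTop (𝓝 1))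
    (hε0 : ∀ k, 0 < ε k) (hε : Tendsto ε atTop (𝓝 0)) :
    Tendsto (fun k => eLpNorm (avg (l k) (ε k) g - g) 2 (wMeas n b)) atTop (𝓝 0) := by
  have := isFiniteMeasure_wMeas (n := n) hb
  obtain ⟨C, hC, hbd⟩ := exists_eLpNorm_avg_le (E := E) n hb
  rw [ENNReal.tendsto_nhds_zero]
  intro δ hδ
  -- Replacing `g` by its approximation `g'` costs at most `C + 1` times the distance between them,
  -- so this choice leaves `δ/2`.
  have hδ' : δ / (2 * (C + 1)) ≠ 0 := by
    refine (ENNReal.div_pos hδ.ne' (by finiteness)).ne'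
  obtain ⟨g', hc, hgg', hcont, hg'L⟩ :=
    hg.exists_hasCompactSupport_eLpNorm_sub_le (by norm_num) hδ'
  obtain ⟨B, hB⟩ := hcont.bounded_above_of_compact_support hc
  have hlim : Tendsto (fun k => eLpNorm (avg (l k) (ε k) g' - g') 2 (wMeas n b)) atTop (𝓝 0) := by
    simp_rw [eLpNorm_two_eq]
    have h0 : (0 : ℝ≥0∞) = 0 ^ (1 / 2 : ℝ) := by simp
    rw [h0]
    refine ((ENNReal.continuous_rpow_const).tendsto _).comp ?_
    have h1 : (0 : ℝ≥0∞) = ∫⁻ X : Amb n, 0 ∂(wMeas n b) := by simp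
    rw [h1]
    refine tendsto_lintegral_of_dominated_convergence
      (fun _ => ENNReal.ofReal (B + B) ^ 2) (fun k => ?_) (fun k => ae_of_all _ fun X => ?_) ?_ ?_
    · exact ((stronglyMeasurable_avg _ _ hcont.stronglyMeasurable).sub
        hcont.stronglyMeasurable).enorm.pow_const 2
    · simp only
      gcongr
      rw [← ofReal_norm]
      refine ENNReal.ofReal_le_ofReal ?_
      exact (norm_sub_le _ _).trans (add_le_add (norm_avg_le hB _ _ X) (hB X))
    · rw [lintegral_const]; finiteness
    · filter_upwards [ae_mem_halfBall] with X hX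
      have h2 := (tendsto_avg_of_continuous hcont hB hl hε hX).sub_const (g' X)
      rw [sub_self] at h2
      have h3 := ((ENNReal.continuous_pow 2).tendsto _).comp h2.enorm
      simpa [Function.comp_def] using h3
  have hδ2 : 0 < δ / 2 := ENNReal.div_pos hδ.ne' (by norm_num)
  filter_upwards [(ENNReal.tendsto_nhds_zero.1 hlim) (δ / 2) hδ2] with k hk
  have hsplit : avg (l k) (ε k) g - g = avg (l k) (ε k) (g - g') - (g - g')
      + (avg (l k) (ε k) g' - g') := by
    rw [avg_sub (MemLp.integrableOn_halfBall hb' hg) (MemLp.integrableOn_halfBall hb' hg'L) _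
      (hε0 k)]
    abel
  have hm1 : StronglyMeasurable (g - g') := hgm.sub hcont.stronglyMeasurable
  have hm2 := stronglyMeasurable_avg (l k) (ε k) hm1
  have hm3 := (stronglyMeasurable_avg (l k) (ε k) hcont.stronglyMeasurable).sub
    hcont.stronglyMeasurable
  rw [hsplit]
  calc _ ≤ eLpNorm (avg (l k) (ε k) (g - g') - (g - g')) 2 (wMeas n b) + δ / 2 :=
        (eLpNorm_add_le (hm2.sub hm1).aestronglyMeasurable hm3.aestronglyMeasurable
          (by norm_num)).trans (by gcongr)
    _ ≤ (C * eLpNorm (g - g') 2 (wMeas n b) + eLpNorm (g - g') 2 (wMeas n b)) + δ / 2 := by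
        gcongr
        exact (eLpNorm_sub_le hm2.aestronglyMeasurable hm1.aestronglyMeasurable
          (by norm_num)).trans (by gcongr; exact hbd _ _ (hl1 k) (hl2 k) (hε0 k) _ hm1)
    _ ≤ (C + 1) * (δ / (2 * (C + 1))) + δ / 2 := by
        gcongr
        rw [← add_one_mul]
        gcongr
    _ = δ := by
        have : (C + 1) * (δ / (2 * (C + 1))) = δ / 2 := by
          rw [mul_comm 2, ENNReal.div_eq_inv_mul, ENNReal.mul_inv (by simp) (by simp),
            ← mul_assoc, ← mul_assoc, ENNReal.mul_inv_cancel (by simp) (by finiteness), one_mul,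
            ENNReal.div_eq_inv_mul]
        rw [this, ENNReal.add_halves]

end AvgConv

/-! ### Smoothness of the averages -/

/-- The convolution kernel of `avg`. -/
def kap (n : ℕ) (ε : ℝ) (W : Amb n) : ℝ :=
  |(ε ^ Module.finrank ℝ (Amb n))⁻¹| * rho n (-(ε⁻¹ • W))

lemma contDiff_kap (ε : ℝ) : ContDiff ℝ ∞ (kap n ε) :=
  contDiff_const.mul (contDiff_rho.comp (contDiff_const_smul _).neg)

lemma support_kap {ε : ℝ} {W : Amb n} (h : kap n ε W ≠ 0) :
    -(ε⁻¹ • W) ∈ Metric.closedBall (pt (0 : Thin n) 2) 1 := by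
  have : rho n (-(ε⁻¹ • W)) ≠ 0 := right_ne_zero_of_mul h
  rw [← tsupport_rho]
  exact subset_tsupport _ this

lemma tsupport_kap_sub_subset (ε : ℝ) (x : Amb n) :
    tsupport (fun Y => kap n ε (x - Y)) ⊆
      {Y | -(ε⁻¹ • (x - Y)) ∈ Metric.closedBall (pt (0 : Thin n) 2) 1} := by
  refine closure_minimal (fun Y hY => support_kap hY) ?_
  exact Metric.isClosed_closedBall.preimage (by fun_prop)

lemma hasCompactSupport_kap {ε : ℝ} (hε : 0 < ε) : HasCompactSupport (kap n ε) := by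
  refine HasCompactSupport.of_support_subset_isCompact
    (isCompact_closedBall (0 : Amb n) (ε * 3)) fun W hW => ?_
  have h := norm_of_mem_closedBall (support_kap hW)
  rw [norm_neg, norm_smul, norm_inv, Real.norm_of_nonneg hε.le, inv_mul_le_iff₀ hε] at h
  simpa using h

section AvgSmooth

variable {E : Type*} [NormedAddCommGroup E] [NormedSpace ℝ E]

lemma avg_eq_integral_kap {ε : ℝ} (hε : 0 < ε) (l : ℝ) (g : Amb n → E) (X : Amb n) :
    avg l ε g X = ∫ Y, kap n ε (l • X - Y) • (halfBall n).indicator g Y := by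
  have h := integral_comp_add_smul volume
    (fun Y => rho n (-(ε⁻¹ • (l • X - Y))) • (halfBall n).indicator g Y) (l • X) ε
  have e : ∀ Z : Amb n, -(ε⁻¹ • (l • X - (l • X + ε • Z))) = Z := fun Z => by
    rw [sub_add_cancel_left, smul_neg, neg_neg, smul_smul, inv_mul_cancel₀ hε.ne', one_smul]
  simp only [e] at h
  rw [avg, h, ← integral_smul]
  simp only [kap, smul_smul]

lemma avg_eq_setIntegral_kap {ε : ℝ} (hε : 0 < ε) (l : ℝ) (g : Amb n → E) (X : Amb n) :
    avg l ε g X = ∫ Y in halfBall n, kap n ε (l • X - Y) • g Y := by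
  rw [avg_eq_integral_kap hε, ← integral_indicator measurableSet_halfBall]
  congr 1; ext1 Y
  by_cases hY : Y ∈ halfBall n <;> simp [hY]

/-- This is why the bump sits at heights at least `1`: seen from a point of height `≥ 0`, the kernel
of scale `ε` is supported at heights at least `ε`. It is thus a legitimate test function in `LatZ`,
even where its support crosses the sphere. -/
lemma isTest_kap {ε : ℝ} (hε : 0 < ε) {x : Amb n} (hx : 0 ≤ ycoord x) :
    IsTest {X | 0 < ycoord X} (fun Y => kap n ε (x - Y)) where
  smooth := (contDiff_kap ε).comp (contDiff_const.sub contDiff_id)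
  compact := (hasCompactSupport_kap hε).comp_homeomorph (Homeomorph.subLeft x)
  supp := (tsupport_kap_sub_subset ε x).trans fun Y hY => by
    have h := ycoord_of_mem_closedBall hY
    rw [← smul_neg, neg_sub, ycoord_smul, ycoord_sub] at h
    have h2 : 0 < ε⁻¹ * (ycoord Y - ycoord x) := by linarith
    have h3 := pos_of_mul_pos_right h2 (inv_pos.2 hε).le
    simp only [Set.mem_ofPred_eq]; linarith

end AvgSmooth

lemma gradient_kap_sub (ε : ℝ) (x Y : Amb n) :
    ∇ (fun Y => kap n ε (x - Y)) Y = - ∇ (kap n ε) (x - Y) := by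
  have h1 : HasFDerivAt (fun Y => kap n ε (x - Y))
      ((fderiv ℝ (kap n ε) (x - Y)).comp (-(ContinuousLinearMap.id ℝ (Amb n)))) Y :=
    ((contDiff_kap ε).differentiable (by simp) _).hasFDerivAt.comp Y
      ((hasFDerivAt_id Y).const_sub x)
  rw [gradient, h1.fderiv, gradient, ← map_neg]
  congr 1
  ext v
  simp

lemma gradient_comp_smul {φ : Amb n → ℝ} (hφ : Differentiable ℝ φ) (l : ℝ) (X : Amb n) :
    ∇ (fun X => φ (l • X)) X = l • ∇ φ (l • X) := by
  have h1 : HasFDerivAt (fun X => φ (l • X))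
      ((fderiv ℝ φ (l • X)).comp (l • (ContinuousLinearMap.id ℝ (Amb n)))) X :=
    (hφ _).hasFDerivAt.comp X ((hasFDerivAt_id X).const_smul l)
  rw [gradient, h1.fderiv, gradient, ← map_smul]
  congr 1
  ext v
  simp

section Conv

variable {v : Amb n → ℝ}

lemma avg_eq_convolution {ε : ℝ} (hε : 0 < ε) (l : ℝ) (v : Amb n → ℝ) :
    avg l ε v = fun X => (convolution ((halfBall n).indicator v) (kap n ε)
      (ContinuousLinearMap.mul ℝ ℝ) volume) (l • X) := by
  funext X
  rw [avg_eq_integral_kap hε, convolution]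
  simp [mul_comm]

lemma contDiff_avg (hv : IntegrableOn v (halfBall n)) {ε : ℝ} (hε : 0 < ε) (l : ℝ) :
    ContDiff ℝ ∞ (avg l ε v) := by
  rw [avg_eq_convolution hε]
  have h := (hasCompactSupport_kap (n := n) hε).contDiff_convolution_right
    (ContinuousLinearMap.mul ℝ ℝ)
    ((integrable_indicator_iff measurableSet_halfBall).2 hv).locallyIntegrable
    (contDiff_kap ε) (μ := volume)
  exact h.comp (contDiff_const_smul l)

lemma gradient_avg (hv : IntegrableOn v (halfBall n)) {ε : ℝ} (hε : 0 < ε) (l : ℝ) (X : Amb n) :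
    ∇ (avg l ε v) X = l • ∫ Y in halfBall n, v Y • ∇ (kap n ε) (l • X - Y) := by
  have hl := ((integrable_indicator_iff measurableSet_halfBall).2 hv).locallyIntegrable
  have hk1 : ContDiff ℝ 1 (kap n ε) := (contDiff_kap ε).of_le (by exact_mod_cast le_top)
  have hd := fun x => (hasCompactSupport_kap (n := n) hε).hasFDerivAt_convolution_right
    (ContinuousLinearMap.mul ℝ ℝ) hl hk1 x
  rw [avg_eq_convolution hε, gradient_comp_smul (fun x => (hd x).differentiableAt)]
  congr 1
  rw [gradient, (hd _).fderiv, convolution, ← integral_indicator measurableSet_halfBall]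
  refine (((InnerProductSpace.toDual ℝ (Amb n)).symm.toContinuousLinearEquiv).integral_comp_comm
    _).symm.trans ?_
  congr 1; ext1 Y
  change (InnerProductSpace.toDual ℝ (Amb n)).symm _ = _
  have : ((ContinuousLinearMap.precompR (Amb n) (ContinuousLinearMap.mul ℝ ℝ))
      ((halfBall n).indicator v Y)) (fderiv ℝ (kap n ε) (l • X - Y)) =
      (halfBall n).indicator v Y • fderiv ℝ (kap n ε) (l • X - Y) := by
    ext w; simp
  rw [this, map_smul]
  by_cases hY : Y ∈ halfBall n <;> simp [hY, gradient]

/-- Differentiation falls on the kernel, and testing `LatZ` with that kernel moves it to `v` with no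
contribution from the sphere. The factor `l` is the inner derivative of the dilation. -/
lemma gradient_avg_of_latZ (hb' : b < 1) (hv : MemLp v 2 (wMeas n b)) {G : Amb n → Amb n}
    (hG : MemLp G 2 (wMeas n b)) (l' : LatZ v G) {ε l : ℝ} (hε : 0 < ε) (hl : 0 ≤ l) {X : Amb n}
    (hX : 0 ≤ ycoord X) : ∇ (avg l ε v) X = l • avg l ε G X := by
  rw [gradient_avg (MemLp.integrableOn_halfBall hb' hv) hε, avg_eq_setIntegral_kap hε]
  congr 1
  have ht : IsTest {X | 0 < ycoord X} (fun Y => kap n ε (l • X - Y)) :=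
    isTest_kap hε (by rw [ycoord_smul]; positivity)
  have h := l' _ ht
  rw [integral_add (IntegrableOn.smul_test_gradient (MemLp.integrableOn_halfBall hb' hv) ht)
      (IntegrableOn.test_smul (MemLp.integrableOn_halfBall hb' hG) ht)] at h
  rw [eq_neg_of_add_eq_zero_right h, ← integral_neg]
  congr 1; ext1 Y
  rw [gradient_kap_sub, smul_neg, neg_neg]

/-- The bump lies in the ball of radius `3`, so the average is supported in radius `(1 + 3ε)/(1 +
4ε)`. This is what the dilation factor `1 + 4ε` is chosen for. -/
lemma isTest_avg (hv : IntegrableOn v (halfBall n)) {ε : ℝ} (hε : 0 < ε) :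
    IsTest (Metric.ball 0 1) (avg (1 + 4 * ε) ε v) := by
  have hsub : Function.support (avg (1 + 4 * ε) ε v) ⊆
      Metric.closedBall 0 ((1 + ε * 3) / (1 + 4 * ε)) := by
    intro X hX
    have : ∃ Z, rho n Z • (halfBall n).indicator v ((1 + 4 * ε) • X + ε • Z) ≠ 0 := by
      by_contra! hall
      exact hX (by simp only [avg, hall, integral_zero])
    obtain ⟨Z, hZ⟩ := this
    have h1 := left_ne_zero_of_smul hZ
    have h2 := Set.mem_of_indicator_ne_zero (right_ne_zero_of_smul hZ)
    have h3 : ‖Z‖ ≤ 3 := norm_of_mem_closedBall (by rw [← tsupport_rho]; exact subset_tsupport _ h1)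
    have h4 : ‖(1 + 4 * ε) • X‖ ≤ 1 + ε * 3 := by
      calc ‖(1 + 4 * ε) • X‖ = ‖((1 + 4 * ε) • X + ε • Z) - ε • Z‖ := by rw [add_sub_cancel_right]
        _ ≤ ‖(1 + 4 * ε) • X + ε • Z‖ + ‖ε • Z‖ := norm_sub_le _ _
        _ ≤ _ := by
          rw [norm_smul ε, Real.norm_of_nonneg hε.le]
          gcongr; exact h2.1.le
    rw [norm_smul, Real.norm_of_nonneg (by positivity)] at h4
    rw [mem_closedBall_zero_iff, le_div_iff₀ (by positivity)]
    linarith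
  refine ⟨contDiff_avg hv hε _, HasCompactSupport.of_support_subset_isCompact
    (isCompact_closedBall _ _) hsub, (closure_minimal hsub Metric.isClosed_closedBall).trans ?_⟩
  refine Metric.closedBall_subset_ball ?_
  rw [div_lt_one (by positivity)]; linarith

end Conv

/-- **Density of test functions.** A function in `H^1(B_1^+; y^b)` vanishing on `S_1^+` is a limit
of smooth functions with compact support in the unit ball. -/
theorem exists_test_approx (hb : -1 < b) (hb' : b < 1) {v : Amb n → ℝ} {G : Amb n → Amb n}
    (hv : MemLp v 2 (wMeas n b)) (hG : MemLp G 2 (wMeas n b)) (l : LatZ v G) :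
    ∃ φ : ℕ → Amb n → ℝ, (∀ k, IsTest (Metric.ball 0 1) (φ k)) ∧
      Tendsto (fun k => eLpNorm (φ k - v) 2 (wMeas n b)) atTop (𝓝 0) ∧
      Tendsto (fun k => eLpNorm (∇ (φ k) - G) 2 (wMeas n b)) atTop (𝓝 0) := by
  -- The bounds for the averages need strongly measurable representatives, because of Tonelli's
  -- theorem.
  obtain ⟨v', hv'm, hvv'⟩ := hv.1
  obtain ⟨G', hG'm, hGG'⟩ := hG.1
  have hv' := hv.ae_eq hvv'
  have hG' := hG.ae_eq hGG'
  have l' : LatZ v' G' := l.congr hvv' hGG'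
  -- The scales are at most `1/4`, which keeps the dilation factor `1 + 4ε` in `[1, 2]`.
  set ε : ℕ → ℝ := fun k => 1 / (4 * ((k : ℝ) + 1)) with hεdef
  have hε0 : ∀ k, 0 < ε k := fun k => by positivity
  have hε1 : ∀ k, ε k ≤ 1 / 4 := fun k => by
    rw [hεdef]; simp only
    gcongr
    have : (0 : ℝ) ≤ k := by positivity
    linarith
  have hε : Tendsto ε atTop (𝓝 0) := by
    have := (tendsto_one_div_add_atTop_nhds_zero_nat (𝕜 := ℝ)).const_mul (1 / 4)
    simp only [mul_zero] at this
    refine this.congr fun k => ?_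
    rw [hεdef]; field_simp
  have hl : Tendsto (fun k => 1 + 4 * ε k) atTop (𝓝 1) := by
    have := (hε.const_mul 4).const_add 1
    simpa using this
  have hl1 : ∀ k, 1 ≤ 1 + 4 * ε k := fun k => by linarith [hε0 k]
  have hl2 : ∀ k, 1 + 4 * ε k ≤ 2 := fun k => by linarith [hε1 k]
  refine ⟨fun k => avg (1 + 4 * ε k) (ε k) v',
    fun k => isTest_avg (MemLp.integrableOn_halfBall hb' hv') (hε0 k), ?_, ?_⟩
  · refine (tendsto_eLpNorm_avg_sub hb hb' hv'm hv' hl1 hl2 hl hε0 hε).congr fun k => ?_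
    exact eLpNorm_congr_ae ((ae_eq_refl _).sub hvv'.symm)
  · have h1 := tendsto_eLpNorm_avg_sub hb hb' hG'm hG' hl1 hl2 hl hε0 hε
    obtain ⟨C, hC, hbd⟩ := exists_eLpNorm_avg_le (E := Amb n) n hb
    have h2 : Tendsto (fun k => ENNReal.ofReal (4 * ε k) * (C * eLpNorm G' 2 (wMeas n b))) atTop
        (𝓝 0) := by
      have h3 : Tendsto (fun k => ENNReal.ofReal (4 * ε k)) atTop (𝓝 0) := by
        have := ENNReal.tendsto_ofReal (hε.const_mul 4)
        simpa using this
      have := ENNReal.Tendsto.mul_const h3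
        (Or.inr (ENNReal.mul_ne_top hC hG'.2.ne) : (0 : ℝ≥0∞) ≠ 0 ∨ C * eLpNorm G' 2 (wMeas n b) ≠ ⊤)
      simpa using this
    have h3 := h2.add h1
    rw [add_zero] at h3
    refine tendsto_of_tendsto_of_tendsto_of_le_of_le tendsto_const_nhds h3
      (fun _ => zero_le) fun k => ?_
    -- Splitting `l = 1 + 4ε` leaves the usual averaging error for `G'` and a term of size `O(ε)`,
    -- since averages are bounded in `L²`.
    have e : ∇ (avg (1 + 4 * ε k) (ε k) v') - G =ᵐ[wMeas n b]
        (4 * ε k) • avg (1 + 4 * ε k) (ε k) G' + (avg (1 + 4 * ε k) (ε k) G' - G') := by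
      filter_upwards [ae_mem_halfBall, hGG'] with X hX h4
      simp only [Pi.sub_apply, Pi.add_apply, Pi.smul_apply]
      rw [gradient_avg_of_latZ hb' hv' hG' l' (hε0 k) (by linarith [hl1 k]) hX.2.le, h4]
      module
    have hm := stronglyMeasurable_avg (1 + 4 * ε k) (ε k) hG'm
    simp only
    rw [eLpNorm_congr_ae e]
    refine (eLpNorm_add_le (hm.const_smul _).aestronglyMeasurable
      (hm.sub hG'm).aestronglyMeasurable (by norm_num)).trans ?_
    gcongr
    rw [eLpNorm_const_smul, Real.enorm_of_nonneg (by linarith [hε0 k])]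
    gcongr
    exact hbd _ _ (hl1 k) (hl2 k) (hε0 k) _ hG'm

/-! ### Inequalities for smooth functions -/

lemma IsTest.sub {U : Set (Amb n)} {φ ψ : Amb n → ℝ} (h : IsTest U φ) (h' : IsTest U ψ) :
    IsTest U (φ - ψ) := by
  have := h.add (h'.const_smul (-1))
  rwa [neg_one_smul, ← sub_eq_add_neg] at this

lemma IsTest.gradient_sub {U : Set (Amb n)} {φ ψ : Amb n → ℝ} (h : IsTest U φ)
    (h' : IsTest U ψ) : ∇ (φ - ψ) = ∇ φ - ∇ ψ := by
  funext X
  simp [gradient, fderiv_sub (h.differentiable X) (h'.differentiable X)]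

lemma lintegral_wMeas_eq_hw {F : Amb n → ℝ≥0∞} (hF : Measurable F)
    (hF0 : ∀ X ∉ Metric.ball (0 : Amb n) 1, F X = 0) :
    ∫⁻ X, F X ∂(wMeas n b) = ∫⁻ y : ℝ, hw b y * ∫⁻ x : Thin n, F (pt x y) := by
  rw [lintegral_wMeas hF, ← lintegral_indicator measurableSet_halfBall]
  have e : (halfBall n).indicator (fun X => ENNReal.ofReal (ycoord X ^ b) * F X) =
      fun X => hw b (ycoord X) * F X := by
    funext X
    by_cases hX : X ∈ halfBall n
    · rw [Set.indicator_of_mem hX, hw_of_pos hX.2]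
    · rw [Set.indicator_of_notMem hX]
      rw [halfBall_eq_inter] at hX
      by_cases h1 : X ∈ Metric.ball 0 1
      · have h2 : ycoord X ≤ 0 := not_lt.1 fun h => hX ⟨h1, h⟩
        rw [hw_of_nonpos h2, zero_mul]
      · rw [hF0 X h1, mul_zero]
  have hm : Measurable fun X : Amb n => hw b (ycoord X) * F X :=
    (measurable_hw.comp (by fun_prop)).mul hF
  rw [e, lintegral_amb hm]
  refine lintegral_congr fun y => ?_
  simp only [ycoord_pt]
  rw [lintegral_const_mul]
  exact hF.comp ((ptL n).continuous.measurable.comp (by fun_prop : Measurable fun x => (x, y)))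

lemma enorm_sub_le_lintegral_gradient {φ : Amb n → ℝ} (hφ : ContDiff ℝ 1 φ) (X Z : Amb n)
    {r s : ℝ} (hrs : r ≤ s) :
    ‖φ (X + s • Z) - φ (X + r • Z)‖ₑ ≤ ∫⁻ t in Set.Ioo r s, ‖∇ φ (X + t • Z)‖ₑ * ‖Z‖ₑ := by
  have hd : ∀ t : ℝ, HasDerivAt (fun t => φ (X + t • Z)) (fderiv ℝ φ (X + t • Z) Z) t := fun t => by
    have h1 : HasDerivAt (fun t : ℝ => X + t • Z) Z t := by
      simpa using ((hasDerivAt_id t).smul_const Z).const_add X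
    exact ((hφ.differentiable (by simp) _).hasFDerivAt).comp_hasDerivAt t h1
  have hc : Continuous fun t : ℝ => fderiv ℝ φ (X + t • Z) Z :=
    ((hφ.continuous_fderiv one_ne_zero).comp (by fun_prop)).clm_apply continuous_const
  have h := intervalIntegral.integral_eq_sub_of_hasDerivAt (fun t _ => hd t)
    (hc.intervalIntegrable r s)
  rw [← h, intervalIntegral.integral_of_le hrs, integral_Ioc_eq_integral_Ioo]
  refine (enorm_integral_le_lintegral_enorm _).trans (lintegral_mono fun t => ?_)
  have h2 : ‖fderiv ℝ φ (X + t • Z) Z‖ ≤ ‖∇ φ (X + t • Z)‖ * ‖Z‖ := by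
    rw [norm_gradient]; exact ContinuousLinearMap.le_opNorm _ _
  simpa only [← ofReal_norm, ← ENNReal.ofReal_mul (norm_nonneg _)] using
    ENNReal.ofReal_le_ofReal h2

/-- Cauchy-Schwarz for `F = t^(-b/2) · t^(b/2) F`. On `(0, r)` the first factor is finite when `b <
1`, so weighted `L²` bounds on a derivative control increments down to height `0`. -/
lemma sq_lintegral_le_weight (b : ℝ) {I : Set ℝ} (hI : MeasurableSet I)
    (hI0 : ∀ t ∈ I, 0 < t) {F : ℝ → ℝ≥0∞} (hF : Measurable F) :
    (∫⁻ t in I, F t) ^ 2 ≤ (∫⁻ t in I, ENNReal.ofReal (t ^ (-b))) *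
      ∫⁻ t in I, ENNReal.ofReal (t ^ b) * F t ^ 2 := by
  have h := ENNReal.lintegral_mul_le_Lp_mul_Lq (volume.restrict I) (Real.HolderConjugate.two_two)
    (f := fun t => ENNReal.ofReal (t ^ (-b / 2))) (g := fun t => ENNReal.ofReal (t ^ (b / 2)) * F t)
    (Measurable.aemeasurable (by fun_prop)) (Measurable.aemeasurable (by fun_prop))
  have e1 : ∫⁻ t in I, ((fun t => ENNReal.ofReal (t ^ (-b / 2))) *
      fun t => ENNReal.ofReal (t ^ (b / 2)) * F t) t = ∫⁻ t in I, F t := by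
    refine setLIntegral_congr_fun hI fun t ht => ?_
    simp only [Pi.mul_apply]
    rw [← mul_assoc, ← ENNReal.ofReal_mul (Real.rpow_nonneg (hI0 t ht).le _),
      ← Real.rpow_add (hI0 t ht), neg_div, neg_add_cancel, Real.rpow_zero, ENNReal.ofReal_one,
      one_mul]
  have e2 : ∫⁻ t in I, ENNReal.ofReal (t ^ (-b / 2)) ^ (2 : ℝ) =
      ∫⁻ t in I, ENNReal.ofReal (t ^ (-b)) := by
    refine setLIntegral_congr_fun hI fun t ht => ?_
    rw [ENNReal.ofReal_rpow_of_nonneg (Real.rpow_nonneg (hI0 t ht).le _) (by norm_num),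
      ← Real.rpow_mul (hI0 t ht).le]
    congr 2; ring
  have e3 : ∫⁻ t in I, (ENNReal.ofReal (t ^ (b / 2)) * F t) ^ (2 : ℝ) =
      ∫⁻ t in I, ENNReal.ofReal (t ^ b) * F t ^ 2 := by
    refine setLIntegral_congr_fun hI fun t ht => ?_
    rw [ENNReal.mul_rpow_of_nonneg _ _ (by norm_num),
      ENNReal.ofReal_rpow_of_nonneg (Real.rpow_nonneg (hI0 t ht).le _) (by norm_num),
      ← Real.rpow_mul (hI0 t ht).le]
    congr 1
    · congr 2; ring
    · norm_num
  rw [e1, e2, e3] at h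
  calc _ ≤ ((∫⁻ t in I, ENNReal.ofReal (t ^ (-b))) ^ (1 / 2 : ℝ) *
      (∫⁻ t in I, ENNReal.ofReal (t ^ b) * F t ^ 2) ^ (1 / 2 : ℝ)) ^ 2 := by gcongr
    _ = _ := by
      rw [mul_pow, ← ENNReal.rpow_natCast, ← ENNReal.rpow_natCast, ← ENNReal.rpow_mul,
        ← ENNReal.rpow_mul]
      simp

lemma lintegral_Ioo_rpow {a r : ℝ} (ha : -1 < a) (hr : 0 < r) :
    ∫⁻ t in Set.Ioo 0 r, ENNReal.ofReal (t ^ a) = ENNReal.ofReal (r ^ (a + 1) / (a + 1)) := by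
  rw [← lintegral_Iio_hw ha hr, hw, lintegral_indicator measurableSet_Ioi,
    Measure.restrict_restrict measurableSet_Ioi, Set.Ioi_inter_Iio]

lemma pt_zero_add_smul (x : Thin n) (t : ℝ) : pt x 0 + t • pt 0 1 = pt x t := by
  rw [← pt_smul, ← pt_add]; simp

lemma measurable_pt_left (y : ℝ) : Measurable fun x : Thin n => pt x y :=
  (ptL n).continuous.measurable.comp (by fun_prop : Measurable fun x => (x, y))

lemma measurable_pt_right (x : Thin n) : Measurable fun y : ℝ => pt x y :=
  (ptL n).continuous.measurable.comp (by fun_prop : Measurable fun y => (x, y))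

lemma continuous_pt_left (y : ℝ) : Continuous fun x : Thin n => pt x y :=
  (ptL n).continuous.comp (by fun_prop : Continuous fun x => (x, y))

lemma continuous_pt_right (x : Thin n) : Continuous fun y : ℝ => pt x y :=
  (ptL n).continuous.comp (by fun_prop : Continuous fun y => (x, y))

lemma IsTest.measurable_enorm_gradient {U : Set (Amb n)} {φ : Amb n → ℝ} (hφ : IsTest U φ) :
    Measurable fun X => ‖∇ φ X‖ₑ ^ 2 :=
  (hφ.continuous_gradient.measurable.enorm).pow_const 2

lemma IsTest.lintegral_gradient {φ : Amb n → ℝ} (hφ : IsTest (Metric.ball 0 1) φ) :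
    ∫⁻ X, ‖∇ φ X‖ₑ ^ 2 ∂(wMeas n b) = ∫⁻ y : ℝ, hw b y * ∫⁻ x : Thin n, ‖∇ φ (pt x y)‖ₑ ^ 2 :=
  lintegral_wMeas_eq_hw hφ.measurable_enorm_gradient fun X hX => by
    rw [hφ.gradient_zero_of_notMem hX]; simp

/-- Bound for the `L^2` norm of a test function on horizontal slices. -/
lemma IsTest.lintegral_slice_le (hb' : b < 1) {φ : Amb n → ℝ} (hφ : IsTest (Metric.ball 0 1) φ)
    {y : ℝ} (hy : 0 ≤ y) :
    ∫⁻ x : Thin n, ‖φ (pt x y)‖ₑ ^ 2 ≤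
      ENNReal.ofReal (1 / (1 - b)) * ∫⁻ X, ‖∇ φ X‖ₑ ^ 2 ∂(wMeas n b) := by
  have hvan : ∀ (x : Thin n) (t : ℝ), 1 ≤ t → φ (pt x t) = 0 := fun x t ht => by
    refine hφ.zero_of_notMem ?_
    rw [mem_ball_zero_iff, not_lt]
    have := abs_ycoord_le (pt x t)
    rw [ycoord_pt] at this
    exact ht.trans ((le_abs_self t).trans this)
  have hc1 : ContDiff ℝ 1 φ := hφ.smooth.of_le (by exact_mod_cast le_top)
  have hm1 : ∀ x : Thin n, Measurable fun t : ℝ => ‖∇ φ (pt x t)‖ₑ := fun x =>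
    hφ.continuous_gradient.measurable.enorm.comp (measurable_pt_right x)
  have key : ∀ x : Thin n, ‖φ (pt x y)‖ₑ ^ 2 ≤ ENNReal.ofReal (1 / (1 - b)) *
      ∫⁻ t : ℝ, hw b t * ‖∇ φ (pt x t)‖ₑ ^ 2 := fun x => by
    rcases le_or_gt 1 y with h1 | h1
    · rw [hvan x y h1]; simp
    -- `φ` vanishes at height `1`, so its value at height `y` is an integral of `∂_y φ` over `(y,
    -- 1)`.
    · have h2 := enorm_sub_le_lintegral_gradient hc1 (pt x 0) (pt 0 1) h1.le
      simp only [pt_zero_add_smul] at h2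
      rw [hvan x 1 le_rfl, zero_sub, enorm_neg] at h2
      have h3 : ‖pt (0 : Thin n) 1‖ₑ = 1 := by
        rw [← ofReal_norm, norm_pt_zero]; simp
      simp only [h3, mul_one] at h2
      calc _ ≤ (∫⁻ t in Set.Ioo (0 : ℝ) 1, ‖∇ φ (pt x t)‖ₑ) ^ 2 := by
            gcongr
            exact h2.trans (lintegral_mono_set (Set.Ioo_subset_Ioo_left hy))
        _ ≤ _ := sq_lintegral_le_weight b measurableSet_Ioo (fun t ht => ht.1) (hm1 x)
        _ ≤ _ := by
            rw [lintegral_Ioo_rpow (by linarith) one_pos, Real.one_rpow, neg_add_eq_sub]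
            gcongr _ * ?_
            · rw [← lintegral_indicator measurableSet_Ioo]
              refine lintegral_mono fun t => ?_
              by_cases ht : t ∈ Set.Ioo (0 : ℝ) 1
              · rw [Set.indicator_of_mem ht, hw_of_pos ht.1]
              · rw [Set.indicator_of_notMem ht]; exact zero_le
  refine (lintegral_mono key).trans (le_of_eq ?_)
  have hm2 : Measurable (Function.uncurry fun (x : Thin n) (t : ℝ) =>
      hw b t * ‖∇ φ (pt x t)‖ₑ ^ 2) :=
    (measurable_hw.comp measurable_snd).mul
      (hφ.measurable_enorm_gradient.comp (ptL n).continuous.measurable)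
  rw [lintegral_const_mul _ hm2.lintegral_prod_right, hφ.lintegral_gradient,
    lintegral_lintegral_swap hm2.aemeasurable]
  congr 1
  refine lintegral_congr fun t => ?_
  have hm3 : Measurable fun x : Thin n => ‖∇ φ (pt x t)‖ₑ ^ 2 :=
    hφ.measurable_enorm_gradient.comp (measurable_pt_left t)
  rw [lintegral_const_mul _ hm3]

/-- The slice bound is uniform in the height; integrating it against `y^b` over `(0, 1)` contributes
`1/(1 + b)`. -/
lemma IsTest.lintegral_poincare (hb : -1 < b) (hb' : b < 1) {φ : Amb n → ℝ}
    (hφ : IsTest (Metric.ball 0 1) φ) :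
    ∫⁻ X, ‖φ X‖ₑ ^ 2 ∂(wMeas n b) ≤ ENNReal.ofReal (1 / (1 + b) * (1 / (1 - b))) *
      ∫⁻ X, ‖∇ φ X‖ₑ ^ 2 ∂(wMeas n b) := by
  have hm : Measurable fun X => ‖φ X‖ₑ ^ 2 := hφ.continuous.measurable.enorm.pow_const 2
  rw [lintegral_wMeas_eq_hw hm fun X hX => by rw [hφ.zero_of_notMem hX]; simp]
  calc _ ≤ ∫⁻ y in Set.Ioo (0 : ℝ) 1, ENNReal.ofReal (y ^ b) *
        (ENNReal.ofReal (1 / (1 - b)) * ∫⁻ X, ‖∇ φ X‖ₑ ^ 2 ∂(wMeas n b)) := by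
        rw [← lintegral_indicator measurableSet_Ioo]
        refine lintegral_mono fun y => ?_
        by_cases hy : y ∈ Set.Ioo (0 : ℝ) 1
        · rw [Set.indicator_of_mem hy, hw_of_pos hy.1]
          gcongr
          exact hφ.lintegral_slice_le hb' hy.1.le
        · rw [Set.indicator_of_notMem hy]
          rcases le_or_gt y 0 with h | h
          · rw [hw_of_nonpos h, zero_mul]
          · have h1 : 1 ≤ y := not_lt.1 fun h' => hy ⟨h, h'⟩
            refine le_of_eq (mul_eq_zero_of_right _ ?_)
            refine lintegral_eq_zero_of_ae_eq_zero (ae_of_all _ fun x => ?_)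
            have h2 : pt x y ∉ Metric.ball (0 : Amb n) 1 := by
              rw [mem_ball_zero_iff, not_lt]
              have := abs_ycoord_le (pt x y)
              rw [ycoord_pt] at this
              exact h1.trans ((le_abs_self y).trans this)
            simp [hφ.zero_of_notMem h2]
    _ = _ := by
        rw [lintegral_mul_const _ (by fun_prop), lintegral_Ioo_rpow hb one_pos, ← mul_assoc,
          ← ENNReal.ofReal_mul (by rw [Real.one_rpow]; exact one_div_nonneg.2 (by linarith))]
        congr 2
        rw [Real.one_rpow, add_comm b 1]

/-- The Gauss-Green formula for smooth functions. -/
lemma IsTest.integral_ycoord_gradient {χ : Amb n → ℝ} (hχ : IsTest (Metric.ball 0 1) χ) :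
    ∫ X in halfBall n, ycoord (∇ χ X) = - ∫ x in flatBall n, χ (pt x 0) := by
  have hc : Continuous fun X => ycoord (∇ χ X) := continuous_ycoord.comp hχ.continuous_gradient
  have hsupp : HasCompactSupport fun X => ycoord (∇ χ X) :=
    hχ.hasCompactSupport_gradient.comp_left (g := ycoord) ((ycoordL n).map_zero)
  have hint : Integrable fun X => ycoord (∇ χ X) := hc.integrable_of_hasCompactSupport hsupp
  have hmp : MeasurableSet {X : Amb n | 0 < ycoord X} :=
    (isOpen_lt continuous_const continuous_ycoord).measurableSet
  -- The gradient vanishes off the unit ball, so the half ball may be replaced by the half space and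
  -- each vertical line integrated over `(0, ∞)`.
  have e1 : (halfBall n).indicator (fun X => ycoord (∇ χ X)) =
      {X : Amb n | 0 < ycoord X}.indicator (fun X => ycoord (∇ χ X)) := by
    funext X
    by_cases h1 : X ∈ Metric.ball (0 : Amb n) 1
    · by_cases h2 : 0 < ycoord X
      · rw [Set.indicator_of_mem (by rw [halfBall_eq_inter]; exact ⟨h1, h2⟩),
          Set.indicator_of_mem (by exact h2)]
      · rw [Set.indicator_of_notMem (fun h => h2 h.2), Set.indicator_of_notMem (by exact h2)]
    · have : ycoord (∇ χ X) = 0 := by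
        rw [hχ.gradient_zero_of_notMem h1]; exact (ycoordL n).map_zero
      simp [Set.indicator_apply, this]
  have hflat : ∀ x ∉ flatBall n, χ (pt x 0) = 0 := fun x hx => by
    refine hχ.zero_of_notMem fun h => hx ?_
    rw [mem_ball_zero_iff] at h
    simp only [flatBall, mem_ball_zero_iff]
    have := norm_pt_sq x 0
    nlinarith [norm_nonneg x, norm_nonneg (pt x 0)]
  rw [← integral_indicator measurableSet_halfBall, e1, integral_amb (hint.indicator hmp),
    setIntegral_eq_integral_of_forall_compl_eq_zero hflat, ← integral_neg]
  congr 1; ext1 x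
  have e2 : (fun y => {X : Amb n | 0 < ycoord X}.indicator (fun X => ycoord (∇ χ X)) (pt x y)) =
      (Set.Ioi (0 : ℝ)).indicator fun y => ycoord (∇ χ (pt x y)) := by
    funext y
    simp [Set.indicator_apply]
  rw [e2, integral_indicator measurableSet_Ioi]
  have hd : ∀ y : ℝ, HasDerivAt (fun y => χ (pt x y)) (ycoord (∇ χ (pt x y))) y := fun y => by
    rw [ycoord_gradient]
    have h1 : HasDerivAt (fun t : ℝ => pt x 0 + t • pt 0 1) (pt (0 : Thin n) 1) y := by
      simpa using ((hasDerivAt_id y).smul_const (pt (0 : Thin n) 1)).const_add (pt x 0)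
    simp only [pt_zero_add_smul] at h1
    exact ((hχ.differentiable _).hasFDerivAt).comp_hasDerivAt y h1
  have hcs : HasCompactSupport fun y : ℝ => χ (pt x y) := by
    refine HasCompactSupport.of_support_subset_isCompact (isCompact_Icc (a := (-1 : ℝ)) (b := 1))
      fun y hy => ?_
    have h1 : pt x y ∈ Metric.ball (0 : Amb n) 1 := by
      by_contra h; exact hy (hχ.zero_of_notMem h)
    rw [mem_ball_zero_iff] at h1
    have h2 := abs_ycoord_le (pt x y)
    rw [ycoord_pt] at h2
    exact abs_le.1 (h2.trans h1.le)
  have hcs' : HasCompactSupport fun y : ℝ => ycoord (∇ χ (pt x y)) := by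
    have e3 : (fun y : ℝ => ycoord (∇ χ (pt x y))) = deriv fun y => χ (pt x y) :=
      funext fun y => (hd y).deriv.symm
    rw [e3]
    exact hcs.deriv
  have hI : IntegrableOn (fun y : ℝ => ycoord (∇ χ (pt x y))) (Set.Ioi 0) :=
    ((hc.comp (continuous_pt_right x)).integrable_of_hasCompactSupport hcs').integrableOn
  have := integral_Ioi_of_hasDerivAt_of_tendsto (f := fun y => χ (pt x y)) (m := 0)
    (hd 0).continuousAt.continuousWithinAt (fun y _ => hd y) hI
    ((hcs.is_zero_at_infty).mono_left atTop_le_cocompact)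
  rw [this, zero_sub]

lemma IsTest.gauss_green {φ ψ : Amb n → ℝ} (hφ : IsTest (Metric.ball 0 1) φ)
    (hψ : IsTest (Metric.ball 0 1) ψ) :
    ∫ X in halfBall n, (φ X * ycoord (∇ ψ X) + ψ X * ycoord (∇ φ X)) =
      - ∫ x in flatBall n, φ (pt x 0) * ψ (pt x 0) := by
  have h := (hφ.mul_left hψ.smooth).integral_ycoord_gradient
  simp only [mul_comm (ψ _) (φ _)] at h
  rw [← h]
  congr 1; ext1 X
  rw [gradient_mul (hφ.differentiable X) (hψ.differentiable X), ycoord_add, ycoord_smul,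
    ycoord_smul]

/-! ### Comparison of traces and averages -/

lemma lintegral_comp_mul_le {K : ℝ → ℝ≥0∞} (hK : Measurable K) {s : ℝ} (hs : 1 ≤ s) :
    ∫⁻ t, K (t * s) ≤ ∫⁻ t, K t := by
  have h := lintegral_comp_add_smul volume hK 0 (r := s) (by linarith)
  simp only [zero_add, smul_eq_mul, mul_comm s] at h
  rw [h]
  refine mul_le_of_le_one_left zero_le ?_
  rw [← ENNReal.ofReal_one]
  refine ENNReal.ofReal_le_ofReal ?_
  rw [abs_of_pos (by positivity)]
  exact inv_le_one_of_one_le₀ (one_le_pow₀ hs)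

lemma pt_left_add (x z : Thin n) (t s : ℝ) : pt x 0 + t • pt z s = pt (t • z + x) (t * s) := by
  rw [← pt_smul, ← pt_add, add_comm x, zero_add]

/-- Write `Z = (z, s)`. The horizontal shift `t • z` disappears in the integral over `x`, leaving
the slice integral at height `ts`. Since `s ∈ (1, 3)` and `b > -1`, one has `t^b ≤ 3 (ts)^b`, and
the substitution `t ↦ ts` does not increase the integral. -/
lemma IsTest.lintegral_ray_le (hb : -1 < b) {φ : Amb n → ℝ}
    (hφ : IsTest (Metric.ball 0 1) φ) {Z : Amb n} (hZ : Z ∈ Metric.ball (pt (0 : Thin n) 2) 1)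
    (ε : ℝ) :
    ∫⁻ x : Thin n, (∫⁻ t in Set.Ioo 0 ε, ENNReal.ofReal (t ^ b) * ‖∇ φ (pt x 0 + t • Z)‖ₑ ^ 2) ≤
      3 * ∫⁻ X, ‖∇ φ X‖ₑ ^ 2 ∂(wMeas n b) := by
  obtain ⟨z, s, rfl⟩ := exists_pt Z
  obtain ⟨-, hs1, hs3⟩ := pt_mem_ball_two hZ
  set K : ℝ → ℝ≥0∞ := fun y => hw b y * ∫⁻ x : Thin n, ‖∇ φ (pt x y)‖ₑ ^ 2 with hKdef
  have hK : Measurable K := by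
    refine measurable_hw.mul ?_
    have hm : Measurable (Function.uncurry fun (y : ℝ) (x : Thin n) => ‖∇ φ (pt x y)‖ₑ ^ 2) :=
      hφ.measurable_enorm_gradient.comp ((ptL n).continuous.measurable.comp measurable_swap)
    exact hm.lintegral_prod_right
  have hm : Measurable (Function.uncurry fun (x : Thin n) (t : ℝ) =>
      ENNReal.ofReal (t ^ b) * ‖∇ φ (pt x 0 + t • pt z s)‖ₑ ^ 2) := by
    refine Measurable.mul (by fun_prop) (hφ.measurable_enorm_gradient.comp ?_)
    exact ((measurable_pt_left 0).comp measurable_fst).add (by fun_prop)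
  rw [lintegral_lintegral_swap hm.aemeasurable]
  calc _ ≤ ∫⁻ t in Set.Ioo 0 ε, 3 * K (t * s) := by
        refine setLIntegral_mono ((hK.comp (by fun_prop)).const_mul 3) fun t ht => ?_
        have hts : 0 < t * s := mul_pos ht.1 (by linarith)
        have hm2 : Measurable fun x : Thin n => ‖∇ φ (pt x 0 + t • pt z s)‖ₑ ^ 2 :=
          hφ.measurable_enorm_gradient.comp ((measurable_pt_left 0).add_const _)
        rw [lintegral_const_mul _ hm2, hKdef]
        simp only [pt_left_add]
        rw [lintegral_add_left_eq_self (fun x => ‖∇ φ (pt x (t * s))‖ₑ ^ 2) (t • z),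
          ← mul_assoc, hw_of_pos hts]
        gcongr ?_ * _
        have h3 : (3 : ℝ≥0∞) = ENNReal.ofReal 3 := by simp
        rw [h3, ← ENNReal.ofReal_mul (by norm_num)]
        refine ENNReal.ofReal_le_ofReal ?_
        rw [Real.mul_rpow ht.1.le (by linarith)]
        have h4 : (1 / 3 : ℝ) ≤ s ^ b := by
          calc (1 / 3 : ℝ) ≤ s ^ (-1 : ℝ) := by
                rw [Real.rpow_neg_one, ← one_div]; gcongr
            _ ≤ s ^ b := Real.rpow_le_rpow_of_exponent_le hs1.le hb.le
        nlinarith [Real.rpow_pos_of_pos ht.1 b]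
    _ ≤ ∫⁻ t, 3 * K (t * s) := setLIntegral_le_lintegral _ _
    _ ≤ _ := by
        have hKs : Measurable fun t => K (t * s) := hK.comp (by fun_prop)
        rw [lintegral_const_mul _ hKs, hφ.lintegral_gradient]
        gcongr 3 * ?_
        exact lintegral_comp_mul_le hK hs1.le

/-- Quantitative comparison of the trace with the averages at scale `ε`. -/
lemma IsTest.lintegral_trace_sub_avg_le (hb : -1 < b) (hb' : b < 1) {φ : Amb n → ℝ}
    (hφ : IsTest (Metric.ball 0 1) φ) {ε : ℝ} (hε : 0 < ε) :
    ∫⁻ x : Thin n, ‖φ (pt x 0) - avg 1 ε φ (pt x 0)‖ₑ ^ 2 ≤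
      ENNReal.ofReal (27 * (ε ^ (1 - b) / (1 - b))) * ∫⁻ X, ‖∇ φ X‖ₑ ^ 2 ∂(wMeas n b) := by
  have hc1 : ContDiff ℝ 1 φ := hφ.smooth.of_le (by exact_mod_cast le_top)
  -- `κ` is `∫₀^ε t^(-b) dt`. The constant `27` is `9 · 3`: the `9` bounds `‖Z‖²` on the support of
  -- the bump, the `3` comes from `lintegral_ray_le`.
  set κ := ENNReal.ofReal (ε ^ (1 - b) / (1 - b)) with hκ
  have hmG : Measurable fun X => ‖∇ φ X‖ₑ := hφ.continuous_gradient.measurable.enorm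
  have step1 : ∀ x : Thin n, ‖φ (pt x 0) - avg 1 ε φ (pt x 0)‖ₑ ≤
      ∫⁻ Z, ‖φ (pt x 0 + ε • Z) - φ (pt x 0)‖ₑ ∂(nu n) := fun x => by
    have h1 : φ (pt x 0) = ∫ Z, rho n Z * φ (pt x 0) := by
      rw [integral_mul_const, integral_rho, one_mul]
    have h2 : avg 1 ε φ (pt x 0) = ∫ Z, rho n Z * φ (pt x 0 + ε • Z) := by
      rw [avg]
      congr 1; ext1 Z
      rw [one_smul, smul_eq_mul]
      by_cases hZ : rho n Z = 0
      · simp [hZ]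
      · have hZ' := ycoord_of_mem_closedBall (by rw [← tsupport_rho]; exact subset_tsupport _ hZ)
        congr 1
        -- The point has positive height, so it leaves the half ball only by leaving the unit ball,
        -- where `φ` is already zero.
        by_cases h3 : pt x 0 + ε • Z ∈ halfBall n
        · rw [Set.indicator_of_mem h3]
        · rw [Set.indicator_of_notMem h3]
          refine (hφ.zero_of_notMem fun h => h3 ?_).symm
          rw [halfBall_eq_inter]
          refine ⟨h, ?_⟩
          simp only [Set.mem_ofPred_eq]
          rw [ycoord_add, ycoord_smul, ycoord_pt]
          nlinarith
    have hi1 : Integrable fun Z => rho n Z * φ (pt x 0) := integrable_rho.mul_const _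
    have hi2 : Integrable fun Z => rho n Z * φ (pt x 0 + ε • Z) :=
      (continuous_rho.mul (hφ.continuous.comp (by fun_prop))).integrable_of_hasCompactSupport
        hasCompactSupport_rho.mul_right
    have h3 : φ (pt x 0) - avg 1 ε φ (pt x 0) =
        -∫ Z, rho n Z * (φ (pt x 0 + ε • Z) - φ (pt x 0)) := by
      rw [h2]
      nth_rewrite 1 [h1]
      rw [← integral_sub hi1 hi2, ← integral_neg]
      congr 1; ext1 Z; ring
    rw [h3, enorm_neg]
    refine (enorm_integral_le_lintegral_enorm _).trans (le_of_eq ?_)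
    have hm : Measurable fun Z => ‖φ (pt x 0 + ε • Z) - φ (pt x 0)‖ₑ :=
      ((hφ.continuous.comp (by fun_prop)).sub continuous_const).measurable.enorm
    rw [nu, lintegral_withDensity_eq_lintegral_mul _ measurable_ofReal_rho hm]
    refine lintegral_congr fun Z => ?_
    simp only [Pi.mul_apply]
    rw [enorm_mul, Real.enorm_of_nonneg (rho_nonneg Z)]
  have step2 : ∀ (x : Thin n) (Z : Amb n), Z ∈ Metric.ball (pt (0 : Thin n) 2) 1 →
      ‖φ (pt x 0 + ε • Z) - φ (pt x 0)‖ₑ ^ 2 ≤ 9 * (κ *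
        ∫⁻ t in Set.Ioo 0 ε, ENNReal.ofReal (t ^ b) * ‖∇ φ (pt x 0 + t • Z)‖ₑ ^ 2) :=
    fun x Z hZ => by
    have h1 := enorm_sub_le_lintegral_gradient hc1 (pt x 0) Z hε.le
    rw [zero_smul, add_zero] at h1
    have hm : Measurable fun t : ℝ => ‖∇ φ (pt x 0 + t • Z)‖ₑ := hmG.comp (by fun_prop)
    have h3 : ‖Z‖ₑ ≤ 3 := by
      rw [← ofReal_norm]
      have := ENNReal.ofReal_le_ofReal (norm_of_mem_closedBall (Metric.ball_subset_closedBall hZ))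
      simpa using this
    rw [lintegral_mul_const _ hm] at h1
    calc _ ≤ ((∫⁻ t in Set.Ioo 0 ε, ‖∇ φ (pt x 0 + t • Z)‖ₑ) * 3) ^ 2 := by
          gcongr
          exact h1.trans (by gcongr)
      _ = 9 * (∫⁻ t in Set.Ioo 0 ε, ‖∇ φ (pt x 0 + t • Z)‖ₑ) ^ 2 := by
          rw [mul_pow, mul_comm]; norm_num
      _ ≤ _ := by
          gcongr 9 * ?_
          refine (sq_lintegral_le_weight b measurableSet_Ioo (fun t ht => ht.1) hm).trans ?_
          rw [lintegral_Ioo_rpow (by linarith) hε, hκ, neg_add_eq_sub]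
  have hm3 : Measurable (Function.uncurry fun (x : Thin n) (Z : Amb n) =>
      ∫⁻ t in Set.Ioo 0 ε, ENNReal.ofReal (t ^ b) * ‖∇ φ (pt x 0 + t • Z)‖ₑ ^ 2) := by
    have hm : Measurable (Function.uncurry fun (p : Thin n × Amb n) (t : ℝ) =>
        ENNReal.ofReal (t ^ b) * ‖∇ φ (pt p.1 0 + t • p.2)‖ₑ ^ 2) := by
      refine Measurable.mul (by fun_prop) (hφ.measurable_enorm_gradient.comp ?_)
      exact ((measurable_pt_left 0).comp (by fun_prop)).add (by fun_prop)
    exact hm.lintegral_prod_right'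
  calc _ ≤ ∫⁻ x : Thin n, (∫⁻ Z, 9 * (κ * ∫⁻ t in Set.Ioo 0 ε,
        ENNReal.ofReal (t ^ b) * ‖∇ φ (pt x 0 + t • Z)‖ₑ ^ 2) ∂(nu n)) := by
        refine lintegral_mono fun x => ?_
        calc _ ≤ (∫⁻ Z, ‖φ (pt x 0 + ε • Z) - φ (pt x 0)‖ₑ ∂(nu n)) ^ 2 := by
              gcongr; exact step1 x
          _ ≤ ∫⁻ Z, ‖φ (pt x 0 + ε • Z) - φ (pt x 0)‖ₑ ^ 2 ∂(nu n) := by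
              refine sq_lintegral_le (Measurable.aemeasurable ?_)
              exact ((hφ.continuous.comp (by fun_prop)).sub continuous_const).measurable.enorm
          _ ≤ _ := by
              refine lintegral_mono_ae ?_
              filter_upwards [ae_nu_mem] with Z hZ using step2 x Z hZ
    _ = 9 * (κ * ∫⁻ Z, (∫⁻ x : Thin n, ∫⁻ t in Set.Ioo 0 ε,
        ENNReal.ofReal (t ^ b) * ‖∇ φ (pt x 0 + t • Z)‖ₑ ^ 2) ∂(nu n)) := by
        rw [lintegral_lintegral_swap ((hm3.const_mul κ).const_mul 9).aemeasurable]
        rw [← lintegral_const_mul _ (hm3.lintegral_prod_left), ← lintegral_const_mul]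
        · refine lintegral_congr fun Z => ?_
          rw [lintegral_const_mul, lintegral_const_mul]
          · exact hm3.of_uncurry_right
          · exact hm3.of_uncurry_right.const_mul κ
        · exact (hm3.lintegral_prod_left).const_mul κ
    _ ≤ 9 * (κ * ∫⁻ Z, (3 * ∫⁻ X, ‖∇ φ X‖ₑ ^ 2 ∂(wMeas n b)) ∂(nu n)) := by
        gcongr 9 * (κ * ?_)
        refine lintegral_mono_ae ?_
        filter_upwards [ae_nu_mem] with Z hZ using hφ.lintegral_ray_le hb hZ ε
    _ = _ := by
        rw [lintegral_const, measure_univ, mul_one, ENNReal.ofReal_mul (by norm_num), ← hκ]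
        have : ENNReal.ofReal 27 = 9 * 3 := by norm_num
        rw [this]; ring

/-! ### Weak convergence in `L^2` -/

section WeakConv

variable {α F : Type*} [MeasurableSpace α] {m : Measure α} [NormedAddCommGroup F]
  [InnerProductSpace ℝ F]

/-- Weak convergence in `L^2`. -/
def WeakTo (m : Measure α) (u : ℕ → α → F) (u₀ : α → F) : Prop :=
  ∀ Ψ : α → F, MemLp Ψ 2 m →
    Tendsto (fun k => ∫ a, inner ℝ (u k a) (Ψ a) ∂m) atTop (𝓝 (∫ a, inner ℝ (u₀ a) (Ψ a) ∂m))

lemma integral_inner_toLp {u Ψ : α → F} (hu : MemLp u 2 m) (hΨ : MemLp Ψ 2 m) :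
    ∫ a, inner ℝ (u a) (Ψ a) ∂m = inner ℝ (hu.toLp u) (hΨ.toLp Ψ) := by
  rw [L2.inner_def]
  refine integral_congr_ae ?_
  filter_upwards [hu.coeFn_toLp, hΨ.coeFn_toLp] with a h1 h2
  rw [h1, h2]

lemma abs_integral_inner_le {u Ψ : α → F} (hu : MemLp u 2 m) (hΨ : MemLp Ψ 2 m) :
    |∫ a, inner ℝ (u a) (Ψ a) ∂m| ≤ (eLpNorm u 2 m).toReal * (eLpNorm Ψ 2 m).toReal := by
  rw [integral_inner_toLp hu hΨ, ← Lp.norm_toLp u hu, ← Lp.norm_toLp Ψ hΨ]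
  exact abs_real_inner_le_norm _ _

lemma integral_norm_sq_eq {u : α → F} (hu : MemLp u 2 m) :
    ∫ a, ‖u a‖ ^ 2 ∂m = (eLpNorm u 2 m).toReal ^ 2 := by
  rw [← Lp.norm_toLp u hu, ← real_inner_self_eq_norm_sq, ← integral_inner_toLp hu hu]
  simp only [real_inner_self_eq_norm_sq]

lemma tendsto_toLp {F : Type*} [NormedAddCommGroup F] {u : ℕ → α → F} {u₀ : α → F}
    (hu : ∀ k, MemLp (u k) 2 m) (h0 : MemLp u₀ 2 m)
    (h : Tendsto (fun k => eLpNorm (u k - u₀) 2 m) atTop (𝓝 0)) :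
    Tendsto (fun k => (hu k).toLp (u k)) atTop (𝓝 (h0.toLp u₀)) :=
  (Lp.tendsto_Lp_iff_tendsto_eLpNorm'' u hu u₀ h0).2 h

lemma weakTo_of_tendsto {u : ℕ → α → F} {u₀ : α → F} (hu : ∀ k, MemLp (u k) 2 m)
    (h0 : MemLp u₀ 2 m) (h : Tendsto (fun k => eLpNorm (u k - u₀) 2 m) atTop (𝓝 0)) :
    WeakTo m u u₀ := fun Ψ hΨ => by
  simp_rw [integral_inner_toLp h0 hΨ, fun k => integral_inner_toLp (hu k) hΨ]
  exact (tendsto_toLp hu h0 h).inner tendsto_const_nhds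

lemma tendsto_eLpNorm_of_tendsto {F : Type*} [NormedAddCommGroup F] {u : ℕ → α → F} {u₀ : α → F}
    (hu : ∀ k, MemLp (u k) 2 m)
    (h0 : MemLp u₀ 2 m) (h : Tendsto (fun k => eLpNorm (u k - u₀) 2 m) atTop (𝓝 0)) :
    Tendsto (fun k => eLpNorm (u k) 2 m) atTop (𝓝 (eLpNorm u₀ 2 m)) := by
  have h1 := (tendsto_toLp hu h0 h).norm
  simp only [Lp.norm_toLp] at h1
  exact (ENNReal.tendsto_toReal_iff (fun k => (hu k).2.ne) h0.2.ne).1 h1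

end WeakConv

/-! ### Stability of the weak identities under weak limits. -/

section Pairings

variable {v : Amb n → ℝ} {h φ : Amb n → ℝ} {G : Amb n → Amb n} {U : Set (Amb n)}
  {vk hk : ℕ → Amb n → ℝ} {Gk : ℕ → Amb n → Amb n}

lemma memLp_rpow_neg_mul {E : Type*} [NormedAddCommGroup E] [NormedSpace ℝ E] (hb' : b < 1)
    {Ψ : Amb n → E} (hΨ : Continuous Ψ) (hc : HasCompactSupport Ψ) :
    MemLp (fun X => ycoord X ^ (-b) • Ψ X) 2 (wMeas n b) :=
  (hΨ.memLp_top_of_hasCompactSupport hc _).smul (memLp_rpow_neg hb')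

lemma integral_wMeas_rpow_neg {E : Type*} [NormedAddCommGroup E] [InnerProductSpace ℝ E]
    (u Ψ : Amb n → E) :
    ∫ X, inner ℝ (u X) (ycoord X ^ (-b) • Ψ X) ∂(wMeas n b) =
      ∫ X in halfBall n, inner ℝ (u X) (Ψ X) := by
  rw [integral_wMeas]
  refine setIntegral_congr_fun measurableSet_halfBall fun X hX => ?_
  simp only [smul_eq_mul, inner_smul_right]
  rw [← mul_assoc, ← Real.rpow_add hX.2]
  simp

/-- The unweighted integral against `Ψ` is the weighted one against `y^(-b) Ψ`, which is in
`L²(y^b)` because `b < 1`. -/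
lemma WeakTo.setIntegral {E : Type*} [NormedAddCommGroup E] [InnerProductSpace ℝ E] (hb' : b < 1)
    {uk : ℕ → Amb n → E} {u Ψ : Amb n → E} (hw : WeakTo (wMeas n b) uk u) (hΨ : Continuous Ψ)
    (hc : HasCompactSupport Ψ) :
    Tendsto (fun k => ∫ X in halfBall n, inner ℝ (uk k X) (Ψ X)) atTop
      (𝓝 (∫ X in halfBall n, inner ℝ (u X) (Ψ X))) := by
  have h1 := hw _ (memLp_rpow_neg_mul hb' hΨ hc)
  simpa only [integral_wMeas_rpow_neg] using h1

/-- The pairing is vector-valued; its component along `c` is a sum of two integrals to which weak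
convergence applies. -/
lemma inner_setIntegral_pairing (hb' : b < 1) (hv : MemLp v 2 (wMeas n b))
    (hG : MemLp G 2 (wMeas n b)) (hφ : IsTest U φ) (c : Amb n) :
    inner ℝ c (∫ X in halfBall n, (v X • ∇ φ X + φ X • G X)) =
      (∫ X in halfBall n, inner ℝ (v X) (inner ℝ c (∇ φ X)))
        + ∫ X in halfBall n, inner ℝ (G X) (φ X • c) := by
  rw [← integral_inner (integrableOn_pairing hb' hv hG hφ), ← integral_add]
  · congr 1; ext1 X
    simp [inner_add_right, inner_smul_right, real_inner_comm c (G X), mul_comm]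
  · have := (IntegrableOn.smul_test_gradient (MemLp.integrableOn_halfBall hb' hv) hφ).const_inner
      (𝕜 := ℝ) c
    refine this.congr (ae_of_all _ fun X => ?_)
    simp [inner_smul_right, mul_comm]
  · have := (IntegrableOn.test_smul (MemLp.integrableOn_halfBall hb' hG) hφ).const_inner
      (𝕜 := ℝ) c
    refine this.congr (ae_of_all _ fun X => ?_)
    simp [inner_smul_right, real_inner_comm c (G X)]

lemma tendsto_pairing (hb' : b < 1) (hvk : ∀ k, MemLp (vk k) 2 (wMeas n b))
    (hGk : ∀ k, MemLp (Gk k) 2 (wMeas n b)) (hv : MemLp v 2 (wMeas n b))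
    (hG : MemLp G 2 (wMeas n b)) (hw : WeakTo (wMeas n b) vk v) (hw' : WeakTo (wMeas n b) Gk G)
    (hφ : IsTest U φ) (c : Amb n) :
    Tendsto (fun k => inner ℝ c (∫ X in halfBall n, (vk k X • ∇ φ X + φ X • Gk k X))) atTop
      (𝓝 (inner ℝ c (∫ X in halfBall n, (v X • ∇ φ X + φ X • G X)))) := by
  simp_rw [inner_setIntegral_pairing hb' hv hG hφ,
    fun k => inner_setIntegral_pairing hb' (hvk k) (hGk k) hφ]
  refine (hw.setIntegral hb' ?_ ?_).add (hw'.setIntegral hb' ?_ ?_)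
  · exact continuous_const.inner hφ.continuous_gradient
  · exact hφ.hasCompactSupport_gradient.comp_left (g := fun x => inner ℝ c x) (by simp)
  · exact hφ.continuous.smul continuous_const
  · exact hφ.compact.smul_right

lemma tendsto_wpairing (hb : -1 < b) (hGk : ∀ k, MemLp (Gk k) 2 (wMeas n b))
    (hhk : ∀ k, MemLp (hk k) 2 (wMeas n b)) (hG : MemLp G 2 (wMeas n b))
    (hh : MemLp h 2 (wMeas n b)) (hw : WeakTo (wMeas n b) Gk G) (hw' : WeakTo (wMeas n b) hk h)
    (hφ : IsTest U φ) :
    Tendsto (fun k => ∫ X, (inner ℝ (Gk k X) (∇ φ X) + hk k X * φ X) ∂(wMeas n b)) atTop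
      (𝓝 (∫ X, (inner ℝ (G X) (∇ φ X) + h X * φ X) ∂(wMeas n b))) := by
  have := isFiniteMeasure_wMeas (n := n) hb
  simp_rw [integral_pairing_eq hb hG hh hφ, fun k => integral_pairing_eq hb (hGk k) (hhk k) hφ]
  refine (hw _ hφ.memLp_gradient).add ?_
  have := hw' _ hφ.memLp
  simpa [mul_comm] using this

/-- Stated for a single test function and an arbitrary `U`, so that it serves both the definition of
the weak gradient and the lateral Dirichlet condition. -/
lemma latZ_of_weakTo (hb' : b < 1) (hvk : ∀ k, MemLp (vk k) 2 (wMeas n b))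
    (hGk : ∀ k, MemLp (Gk k) 2 (wMeas n b)) (hv : MemLp v 2 (wMeas n b))
    (hG : MemLp G 2 (wMeas n b)) (hw : WeakTo (wMeas n b) vk v) (hw' : WeakTo (wMeas n b) Gk G)
    (hφ : IsTest U φ)
    (l : ∀ k, ∫ X in halfBall n, (vk k X • ∇ φ X + φ X • Gk k X) = 0) :
    ∫ X in halfBall n, (v X • ∇ φ X + φ X • G X) = 0 := by
  refine ext_inner_left ℝ fun c => ?_
  have h1 := tendsto_pairing hb' hvk hGk hv hG hw hw' hφ c
  simp only [l] at h1
  exact tendsto_nhds_unique h1 tendsto_const_nhds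

lemma normZ_of_weakTo (hb : -1 < b) (hGk : ∀ k, MemLp (Gk k) 2 (wMeas n b))
    (hhk : ∀ k, MemLp (hk k) 2 (wMeas n b)) (hG : MemLp G 2 (wMeas n b))
    (hh : MemLp h 2 (wMeas n b)) (hw : WeakTo (wMeas n b) Gk G) (hw' : WeakTo (wMeas n b) hk h)
    (l : ∀ k, NormZ b U (Gk k) (hk k)) : NormZ b U G h := fun φ hφ => by
  have h1 := tendsto_wpairing hb hGk hhk hG hh hw hw' hφ
  simp only [l _ φ hφ] at h1
  exact tendsto_nhds_unique h1 tendsto_const_nhds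

lemma Triple.of_weakTo (hb : -1 < b) (hb' : b < 1) (t : ∀ k, Triple b (vk k) (Gk k) (hk k))
    (hv : MemLp v 2 (wMeas n b)) (hG : MemLp G 2 (wMeas n b)) (hh : MemLp h 2 (wMeas n b))
    (hwv : WeakTo (wMeas n b) vk v) (hwG : WeakTo (wMeas n b) Gk G)
    (hwh : WeakTo (wMeas n b) hk h) : Triple b v G h where
  memLp := hv
  memLp_grad := hG
  memLp_lap := hh
  parts_grad φ hφ := latZ_of_weakTo hb' (fun k => (t k).memLp) (fun k => (t k).memLp_grad) hv hG
    hwv hwG hφ fun k => (t k).parts_grad φ hφ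
  parts_lap := normZ_of_weakTo hb (fun k => (t k).memLp_grad) (fun k => (t k).memLp_lap) hG hh
    hwG hwh fun k => (t k).parts_lap

end Pairings

/-! ### Poincaré inequality and coercivity -/

lemma eLpNorm_le_of_lintegral_sq_le {α E F : Type*} [MeasurableSpace α] [NormedAddCommGroup E]
    [NormedAddCommGroup F] {β : Type*} [MeasurableSpace β] {m : Measure α} {m' : Measure β}
    {u : α → E} {w : β → F} {C : ℝ≥0∞}
    (h : ∫⁻ a, ‖u a‖ₑ ^ 2 ∂m ≤ C * ∫⁻ a, ‖w a‖ₑ ^ 2 ∂m') :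
    eLpNorm u 2 m ≤ C ^ (1 / 2 : ℝ) * eLpNorm w 2 m' := by
  rw [eLpNorm_two_eq, eLpNorm_two_eq, ← ENNReal.mul_rpow_of_nonneg _ _ (by norm_num)]
  exact ENNReal.rpow_le_rpow h (by norm_num)

/-- The constant in the Poincaré inequality. -/
def poincareConst (b : ℝ) : ℝ≥0∞ := ENNReal.ofReal (1 / (1 + b) * (1 / (1 - b))) ^ (1 / 2 : ℝ)

lemma poincareConst_ne_top : poincareConst b ≠ ⊤ :=
  ENNReal.rpow_ne_top_of_nonneg (by norm_num) ENNReal.ofReal_ne_top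

/-- The Poincaré inequality for test functions passes to the limit along `exists_test_approx`. -/
lemma eLpNorm_le_grad (hb : -1 < b) (hb' : b < 1) {v : Amb n → ℝ} {G : Amb n → Amb n}
    (hv : MemLp v 2 (wMeas n b)) (hG : MemLp G 2 (wMeas n b)) (l : LatZ v G) :
    eLpNorm v 2 (wMeas n b) ≤ poincareConst b * eLpNorm G 2 (wMeas n b) := by
  have := isFiniteMeasure_wMeas (n := n) hb
  obtain ⟨φ, hφ, h1, h2⟩ := exists_test_approx hb hb' hv hG l
  have h3 := tendsto_eLpNorm_of_tendsto (fun k => (hφ k).memLp) hv h1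
  have h4 := tendsto_eLpNorm_of_tendsto (fun k => (hφ k).memLp_gradient) hG h2
  exact le_of_tendsto_of_tendsto' h3
    (ENNReal.Tendsto.const_mul h4 (Or.inr poincareConst_ne_top))
    fun k => eLpNorm_le_of_lintegral_sq_le ((hφ k).lintegral_poincare hb hb')

/-- Green's formula for functions with homogeneous boundary conditions. -/
lemma green (hb : -1 < b) (hb' : b < 1) {v h : Amb n → ℝ} {G : Amb n → Amb n}
    (t : Triple b v G h) (l : LatZ v G) (N : NormZ b (Metric.ball 0 1) G h) :
    ∫ X, ‖G X‖ ^ 2 ∂(wMeas n b) = - ∫ X, inner ℝ (h X) (v X) ∂(wMeas n b) := by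
  have := isFiniteMeasure_wMeas (n := n) hb
  obtain ⟨φ, hφ, h1, h2⟩ := exists_test_approx hb hb' t.memLp t.memLp_grad l
  have h3 := weakTo_of_tendsto (fun k => (hφ k).memLp) t.memLp h1 h t.memLp_lap
  have h4 := weakTo_of_tendsto (fun k => (hφ k).memLp_gradient) t.memLp_grad h2 G t.memLp_grad
  have h5 := h4.add h3
  -- The approximations `φ k` of `v` may reach the flat boundary but stay off the sphere, so they
  -- are admissible in the conormal condition; `v` itself is tested in the limit.
  have e : ∀ k, ∫ X, inner ℝ (∇ (φ k) X) (G X) ∂(wMeas n b)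
      + ∫ X, inner ℝ (φ k X) (h X) ∂(wMeas n b) = 0 := fun k => by
    have := N _ (hφ k)
    rw [integral_pairing_eq hb t.memLp_grad t.memLp_lap (hφ k)] at this
    rw [← this]
    congr 1
    · congr 1; ext1 X; rw [real_inner_comm]
  simp only [e] at h5
  have h6 := tendsto_nhds_unique h5 tendsto_const_nhds
  simp only [real_inner_self_eq_norm_sq] at h6
  simp only [real_inner_comm (v _) (h _)]
  linarith

/-- Green, Cauchy-Schwarz and Poincaré give `‖G‖² ≤ ‖h‖ ‖v‖ ≤ C ‖h‖ ‖G‖`, and one factor cancels.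
Only the lateral Dirichlet and flat conormal conditions enter. This is the coercivity behind the
direct method. -/
lemma norm_grad_le (hb : -1 < b) (hb' : b < 1) {v h : Amb n → ℝ} {G : Amb n → Amb n}
    (t : Triple b v G h) (l : LatZ v G) (N : NormZ b (Metric.ball 0 1) G h) :
    eLpNorm G 2 (wMeas n b) ≤ poincareConst b * eLpNorm h 2 (wMeas n b) := by
  have h1 := green hb hb' t l N
  rw [integral_norm_sq_eq t.memLp_grad] at h1
  have h2 := abs_integral_inner_le t.memLp_lap t.memLp
  have h3 : (eLpNorm v 2 (wMeas n b)).toReal ≤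
      (poincareConst b).toReal * (eLpNorm G 2 (wMeas n b)).toReal := by
    rw [← ENNReal.toReal_mul]
    exact ENNReal.toReal_mono (ENNReal.mul_ne_top poincareConst_ne_top t.memLp_grad.2.ne)
      (eLpNorm_le_grad hb hb' t.memLp t.memLp_grad l)
  have h4 : (eLpNorm G 2 (wMeas n b)).toReal ≤
      (poincareConst b).toReal * (eLpNorm h 2 (wMeas n b)).toReal := by
    rcases eq_or_lt_of_le (ENNReal.toReal_nonneg (a := eLpNorm G 2 (wMeas n b))) with h5 | h5
    · rw [← h5]; positivity
    · have h6 : (eLpNorm G 2 (wMeas n b)).toReal ^ 2 ≤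
          (eLpNorm h 2 (wMeas n b)).toReal * ((poincareConst b).toReal *
            (eLpNorm G 2 (wMeas n b)).toReal) := by
        rw [h1]
        refine (neg_le_abs _).trans (h2.trans ?_)
        gcongr
      nlinarith
  rw [← ENNReal.toReal_mul] at h4
  exact (ENNReal.toReal_le_toReal t.memLp_grad.2.ne
    (ENNReal.mul_ne_top poincareConst_ne_top t.memLp_lap.2.ne)).1 h4

/-! ### Flat traces -/

lemma inner_pt_zero_one (X : Amb n) : inner ℝ (pt 0 1) X = ycoord X := by
  simp only [ycoord, pt, PiLp.inner_apply, Fin.sum_univ_castSucc]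
  simp

lemma integral_flat_pairing (hb' : b < 1) {v ψ : Amb n → ℝ} {G : Amb n → Amb n}
    {U : Set (Amb n)} (hv : MemLp v 2 (wMeas n b)) (hG : MemLp G 2 (wMeas n b))
    (hψ : IsTest U ψ) :
    ∫ X in halfBall n, (v X * ycoord (∇ ψ X) + ψ X * ycoord (G X)) =
      inner ℝ (pt 0 1) (∫ X in halfBall n, (v X • ∇ ψ X + ψ X • G X)) := by
  rw [← integral_inner (integrableOn_pairing hb' hv hG hψ)]
  congr 1; ext1 X
  rw [inner_pt_zero_one, ycoord_add, ycoord_smul, ycoord_smul]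

instance : IsFiniteMeasure (volume.restrict (flatBall n)) :=
  ⟨by rw [Measure.restrict_apply_univ]; exact measure_ball_lt_top⟩

/-- The projection `(x, y) ↦ x`. -/
def xproj (n : ℕ) : Amb n →L[ℝ] Thin n :=
  LinearMap.toContinuousLinearMap
    { toFun := fun X => WithLp.toLp 2 fun i => X i.castSucc
      map_add' := fun _ _ => rfl
      map_smul' := fun _ _ => rfl }

@[simp] lemma xproj_pt (x : Thin n) (y : ℝ) : xproj n (pt x y) = x := by
  ext i
  change (pt x y) i.castSucc = x i
  simp [pt]

/-- Every test function `ψ` on the flat ball extends to the admissible `ψ(x) η(X)`, with a cutoff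
`η` equal to `1` on the support of `ψ` in the hyperplane. The fundamental lemma then applies on the
flat ball. -/
lemma IsFlatTrace.ae_eq {w : Amb n → ℝ} {T T' : Thin n → ℝ} (h : IsFlatTrace w T)
    (h' : IsFlatTrace w T') : T =ᵐ[volume.restrict (flatBall n)] T' := by
  have hmf : MeasurableSet (flatBall n) := Metric.isOpen_ball.measurableSet
  have key := (Metric.isOpen_ball (x := (0 : Thin n)) (ε := 1)).ae_eq_zero_of_integral_contDiff_smul_eq_zero
    (μ := volume) (h.locInt.sub h'.locInt) fun ψ hψ hc hs => by
    have hi := integrable_smul_of_tsupport_subset hmf h.locInt hψ.continuous hc hs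
    have hi' := integrable_smul_of_tsupport_subset hmf h'.locInt hψ.continuous hc hs
    have hK : IsCompact ((fun x : Thin n => pt x 0) '' tsupport ψ) :=
      hc.image (continuous_pt_left 0)
    have hK1 : (fun x : Thin n => pt x 0) '' tsupport ψ ⊆ Metric.ball 0 1 := by
      rintro _ ⟨x, hx, rfl⟩
      have h1 := hs hx
      rw [mem_ball_zero_iff] at h1 ⊢
      have h2 := norm_pt_sq x 0
      simp only
      nlinarith [norm_nonneg x, norm_nonneg (pt x 0)]
    obtain ⟨η, hη, hη1⟩ := exists_cutoff hK hK1
    have ht : IsTest (Metric.ball 0 1) (fun X => ψ (xproj n X) * η X) :=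
      hη.mul_left (hψ.comp (xproj n).contDiff)
    have e : ∀ x : Thin n, ψ (xproj n (pt x 0)) * η (pt x 0) = ψ x := fun x => by
      rw [xproj_pt]
      by_cases hx : x ∈ tsupport ψ
      · rw [(hη1 _ (Set.mem_image_of_mem _ hx)).eq_of_nhds]; simp
      · rw [image_eq_zero_of_notMem_tsupport hx, zero_mul]
    have g := h.gaussGreen _ ht
    rw [h'.gaussGreen _ ht, neg_inj] at g
    simp only [e] at g
    rw [← setIntegral_eq_integral_of_forall_compl_eq_zero (s := flatBall n)]
    · simp only [Pi.sub_apply, smul_sub]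
      rw [integral_sub hi hi']
      simp only [smul_eq_mul, mul_comm (ψ _)]
      rw [g, sub_self]
    · intro x hx
      rw [image_eq_zero_of_notMem_tsupport fun h => hx (hs h), zero_smul]
  rw [EventuallyEq, ae_restrict_iff' hmf]
  filter_upwards [key] with x hx hxB
  exact sub_eq_zero.1 (hx hxB)

lemma isFlatTrace_flatTrace {w : Amb n → ℝ} (h : ∃ T, IsFlatTrace w T) :
    IsFlatTrace w (flatTrace w) := by
  rw [flatTrace, dif_pos h]
  exact h.choose_spec

lemma IsFlatTrace.flatTrace_ae_eq {w : Amb n → ℝ} {T : Thin n → ℝ} (h : IsFlatTrace w T) :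
    flatTrace w =ᵐ[volume.restrict (flatBall n)] T :=
  (isFlatTrace_flatTrace ⟨T, h⟩).ae_eq h

/-- The Gauss-Green integral is the vertical component of the vector pairing and does not see the
representative of the gradient. In this form, linearity and weak limits of the pairing are
available. -/
lemma isFlatTrace_iff (hb : -1 < b) (hb' : b < 1) {v h : Amb n → ℝ} {G : Amb n → Amb n}
    (t : Triple b v G h) {T : Thin n → ℝ} :
    IsFlatTrace v T ↔ LocallyIntegrableOn T (flatBall n) ∧
      ∀ φ : Amb n → ℝ, IsTest (Metric.ball 0 1) φ →
        inner ℝ (pt 0 1) (∫ X in halfBall n, (v X • ∇ φ X + φ X • G X))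
          = - ∫ x in flatBall n, T x * φ (pt x 0) := by
  have e : ∀ φ : Amb n → ℝ, IsTest (Metric.ball 0 1) φ →
      ∫ X in halfBall n, (v X * ycoord (∇ φ X) + φ X * ycoord (weakGrad v X)) =
      inner ℝ (pt 0 1) (∫ X in halfBall n, (v X • ∇ φ X + φ X • G X)) := fun φ hφ => by
    rw [integral_flat_pairing hb' t.memLp (t.memH hb hb').memH1.grad_memLp hφ]
    congr 1
    refine integral_congr_ae ?_
    filter_upwards [ae_eq_wMeas_iff.1 (t.weakGrad_ae_eq hb')] with X hX
    rw [hX]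
  exact ⟨fun h => ⟨h.locInt, fun φ hφ => (e φ hφ).symm.trans (h.gaussGreen φ hφ)⟩,
    fun h => ⟨h.1, fun φ hφ => (e φ hφ).trans (h.2 φ hφ)⟩⟩

lemma IsFlatTrace.add_smul (hb : -1 < b) (hb' : b < 1) {w w' : Amb n → ℝ} {T T' : Thin n → ℝ}
    (hw : MemH b w) (hw' : MemH b w') (h : IsFlatTrace w T) (h' : IsFlatTrace w' T') (c : ℝ) :
    IsFlatTrace (w + c • w') (T + c • T') := by
  have hmf : MeasurableSet (flatBall n) := Metric.isOpen_ball.measurableSet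
  have t := hw.triple hb hb'
  have t' := hw'.triple hb hb'
  rw [isFlatTrace_iff hb hb' t] at h
  rw [isFlatTrace_iff hb hb' t'] at h'
  rw [isFlatTrace_iff hb hb' (t.add_smul hb hb' t' c)]
  refine ⟨h.1.add (h'.1.smul c), fun φ hφ => ?_⟩
  rw [integral_pairing_add hb' t.memLp t.memLp_grad t'.memLp t'.memLp_grad hφ, inner_add_right,
    inner_smul_right, h.2 φ hφ, h'.2 φ hφ]
  have hcs : HasCompactSupport fun x : Thin n => φ (pt x 0) := by
    refine HasCompactSupport.of_support_subset_isCompact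
      (hφ.compact.image (xproj n).continuous) fun x hx => ⟨pt x 0, subset_tsupport _ hx, by simp⟩
  have hts : tsupport (fun x : Thin n => φ (pt x 0)) ⊆ flatBall n := by
    have : tsupport (fun x : Thin n => φ (pt x 0)) ⊆ (fun x : Thin n => pt x 0) ⁻¹' tsupport φ :=
      closure_minimal (fun x hx => subset_tsupport _ hx)
        ((isClosed_tsupport φ).preimage (continuous_pt_left 0))
    refine this.trans fun x hx => ?_
    have h1 := hφ.supp hx
    rw [mem_ball_zero_iff] at h1
    simp only [flatBall, mem_ball_zero_iff]
    have := norm_pt_sq x 0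
    nlinarith [norm_nonneg x, norm_nonneg (pt x 0)]
  have hcont : Continuous fun x : Thin n => φ (pt x 0) :=
    hφ.continuous.comp (continuous_pt_left 0)
  have i1 := integrable_smul_of_tsupport_subset hmf h.1 hcont hcs hts
  have i2 : IntegrableOn (fun x => c * (φ (pt x 0) * T' x)) (flatBall n) :=
    (integrable_smul_of_tsupport_subset hmf h'.1 hcont hcs hts).const_mul c
  have e : ∀ x, (T + c • T') x * φ (pt x 0) = φ (pt x 0) • T x + c * (φ (pt x 0) * T' x) :=
    fun x => by simp only [Pi.add_apply, Pi.smul_apply, smul_eq_mul]; ring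
  simp only [e]
  rw [integral_add i1 i2, integral_const_mul]
  simp only [smul_eq_mul, mul_comm (φ _)]
  ring

/-! ### Existence of traces -/

/-- The constant in the comparison between traces and averages. -/
def traceConst (b ε : ℝ) : ℝ≥0∞ := ENNReal.ofReal (27 * (ε ^ (1 - b) / (1 - b))) ^ (1 / 2 : ℝ)

lemma tendsto_traceConst (hb' : b < 1) : Tendsto (traceConst b) (𝓝[>] 0) (𝓝 0) := by
  have h0 : (0 : ℝ≥0∞) = ENNReal.ofReal (27 * (0 / (1 - b))) ^ (1 / 2 : ℝ) := by simp
  rw [h0]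
  refine ((ENNReal.continuous_rpow_const).tendsto _).comp (ENNReal.tendsto_ofReal ?_)
  refine Tendsto.const_mul _ (Tendsto.div_const ?_ _)
  have h1 : Tendsto (fun ε : ℝ => ε ^ (1 - b)) (𝓝 0) (𝓝 ((0 : ℝ) ^ (1 - b))) :=
    (Real.continuousAt_rpow_const _ _ (Or.inr (by linarith))).tendsto
  rw [Real.zero_rpow (by linarith)] at h1
  exact h1.mono_left nhdsWithin_le_nhds

/-- `τ` is an `L^2` trace of `v`, quantitatively close to the averages of `v`. -/
structure TraceData (b : ℝ) (v : Amb n → ℝ) (G : Amb n → Amb n) (τ : Thin n → ℝ) : Prop where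
  memLp : MemLp τ 2 (volume.restrict (flatBall n))
  gaussGreen : ∀ φ : Amb n → ℝ, IsTest (Metric.ball 0 1) φ →
    inner ℝ (pt 0 1) (∫ X in halfBall n, (v X • ∇ φ X + φ X • G X))
      = - ∫ x in flatBall n, τ x * φ (pt x 0)
  avg_le : ∀ ε : ℝ, 0 < ε →
    eLpNorm (fun x => τ x - avg 1 ε v (pt x 0)) 2 (volume.restrict (flatBall n)) ≤
      traceConst b ε * eLpNorm G 2 (wMeas n b)

lemma TraceData.isFlatTrace (hb : -1 < b) (hb' : b < 1) {v h : Amb n → ℝ} {G : Amb n → Amb n}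
    {τ : Thin n → ℝ} (d : TraceData b v G τ) (t : Triple b v G h) : IsFlatTrace v τ :=
  (isFlatTrace_iff hb hb' t).2
    ⟨(show IntegrableOn τ (flatBall n) from memLp_one_iff_integrable.1
      (d.memLp.mono_exponent (by norm_num : (1 : ℝ≥0∞) ≤ 2))).locallyIntegrableOn,
      d.gaussGreen⟩

/-- The kernel at fixed scale is bounded and `y^(-b) ∈ L²(y^b)`, so Cauchy-Schwarz bounds the
averages uniformly in `X`. This supplies the dominating constant in `tendsto_eLpNorm_avg`. -/
lemma exists_avg_bound (n : ℕ) (hb' : b < 1) {ε : ℝ} (hε : 0 < ε) : ∃ K : ℝ, 0 ≤ K ∧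
    ∀ u : Amb n → ℝ, MemLp u 2 (wMeas n b) → ∀ X, |avg 1 ε u X| ≤
      K * (eLpNorm u 2 (wMeas n b)).toReal := by
  obtain ⟨B, hB⟩ := (contDiff_kap (n := n) ε).continuous.bounded_above_of_compact_support
    (hasCompactSupport_kap hε)
  have hy := memLp_rpow_neg (n := n) hb'
  refine ⟨(ENNReal.ofReal B * eLpNorm (fun X : Amb n => ycoord X ^ (-b)) 2 (wMeas n b)).toReal,
    ENNReal.toReal_nonneg, fun u hu X => ?_⟩
  have hc : Continuous fun Y => kap n ε ((1 : ℝ) • X - Y) :=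
    (contDiff_kap ε).continuous.comp (by fun_prop)
  have hcs : HasCompactSupport fun Y => kap n ε ((1 : ℝ) • X - Y) :=
    (hasCompactSupport_kap hε).comp_homeomorph (Homeomorph.subLeft ((1 : ℝ) • X))
  have hΨ := memLp_rpow_neg_mul (b := b) hb' hc hcs
  have e : avg 1 ε u X = ∫ Y, inner ℝ (u Y) (ycoord Y ^ (-b) • kap n ε ((1 : ℝ) • X - Y))
      ∂(wMeas n b) := by
    rw [integral_wMeas_rpow_neg, avg_eq_setIntegral_kap hε]
    rfl
  rw [e, mul_comm]
  refine (abs_integral_inner_le hu hΨ).trans ?_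
  gcongr
  · exact ENNReal.mul_ne_top ENNReal.ofReal_ne_top hy.2.ne
  · have : eLpNorm (fun X : Amb n => B • ycoord X ^ (-b)) 2 (wMeas n b) ≤
        ENNReal.ofReal B * eLpNorm (fun X : Amb n => ycoord X ^ (-b)) 2 (wMeas n b) := by
      refine (eLpNorm_const_smul_le (c := B)).trans (le_of_eq ?_)
      rw [Real.enorm_of_nonneg ((norm_nonneg _).trans (hB 0))]
    refine (eLpNorm_mono fun Y => ?_).trans this
    rw [norm_smul, norm_smul, mul_comm, Real.norm_of_nonneg ((norm_nonneg _).trans (hB 0))]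
    gcongr
    exact hB _

lemma WeakTo.avg (hb' : b < 1) {vk : ℕ → Amb n → ℝ} {v : Amb n → ℝ}
    (hw : WeakTo (wMeas n b) vk v) {ε : ℝ} (hε : 0 < ε) (X : Amb n) :
    Tendsto (fun k => avg 1 ε (vk k) X) atTop (𝓝 (avg 1 ε v X)) := by
  have hc : Continuous fun Y => kap n ε ((1 : ℝ) • X - Y) :=
    (contDiff_kap ε).continuous.comp (by fun_prop)
  have hcs : HasCompactSupport fun Y => kap n ε ((1 : ℝ) • X - Y) :=
    (hasCompactSupport_kap hε).comp_homeomorph (Homeomorph.subLeft ((1 : ℝ) • X))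
  have := hw.setIntegral hb' hc hcs
  simp only [avg_eq_setIntegral_kap hε]
  exact this

lemma continuous_avg (hb' : b < 1) {v : Amb n → ℝ} (hv : MemLp v 2 (wMeas n b)) {ε : ℝ}
    (hε : 0 < ε) : Continuous fun x : Thin n => avg 1 ε v (pt x 0) :=
  (contDiff_avg (MemLp.integrableOn_halfBall hb' hv) hε 1).continuous.comp (continuous_pt_left 0)

/-- The averages of a weakly convergent sequence converge strongly. -/
lemma tendsto_eLpNorm_avg (hb' : b < 1) {vk : ℕ → Amb n → ℝ} {v : Amb n → ℝ}
    (hvk : ∀ k, MemLp (vk k) 2 (wMeas n b)) (hv : MemLp v 2 (wMeas n b))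
    (hw : WeakTo (wMeas n b) vk v) {M : ℝ≥0∞} (hM : M ≠ ⊤)
    (hbd : ∀ k, eLpNorm (vk k) 2 (wMeas n b) ≤ M) {ε : ℝ} (hε : 0 < ε) :
    Tendsto (fun k => eLpNorm (fun x => avg 1 ε (vk k) (pt x 0) - avg 1 ε v (pt x 0)) 2
      (volume.restrict (flatBall n))) atTop (𝓝 0) := by
  obtain ⟨K, hK0, hK⟩ := exists_avg_bound (b := b) n hb' hε
  simp_rw [eLpNorm_two_eq]
  have h0 : (0 : ℝ≥0∞) = 0 ^ (1 / 2 : ℝ) := by simp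
  rw [h0]
  refine ((ENNReal.continuous_rpow_const).tendsto _).comp ?_
  have h1 : (0 : ℝ≥0∞) = ∫⁻ x : Thin n, 0 ∂(volume.restrict (flatBall n)) := by simp
  rw [h1]
  -- At each point the average is a fixed linear functional of `vk k`, so it converges;
  -- `exists_avg_bound` provides a constant majorant on the bounded flat ball.
  refine tendsto_lintegral_of_dominated_convergence
    (fun _ => ENNReal.ofReal (K * M.toReal + K * (eLpNorm v 2 (wMeas n b)).toReal) ^ 2)
    (fun k => ?_) (fun k => ae_of_all _ fun x => ?_) ?_ (ae_of_all _ fun x => ?_)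
  · exact ((continuous_avg hb' (hvk k) hε).sub (continuous_avg hb' hv hε)).measurable.enorm.pow_const 2
  · simp only
    gcongr
    rw [← ofReal_norm]
    refine ENNReal.ofReal_le_ofReal ((norm_sub_le _ _).trans (add_le_add ?_ (hK v hv _)))
    refine (hK _ (hvk k) _).trans ?_
    gcongr
    exact hbd k
  · rw [lintegral_const]
    exact ENNReal.mul_ne_top (by finiteness) (measure_ne_top _ _)
  · have h2 := (hw.avg hb' hε (pt x 0)).sub_const (avg 1 ε v (pt x 0))
    rw [sub_self] at h2
    have h3 := ((ENNReal.continuous_pow 2).tendsto _).comp h2.enorm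
    simpa [Function.comp_def] using h3

/-- Approximate by test functions. Their restrictions to height `0` form a Cauchy sequence in `L²`
by the slice bound, and the limit inherits the Gauss-Green formula and the comparison with averages.
-/
lemma exists_traceData (hb : -1 < b) (hb' : b < 1) {v : Amb n → ℝ} {G : Amb n → Amb n}
    (hv : MemLp v 2 (wMeas n b)) (hG : MemLp G 2 (wMeas n b)) (l : LatZ v G) :
    ∃ τ : Thin n → ℝ, TraceData b v G τ := by
  have := isFiniteMeasure_wMeas (n := n) hb
  obtain ⟨φ, hφ, h1, h2⟩ := exists_test_approx hb hb' hv hG l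
  set m := volume.restrict (flatBall n) with hm
  have hT : ∀ k, MemLp (fun x : Thin n => φ k (pt x 0)) 2 m := fun k => by
    have hc : Continuous fun x : Thin n => φ k (pt x 0) :=
      (hφ k).continuous.comp (continuous_pt_left 0)
    obtain ⟨B, hB⟩ := (hφ k).continuous.bounded_above_of_compact_support (hφ k).compact
    exact MemLp.of_bound hc.aestronglyMeasurable B (ae_of_all _ fun x => hB _)
  set C : ℝ≥0∞ := ENNReal.ofReal (1 / (1 - b)) ^ (1 / 2 : ℝ) with hC
  have hCtop : C ≠ ⊤ := ENNReal.rpow_ne_top_of_nonneg (by norm_num) ENNReal.ofReal_ne_top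
  have hTle : ∀ j k, eLpNorm ((fun x : Thin n => φ j (pt x 0)) - fun x => φ k (pt x 0)) 2 m ≤
      C * eLpNorm (∇ (φ j) - ∇ (φ k)) 2 (wMeas n b) := fun j k => by
    have h3 := ((hφ j).sub (hφ k)).lintegral_slice_le hb' le_rfl
    rw [(hφ j).gradient_sub (hφ k)] at h3
    exact eLpNorm_le_of_lintegral_sq_le ((setLIntegral_le_lintegral _ _).trans h3)
  have hGc := (tendsto_toLp (fun k => (hφ k).memLp_gradient (μ := wMeas n b)) hG h2).cauchySeq
  have hcau : CauchySeq fun k => (hT k).toLp _ := by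
    rw [Metric.cauchySeq_iff] at hGc ⊢
    intro δ hδ
    obtain ⟨N, hN⟩ := hGc (δ / (C.toReal + 1)) (by positivity)
    refine ⟨N, fun j hj k hk => ?_⟩
    have h3 := hN j hj k hk
    rw [dist_eq_norm, ← MemLp.toLp_sub, Lp.norm_toLp] at h3 ⊢
    have h4 := ENNReal.toReal_mono (ENNReal.mul_ne_top hCtop
      ((hφ j).memLp_gradient.sub (hφ k).memLp_gradient).2.ne) (hTle j k)
    rw [ENNReal.toReal_mul] at h4
    refine h4.trans_lt ?_
    have h5 : (0 : ℝ) ≤ C.toReal := ENNReal.toReal_nonneg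
    rw [lt_div_iff₀ (by positivity)] at h3
    have h6 := ENNReal.toReal_nonneg (a := eLpNorm (∇ (φ j) - ∇ (φ k)) 2 (wMeas n b))
    rcases h5.eq_or_lt with h7 | h7
    · rw [← h7]; simpa using hδ
    · nlinarith
  obtain ⟨τL, hτL⟩ := cauchySeq_tendsto_of_complete hcau
  set τ : Thin n → ℝ := fun x => τL x with hτdef
  have hτ : MemLp τ 2 m := Lp.memLp τL
  have hconv : Tendsto (fun k => eLpNorm ((fun x : Thin n => φ k (pt x 0)) - τ) 2 m) atTop
      (𝓝 0) := by
    refine (Lp.tendsto_Lp_iff_tendsto_eLpNorm'' _ hT τ hτ).1 ?_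
    convert hτL
    exact Lp.toLp_coeFn τL hτ
  have hwv := weakTo_of_tendsto (fun k => (hφ k).memLp) hv h1
  have hwG := weakTo_of_tendsto (fun k => (hφ k).memLp_gradient) hG h2
  have hwτ := weakTo_of_tendsto hT hτ hconv
  refine ⟨τ, hτ, fun ψ hψ => ?_, fun ε hε => ?_⟩
  · have h3 := tendsto_pairing hb' (fun k => (hφ k).memLp) (fun k => (hφ k).memLp_gradient) hv hG
      hwv hwG hψ (pt 0 1)
    have e : ∀ k, inner ℝ (pt 0 1) (∫ X in halfBall n, (φ k X • ∇ ψ X + ψ X • ∇ (φ k) X)) =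
        - ∫ x, inner ℝ (φ k (pt x 0)) (ψ (pt x 0)) ∂m := fun k => by
      rw [← integral_flat_pairing hb' (hφ k).memLp (hφ k).memLp_gradient hψ,
        (hφ k).gauss_green hψ]
      simp [mul_comm, hm]
    simp only [e] at h3
    have hψm : MemLp (fun x : Thin n => ψ (pt x 0)) 2 m := by
      have hc : Continuous fun x : Thin n => ψ (pt x 0) :=
        hψ.continuous.comp (continuous_pt_left 0)
      obtain ⟨B, hB⟩ := hψ.continuous.bounded_above_of_compact_support hψ.compact
      exact MemLp.of_bound hc.aestronglyMeasurable B (ae_of_all _ fun x => hB _)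
    have h4 := (hwτ _ hψm).neg
    rw [tendsto_nhds_unique h3 h4]
    simp [mul_comm, hm]
  · have h3 : ∀ k, eLpNorm (fun x : Thin n => φ k (pt x 0) - avg 1 ε (φ k) (pt x 0)) 2 m ≤
        traceConst b ε * eLpNorm (∇ (φ k)) 2 (wMeas n b) := fun k =>
      eLpNorm_le_of_lintegral_sq_le ((setLIntegral_le_lintegral _ _).trans
        ((hφ k).lintegral_trace_sub_avg_le hb hb' hε))
    have h4 := tendsto_eLpNorm_of_tendsto (fun k => (hφ k).memLp_gradient) hG h2
    have htc : traceConst b ε ≠ ⊤ :=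
      ENNReal.rpow_ne_top_of_nonneg (by norm_num) ENNReal.ofReal_ne_top
    have h4' := ENNReal.Tendsto.const_mul (a := traceConst b ε) h4 (Or.inr htc)
    obtain ⟨M, hM, hbd⟩ : ∃ M : ℝ≥0∞, M ≠ ⊤ ∧ ∀ k, eLpNorm (φ k) 2 (wMeas n b) ≤ M := by
      have h5 := (tendsto_toLp (fun k => (hφ k).memLp (μ := wMeas n b)) hv h1).norm
      obtain ⟨B, hB⟩ := h5.bddAbove_range
      refine ⟨ENNReal.ofReal B, ENNReal.ofReal_ne_top, fun k => ?_⟩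
      have h6 := hB (Set.mem_range_self k)
      simp only [Lp.norm_toLp] at h6
      rwa [ENNReal.le_ofReal_iff_toReal_le (hφ k).memLp.2.ne
        (ENNReal.toReal_nonneg.trans h6)]
    have h5 := tendsto_eLpNorm_avg hb' (fun k => (hφ k).memLp) hv hwv hM hbd hε
    have h6 := (hconv.add h4').add h5
    simp only [zero_add, add_zero] at h6
    refine ge_of_tendsto' h6 fun k => ?_
    have e : (fun x : Thin n => τ x - avg 1 ε v (pt x 0)) =
        (τ - fun x : Thin n => φ k (pt x 0)) + (fun x => φ k (pt x 0) - avg 1 ε (φ k) (pt x 0)) +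
          fun x => avg 1 ε (φ k) (pt x 0) - avg 1 ε v (pt x 0) := by
      funext x; simp
    have c1 := (continuous_avg hb' (v := φ k) ((hφ k).memLp (μ := wMeas n b)) hε).aestronglyMeasurable
      (μ := m)
    have c2 := (continuous_avg hb' hv hε).aestronglyMeasurable (μ := m)
    rw [e]
    refine (eLpNorm_add_le ((hτ.1.sub (hT k).1).add ((hT k).1.sub c1)) (c1.sub c2)
      (by norm_num)).trans ?_
    refine add_le_add ?_ le_rfl
    refine (eLpNorm_add_le (hτ.1.sub (hT k).1) ((hT k).1.sub c1) (by norm_num)).trans ?_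
    gcongr
    · rw [eLpNorm_sub_comm]
    · exact h3 k

/-- **Compactness of the trace**: weak convergence in `H^1` implies strong convergence of traces. -/
theorem tendsto_trace (hb' : b < 1) {vk : ℕ → Amb n → ℝ} {v : Amb n → ℝ}
    {Gk : ℕ → Amb n → Amb n} {G : Amb n → Amb n} {τk : ℕ → Thin n → ℝ} {τ : Thin n → ℝ}
    (hvk : ∀ k, MemLp (vk k) 2 (wMeas n b)) (hv : MemLp v 2 (wMeas n b))
    (hw : WeakTo (wMeas n b) vk v) (dk : ∀ k, TraceData b (vk k) (Gk k) (τk k))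
    (d : TraceData b v G τ) {M : ℝ≥0∞} (hM : M ≠ ⊤)
    (hbd : ∀ k, eLpNorm (vk k) 2 (wMeas n b) ≤ M) (hbdk : ∀ k, eLpNorm (Gk k) 2 (wMeas n b) ≤ M)
    (hbdG : eLpNorm G 2 (wMeas n b) ≤ M) :
    Tendsto (fun k => eLpNorm (τk k - τ) 2 (volume.restrict (flatBall n))) atTop (𝓝 0) := by
  rw [ENNReal.tendsto_nhds_zero]
  intro δ hδ
  -- `ε` is fixed first, so that the two trace-to-average errors add up to at most `δ/2` uniformly
  -- in `k`; only then is `k` sent to infinity in the averages.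
  have h1 : Tendsto (fun ε => traceConst b ε * M + traceConst b ε * M) (𝓝[>] 0) (𝓝 0) := by
    have h2 := ENNReal.Tendsto.mul_const (b := M) (tendsto_traceConst hb') (Or.inr hM)
    rw [zero_mul] at h2
    simpa using h2.add h2
  have hδ2 : 0 < δ / 2 := ENNReal.div_pos hδ.ne' (by norm_num)
  obtain ⟨ε, h3, hε⟩ := ((ENNReal.tendsto_nhds_zero.1 h1 (δ / 2) hδ2).and
    self_mem_nhdsWithin).exists
  have hε0 : 0 < ε := hε
  filter_upwards [ENNReal.tendsto_nhds_zero.1 (tendsto_eLpNorm_avg hb' hvk hv hw hM hbd hε0)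
    (δ / 2) hδ2] with k hk
  set m := volume.restrict (flatBall n)
  have e : τk k - τ = (fun x => τk k x - avg 1 ε (vk k) (pt x 0)) +
      (-fun x => τ x - avg 1 ε v (pt x 0)) +
      fun x => avg 1 ε (vk k) (pt x 0) - avg 1 ε v (pt x 0) := by
    funext x
    simp only [Pi.sub_apply, Pi.add_apply, Pi.neg_apply]
    ring
  have c1 := (continuous_avg hb' (hvk k) hε0).aestronglyMeasurable (μ := m)
  have c2 := (continuous_avg hb' hv hε0).aestronglyMeasurable (μ := m)
  rw [e]
  calc _ ≤ (traceConst b ε * M + traceConst b ε * M) + δ / 2 := by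
        refine (eLpNorm_add_le (((dk k).memLp.1.sub c1).add (d.memLp.1.sub c2).neg) (c1.sub c2)
          (by norm_num)).trans ?_
        refine add_le_add ?_ hk
        refine (eLpNorm_add_le ((dk k).memLp.1.sub c1) (d.memLp.1.sub c2).neg
          (by norm_num)).trans ?_
        rw [eLpNorm_neg]
        gcongr
        · exact ((dk k).avg_le ε hε0).trans (by gcongr; exact hbdk k)
        · exact (d.avg_le ε hε0).trans (by gcongr)
    _ ≤ δ / 2 + δ / 2 := by gcongr
    _ = δ := ENNReal.add_halves δ

/-! ### Weak sequential compactness -/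

/-- Bounded sequences in a separable Hilbert space have weakly convergent subsequences. -/
lemma exists_weak_subseq {H : Type*} [NormedAddCommGroup H] [InnerProductSpace ℝ H]
    [CompleteSpace H] [TopologicalSpace.SeparableSpace H] {u : ℕ → H} {M : ℝ}
    (hu : ∀ k, ‖u k‖ ≤ M) : ∃ (u₀ : H) (s : ℕ → ℕ), StrictMono s ∧
      ∀ x : H, Tendsto (fun k => inner ℝ (u (s k)) x) atTop (𝓝 (inner ℝ u₀ x)) := by
  -- The vectors become functionals by Riesz; separability gives sequential weak-* compactness of
  -- the closed ball.
  let ℓ : ℕ → WeakDual ℝ H := fun k =>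
    StrongDual.toWeakDual (InnerProductSpace.toDual ℝ H (u k))
  obtain ⟨a, -, s, hs, ha⟩ := WeakDual.isSeqCompact_closedBall (𝕜 := ℝ) (E := H) 0 M
    (x := ℓ) (fun k => by
      simp only [Set.mem_preimage, mem_closedBall_zero_iff, ℓ]
      exact ((InnerProductSpace.toDual ℝ H).norm_map (u k)).le.trans (hu k))
  refine ⟨(InnerProductSpace.toDual ℝ H).symm (WeakDual.toStrongDual a), s, hs, fun x => ?_⟩
  have h1 := ((WeakDual.eval_continuous (𝕜 := ℝ) (E := H) x).tendsto a).comp ha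
  rw [InnerProductSpace.toDual_symm_apply]
  exact h1

section WeakCompact

variable {α F : Type*} [MeasurableSpace α] {m : Measure α} [NormedAddCommGroup F]
  [InnerProductSpace ℝ F]

lemma exists_weakTo_subseq [IsSeparable m] [CompleteSpace F] [TopologicalSpace.SeparableSpace F]
    {u : ℕ → α → F} (hu : ∀ k, MemLp (u k) 2 m) {M : ℝ≥0∞} (hM : M ≠ ⊤)
    (hbd : ∀ k, eLpNorm (u k) 2 m ≤ M) :
    ∃ (u₀ : α → F) (s : ℕ → ℕ), StrictMono s ∧ MemLp u₀ 2 m ∧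
      WeakTo m (fun k => u (s k)) u₀ := by
  have : Fact ((2 : ℝ≥0∞) ≠ ⊤) := ⟨by norm_num⟩
  obtain ⟨u₀, s, hs, h⟩ := exists_weak_subseq (u := fun k => (hu k).toLp (u k)) (M := M.toReal)
    fun k => by
      rw [Lp.norm_toLp]
      exact ENNReal.toReal_mono hM (hbd k)
  refine ⟨u₀, s, hs, Lp.memLp u₀, fun Ψ hΨ => ?_⟩
  simp_rw [integral_inner_toLp (Lp.memLp u₀) hΨ, fun k => integral_inner_toLp (hu (s k)) hΨ]
  rw [Lp.toLp_coeFn]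
  exact h _

lemma WeakTo.comp {u : ℕ → α → F} {u₀ : α → F} (h : WeakTo m u u₀) {s : ℕ → ℕ}
    (hs : StrictMono s) : WeakTo m (fun k => u (s k)) u₀ :=
  fun Ψ hΨ => (h Ψ hΨ).comp hs.tendsto_atTop

lemma lintegral_enorm_sq_eq {F : Type*} [NormedAddCommGroup F] {u : α → F} (hu : MemLp u 2 m) :
    ∫⁻ a, ‖u a‖ₑ ^ 2 ∂m = ENNReal.ofReal (∫ a, ‖u a‖ ^ 2 ∂m) := by
  rw [ofReal_integral_eq_lintegral_ofReal hu.norm.integrable_sq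
    (ae_of_all _ fun a => by positivity)]
  refine lintegral_congr fun a => ?_
  rw [ENNReal.ofReal_pow (norm_nonneg _), ofReal_norm]

/-- Weak lower semicontinuity of the norm. -/
lemma WeakTo.lintegral_le_liminf {u : ℕ → α → F} {u₀ : α → F} (hu : ∀ k, MemLp (u k) 2 m)
    (h0 : MemLp u₀ 2 m) (h : WeakTo m u u₀) :
    ∫⁻ a, ‖u₀ a‖ₑ ^ 2 ∂m ≤ liminf (fun k => ∫⁻ a, ‖u k a‖ₑ ^ 2 ∂m) atTop := by
  -- From `‖u k - u₀‖² ≥ 0`, the quantity `2⟨u k, u₀⟩ - ‖u₀‖²` is a lower bound for `‖u k‖²`, and it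
  -- converges to `‖u₀‖²`.
  have h1 : Tendsto (fun k => ENNReal.ofReal (2 * ∫ a, inner ℝ (u k a) (u₀ a) ∂m
      - ∫ a, ‖u₀ a‖ ^ 2 ∂m)) atTop (𝓝 (∫⁻ a, ‖u₀ a‖ₑ ^ 2 ∂m)) := by
    rw [lintegral_enorm_sq_eq h0]
    refine ENNReal.tendsto_ofReal ?_
    have h2 := ((h u₀ h0).const_mul 2).sub_const (∫ a, ‖u₀ a‖ ^ 2 ∂m)
    simp only [real_inner_self_eq_norm_sq] at h2
    convert h2 using 2
    ring
  rw [← h1.liminf_eq]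
  refine liminf_le_liminf (Eventually.of_forall fun k => ?_)
  rw [lintegral_enorm_sq_eq (hu k)]
  refine ENNReal.ofReal_le_ofReal ?_
  have h3 : (0 : ℝ) ≤ ‖(hu k).toLp (u k) - h0.toLp u₀‖ ^ 2 := by positivity
  rw [norm_sub_sq_real, ← integral_inner_toLp (hu k) h0, Lp.norm_toLp, Lp.norm_toLp,
    ← integral_norm_sq_eq (hu k), ← integral_norm_sq_eq h0] at h3
  linarith

end WeakCompact

/-- Weak compactness for functions with homogeneous boundary conditions and bounded weighted
Laplacian. -/
lemma exists_triple_subseq (hb : -1 < b) (hb' : b < 1) {v h : ℕ → Amb n → ℝ}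
    {G : ℕ → Amb n → Amb n} (t : ∀ k, Triple b (v k) (G k) (h k))
    (l : ∀ k, LatZ (v k) (G k)) (N : ∀ k, NormZ b (Metric.ball 0 1) (G k) (h k))
    (N' : ∀ k, NormZ b {X | 0 < ycoord X} (G k) (h k)) {M : ℝ≥0∞} (hM : M ≠ ⊤)
    (hbd : ∀ k, eLpNorm (h k) 2 (wMeas n b) ≤ M) :
    ∃ (v₀ h₀ : Amb n → ℝ) (G₀ : Amb n → Amb n) (s : ℕ → ℕ), StrictMono s ∧
      Triple b v₀ G₀ h₀ ∧ LatZ v₀ G₀ ∧ NormZ b (Metric.ball 0 1) G₀ h₀ ∧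
      NormZ b {X | 0 < ycoord X} G₀ h₀ ∧ WeakTo (wMeas n b) (fun k => h (s k)) h₀ ∧
      ∀ (τ : ℕ → Thin n → ℝ) (τ₀ : Thin n → ℝ), (∀ k, TraceData b (v k) (G k) (τ k)) →
        TraceData b v₀ G₀ τ₀ → Tendsto (fun k => eLpNorm (τ (s k) - τ₀) 2
          (volume.restrict (flatBall n))) atTop (𝓝 0) := by
  have := isFiniteMeasure_wMeas (n := n) hb
  have hG : ∀ k, eLpNorm (G k) 2 (wMeas n b) ≤ poincareConst b * M := fun k =>
    (norm_grad_le hb hb' (t k) (l k) (N k)).trans (by gcongr; exact hbd k)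
  have hv : ∀ k, eLpNorm (v k) 2 (wMeas n b) ≤ poincareConst b * (poincareConst b * M) :=
    fun k => (eLpNorm_le_grad hb hb' (t k).memLp (t k).memLp_grad (l k)).trans
      (by gcongr; exact hG k)
  have hP := poincareConst_ne_top (b := b)
  have hM1 := ENNReal.mul_ne_top hP hM
  have hM2 := ENNReal.mul_ne_top hP hM1
  -- Three successive extractions, for the functions, gradients and Laplacians; the earlier limits
  -- persist along the later subsequences.
  obtain ⟨v₀, s, hs, hv0, wv⟩ := exists_weakTo_subseq (fun k => (t k).memLp) hM2 hv
  obtain ⟨G₀, s', hs', hG0, wG⟩ := exists_weakTo_subseq (fun k => (t (s k)).memLp_grad) hM1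
    fun k => hG (s k)
  obtain ⟨h₀, s'', hs'', hh0, wh⟩ := exists_weakTo_subseq (fun k => (t (s (s' k))).memLp_lap) hM
    fun k => hbd (s (s' k))
  have wG' := wG.comp hs''
  have wv' := wv.comp (hs'.comp hs'')
  have t0 : Triple b v₀ G₀ h₀ := Triple.of_weakTo hb hb' (fun k => t (s (s' (s'' k)))) hv0 hG0 hh0
    wv' wG' wh
  refine ⟨v₀, h₀, G₀, fun k => s (s' (s'' k)), hs.comp (hs'.comp hs''), t0, fun φ hφ => ?_, ?_, ?_,
    wh, fun τ τ₀ d d₀ => ?_⟩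
  · exact latZ_of_weakTo hb' (fun k => (t (s (s' (s'' k)))).memLp)
      (fun k => (t (s (s' (s'' k)))).memLp_grad) hv0 hG0 wv' wG' hφ
      fun k => l (s (s' (s'' k))) φ hφ
  · exact normZ_of_weakTo hb (fun k => (t (s (s' (s'' k)))).memLp_grad)
      (fun k => (t (s (s' (s'' k)))).memLp_lap) hG0 hh0 wG' wh fun k => N _
  · exact normZ_of_weakTo hb (fun k => (t (s (s' (s'' k)))).memLp_grad)
      (fun k => (t (s (s' (s'' k)))).memLp_lap) hG0 hh0 wG' wh fun k => N' _
  · refine tendsto_trace hb' (fun k => (t (s (s' (s'' k)))).memLp) hv0 wv'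
      (fun k => d (s (s' (s'' k)))) d₀
      (M := poincareConst b * (poincareConst b * M) + poincareConst b * M
        + eLpNorm G₀ 2 (wMeas n b)) ?_ (fun k => ?_) (fun k => ?_) ?_
    · exact ENNReal.add_ne_top.2 ⟨ENNReal.add_ne_top.2 ⟨hM2, hM1⟩, hG0.2.ne⟩
    · exact (hv _).trans (by rw [add_assoc]; exact le_self_add)
    · exact (hG _).trans (by rw [add_right_comm]; exact le_add_self)
    · exact le_add_self

/-! ### Carathéodory functions and the potential energy -/

section Nemytskii

variable {f : Thin n → ℝ → ℝ} {p : ℝ} {T : Thin n → ℝ}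

/-- A Carathéodory function agrees, for almost every `x`, with a jointly measurable one. -/
lemma IsCaratheodory.exists_rep (hf : IsCaratheodory f) : ∃ f' : Thin n → ℝ → ℝ,
    (∀ x, Continuous (f' x)) ∧ (∀ ζ, Measurable fun x => f' x ζ) ∧
      ∀ᵐ x ∂(volume.restrict (flatBall n)), f x = f' x := by
  have h1 : ∀ᵐ x ∂(volume.restrict (flatBall n)),
      Continuous (f x) ∧ ∀ q : ℚ, f x q = (hf.meas q).mk _ x := by
    filter_upwards [hf.cont, ae_all_iff.2 fun q : ℚ => (hf.meas q).ae_eq_mk] with x hx hq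
    exact ⟨hx, hq⟩
  obtain ⟨S, hS, hSm, hS0⟩ := exists_measurable_superset_of_null (ae_iff.1 h1)
  have hS1 : ∀ x, x ∉ S → Continuous (f x) ∧ ∀ q : ℚ, f x q = (hf.meas q).mk _ x := fun x hx => by
    by_contra hc
    exact hx (hS hc)
  classical
  -- Off the measurable null set `S`, `f x` is continuous and agrees at every rational with a
  -- measurable version. On `S` it is reset to `0`.
  let f' : Thin n → ℝ → ℝ := fun x ζ => if x ∈ S then 0 else f x ζ
  have hc : ∀ x, Continuous (f' x) := fun x => by
    by_cases hx : x ∈ S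
    · have : f' x = fun _ => 0 := by funext ζ; simp [f', hx]
      rw [this]; exact continuous_const
    · have : f' x = f x := by funext ζ; simp [f', hx]
      rw [this]; exact (hS1 x hx).1
  refine ⟨f', hc, fun ζ => ?_, ?_⟩
  · have hq : ∀ q : ℚ, Measurable fun x => f' x q := fun q => by
      have : (fun x => f' x q) = fun x => if x ∈ S then 0 else (hf.meas q).mk _ x := by
        funext x
        by_cases hx : x ∈ S
        · simp [f', hx]
        · simp [f', hx, (hS1 x hx).2 q]
      rw [this]
      exact Measurable.ite hSm measurable_const (hf.meas q).measurable_mk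
    -- Measurability at a real `ζ` follows by approximating `ζ` with rationals, using continuity in
    -- `ζ` for every `x`.
    obtain ⟨a, ha⟩ := mem_closure_iff_seq_limit.1 (Rat.denseRange_cast (𝕜 := ℝ) ζ)
    choose r hr using ha.1
    refine measurable_of_tendsto_metrizable (fun k => hq (r k)) (tendsto_pi_nhds.2 fun x => ?_)
    have h2 := ((hc x).tendsto ζ).comp ha.2
    refine h2.congr fun k => ?_
    simp [hr k]
  · filter_upwards [show ∀ᵐ x ∂(volume.restrict (flatBall n)), x ∉ S from
      measure_eq_zero_iff_ae_notMem.1 hS0] with x hx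
    funext ζ
    simp [f', hx]

lemma aemeasurable_comp_of_rep {f' : Thin n → ℝ → ℝ} (hc : ∀ x, Continuous (f' x))
    (hm : ∀ ζ, Measurable fun x => f' x ζ)
    (he : ∀ᵐ x ∂(volume.restrict (flatBall n)), f x = f' x)
    (hT : AEMeasurable T (volume.restrict (flatBall n))) :
    AEMeasurable (fun x => f x (T x)) (volume.restrict (flatBall n)) := by
  have h1 : Measurable (Function.uncurry fun ζ x => f' x ζ) :=
    measurable_uncurry_of_continuous_of_measurable (u := fun ζ x => f' x ζ) hc hm
  refine (h1.comp_aemeasurable (hT.prodMk aemeasurable_id)).congr ?_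
  filter_upwards [he] with x hx
  simp [hx]

lemma IsCaratheodory.aemeasurable_comp (hf : IsCaratheodory f)
    (hT : AEMeasurable T (volume.restrict (flatBall n))) :
    AEMeasurable (fun x => f x (T x)) (volume.restrict (flatBall n)) := by
  obtain ⟨f', hc, hm, he⟩ := hf.exists_rep
  exact aemeasurable_comp_of_rep hc hm he hT

lemma hasDerivAt_primF {x : Thin n} (hx : Continuous (f x)) (ζ : ℝ) :
    HasDerivAt (primF f x) (-2 * f x ζ) ζ :=
  (intervalIntegral.integral_hasDerivAt_right (hx.intervalIntegrable _ _)
    (hx.stronglyMeasurableAtFilter _ _) hx.continuousAt).const_mul (-2)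

lemma continuous_primF {x : Thin n} (hx : Continuous (f x)) : Continuous (primF f x) :=
  continuous_iff_continuousAt.2 fun ζ => (hasDerivAt_primF hx ζ).continuousAt

lemma IsCaratheodory.aemeasurable_primF (hf : IsCaratheodory f)
    (hT : AEMeasurable T (volume.restrict (flatBall n))) :
    AEMeasurable (fun x => primF f x (T x)) (volume.restrict (flatBall n)) := by
  obtain ⟨f', hc, hm, he⟩ := hf.exists_rep
  refine aemeasurable_comp_of_rep (f := primF f) (f' := primF f')
    (fun x => continuous_primF (hc x)) (fun ζ => ?_) ?_ hT
  · have h1 : StronglyMeasurable (Function.uncurry f') := by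
      have h2 : Measurable (Function.uncurry fun ζ x => f' x ζ) :=
        measurable_uncurry_of_continuous_of_measurable (u := fun ζ x => f' x ζ) hc hm
      exact (h2.comp measurable_swap).stronglyMeasurable
    have h3 : ∀ s : Set ℝ, Measurable fun x => ∫ σ in s, f' x σ := fun s =>
      h1.integral_prod_right.measurable
    simp only [primF, intervalIntegral]
    exact ((h3 _).sub (h3 _)).const_mul _
  · filter_upwards [he] with x hx
    funext ζ
    simp only [primF, hx]

/-- The growth condition in a convenient form. -/
lemma rpow_sub_one_mul_le {z w : ℝ} (hp : 1 ≤ p) (hz : 0 ≤ z) (hw : 0 ≤ w) (hzw : z ≤ w) :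
    (1 + z ^ (p - 1)) * w ≤ 2 * (1 + w ^ p) := by
  have h1 : z ^ (p - 1) ≤ w ^ (p - 1) := Real.rpow_le_rpow hz hzw (by linarith)
  have h2 : w ^ (p - 1) * w ≤ w ^ p := by
    rcases hw.eq_or_lt with h | h
    · rw [← h]; simp; positivity
    · rw [← Real.rpow_add_one h.ne']; simp
  have h3 : w ≤ 1 + w ^ p := by
    rcases le_total w 1 with h | h
    · have : 0 ≤ w ^ p := by positivity
      linarith
    · have := Real.rpow_le_rpow_of_exponent_le h hp
      rw [Real.rpow_one] at this; linarith
  nlinarith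

lemma abs_primF_le {x : Thin n} {C : ℝ} (hp : 1 ≤ p) (hC : 0 ≤ C)
    (hx : ∀ ζ : ℝ, |f x ζ| ≤ C * (1 + |ζ| ^ (p - 1))) (ζ : ℝ) :
    |primF f x ζ| ≤ 4 * C * (1 + |ζ| ^ p) := by
  have h1 : ‖∫ σ in (0 : ℝ)..ζ, f x σ‖ ≤ C * (1 + |ζ| ^ (p - 1)) * |ζ - 0| := by
    refine intervalIntegral.norm_integral_le_of_norm_le_const fun σ hσ => ?_
    refine (hx σ).trans ?_
    have h2 : |σ| ≤ |ζ| := by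
      rcases le_total 0 ζ with h | h
      · rw [Set.uIoc_of_le h] at hσ
        rw [abs_of_pos hσ.1, abs_of_nonneg h]; exact hσ.2
      · rw [Set.uIoc_of_ge h] at hσ
        rw [abs_of_nonpos hσ.2, abs_of_nonpos h]; linarith [hσ.1]
    have := Real.rpow_le_rpow (abs_nonneg σ) h2 (by linarith : 0 ≤ p - 1)
    gcongr
  rw [sub_zero, Real.norm_eq_abs] at h1
  have h3 := rpow_sub_one_mul_le hp (abs_nonneg ζ) (abs_nonneg ζ) le_rfl
  rw [primF, abs_mul, abs_neg, abs_two]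
  nlinarith

lemma GrowthHyp.exists_nonneg (h : GrowthHyp p f) : ∃ C : ℝ, 0 ≤ C ∧
    ∀ᵐ x ∂(volume.restrict (flatBall n)), ∀ ζ : ℝ, |f x ζ| ≤ C * (1 + |ζ| ^ (p - 1)) := by
  obtain ⟨C, hC⟩ := h
  refine ⟨|C|, abs_nonneg C, ?_⟩
  filter_upwards [hC] with x hx ζ
  exact (hx ζ).trans (by gcongr; exact le_abs_self C)

lemma integrable_abs_rpow (hp : 1 ≤ p)
    (hT : MemLp T (ENNReal.ofReal p) (volume.restrict (flatBall n))) :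
    Integrable (fun x => |T x| ^ p) (volume.restrict (flatBall n)) := by
  have h := hT.integrable_norm_rpow (by simp; linarith) ENNReal.ofReal_ne_top
  rwa [ENNReal.toReal_ofReal (by linarith)] at h

lemma integrable_primF (hp : 1 ≤ p) (hf : IsCaratheodory f) (hgr : GrowthHyp p f)
    (hT : MemLp T (ENNReal.ofReal p) (volume.restrict (flatBall n))) :
    Integrable (fun x => primF f x (T x)) (volume.restrict (flatBall n)) := by
  obtain ⟨C, hC, h⟩ := hgr.exists_nonneg
  refine Integrable.mono' (((integrable_const 1).add (integrable_abs_rpow hp hT)).const_mul (4 * C))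
    (hf.aemeasurable_primF hT.1.aemeasurable).aestronglyMeasurable ?_
  filter_upwards [h] with x hx
  exact abs_primF_le hp hC hx _

lemma CoercHyp.primF_nonneg (h : CoercHyp p f) :
    ∀ᵐ x ∂(volume.restrict (flatBall n)), ∀ ζ : ℝ, 0 ≤ primF f x ζ := by
  obtain ⟨c, hc, h⟩ := h
  filter_upwards [h] with x hx ζ
  exact le_trans (by positivity) (hx ζ)

/-- Finite potential energy forces the trace to be in `L^p`. -/
lemma CoercHyp.memLp (hp : 1 ≤ p) (h : CoercHyp p f)
    (hT : AEStronglyMeasurable T (volume.restrict (flatBall n)))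
    (hfin : ∫⁻ x in flatBall n, ENNReal.ofReal (primF f x (T x)) < ⊤) :
    MemLp T (ENNReal.ofReal p) (volume.restrict (flatBall n)) := by
  obtain ⟨c, hc, h⟩ := h
  have hp0 : ENNReal.ofReal p ≠ 0 := by simp; linarith
  refine ⟨hT, (eLpNorm_lt_top_iff_lintegral_rpow_enorm_lt_top hp0 ENNReal.ofReal_ne_top).2 ?_⟩
  rw [ENNReal.toReal_ofReal (by linarith)]
  have h1 : ∫⁻ x in flatBall n, ENNReal.ofReal c * ‖T x‖ₑ ^ p < ⊤ := by
    refine lt_of_le_of_lt (lintegral_mono_ae ?_) hfin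
    filter_upwards [h] with x hx
    rw [← ofReal_norm, ENNReal.ofReal_rpow_of_nonneg (norm_nonneg _) (by linarith),
      ← ENNReal.ofReal_mul hc.le]
    exact ENNReal.ofReal_le_ofReal (hx _)
  rw [lintegral_const_mul' _ _ ENNReal.ofReal_ne_top] at h1
  exact (ENNReal.mul_lt_top_iff.1 h1).elim (fun h => h.2) fun h =>
    h.elim (fun h => absurd h (by simp [hc])) fun h => by rw [h]; simp

/-- Fatou's lemma for the potential energy. -/
lemma lintegral_primF_le_liminf (hf : IsCaratheodory f) {Tk : ℕ → Thin n → ℝ}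
    (hTk : ∀ k, AEMeasurable (Tk k) (volume.restrict (flatBall n)))
    (h : ∀ᵐ x ∂(volume.restrict (flatBall n)), Tendsto (fun k => Tk k x) atTop (𝓝 (T x))) :
    ∫⁻ x in flatBall n, ENNReal.ofReal (primF f x (T x)) ≤
      liminf (fun k => ∫⁻ x in flatBall n, ENNReal.ofReal (primF f x (Tk k x))) atTop := by
  refine le_trans (le_of_eq ?_) (lintegral_liminf_le' fun k =>
    (hf.aemeasurable_primF (hTk k)).ennreal_ofReal)
  refine lintegral_congr_ae ?_
  filter_upwards [h, hf.cont] with x hx hc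
  exact (((ENNReal.continuous_ofReal.comp (continuous_primF hc)).tendsto _).comp hx).liminf_eq.symm

end Nemytskii

/-! ### Existence of minimizers -/

/-- Tail infima increase with the starting index, so their suprema add. It recombines the lower
semicontinuity of the two energy terms. -/
lemma liminf_add_liminf_le (u v : ℕ → ℝ≥0∞) :
    liminf u atTop + liminf v atTop ≤ liminf (fun k => u k + v k) atTop := by
  rw [liminf_eq_iSup_iInf_of_nat, liminf_eq_iSup_iInf_of_nat, liminf_eq_iSup_iInf_of_nat,
    ENNReal.iSup_add_iSup_of_monotone]
  · exact iSup_mono fun N => le_iInf₂ fun i hi => add_le_add (iInf₂_le i hi) (iInf₂_le i hi)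
  · exact fun N N' h => le_iInf₂ fun i hi => iInf₂_le i (h.trans hi)
  · exact fun N N' h => le_iInf₂ fun i hi => iInf₂_le i (h.trans hi)

lemma Triple.zero : Triple b (0 : Amb n → ℝ) 0 0 where
  memLp := MemLp.zero
  memLp_grad := MemLp.zero
  memLp_lap := MemLp.zero
  parts_grad φ hφ := by simp
  parts_lap φ hφ := by simp

lemma energy_eq {f : Thin n → ℝ → ℝ} {w h : Amb n → ℝ} {T : Thin n → ℝ}
    (hh : weakLap b w =ᵐ[wMeas n b] h) (hT : IsFlatTrace w T) :
    energy b f w = (∫⁻ X, ‖h X‖ₑ ^ 2 ∂(wMeas n b))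
      + ∫⁻ x in flatBall n, ENNReal.ofReal (primF f x (T x)) := by
  rw [energy]
  congr 1
  · refine lintegral_congr_ae ?_
    filter_upwards [hh] with X hX
    rw [hX, ← sq_abs, ← Real.norm_eq_abs, ENNReal.ofReal_pow (norm_nonneg _), ofReal_norm]
  · refine lintegral_congr_ae ?_
    filter_upwards [hT.flatTrace_ae_eq] with x hx
    rw [hx]

section Existence

variable {g w v h : Amb n → ℝ} {G : Amb n → Amb n} {f : Thin n → ℝ → ℝ} {p : ℝ}

lemma sub_eq_add_neg_one_smul (w g : Amb n → ℝ) : w - g = w + (-1 : ℝ) • g := by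
  rw [neg_one_smul, sub_eq_add_neg]

lemma Admissible.triple (hb : -1 < b) (hb' : b < 1) (hg : MemH b g) (hw : Admissible b g w) :
    Triple b (w - g) (weakGrad w + (-1 : ℝ) • weakGrad g)
      (weakLap b w + (-1 : ℝ) • weakLap b g) := by
  rw [sub_eq_add_neg_one_smul]
  exact (hw.memH.triple hb hb').add_smul hb hb' (hg.triple hb hb') (-1)

lemma Admissible.latZ (hb : -1 < b) (hb' : b < 1) (hg : MemH b g) (hw : Admissible b g w) :
    LatZ (w - g) (weakGrad w + (-1 : ℝ) • weakGrad g) :=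
  (lateralZero_iff hb' (hw.triple hb hb' hg)).1 hw.lateral

lemma Admissible.normZ_lateral (hb : -1 < b) (hb' : b < 1) (hg : MemH b g)
    (hw : Admissible b g w) : NormZ b {X | 0 < ycoord X} (weakGrad w + (-1 : ℝ) • weakGrad g)
      (weakLap b w + (-1 : ℝ) • weakLap b g) :=
  (lateralNormalZero_iff hb hb' (hw.triple hb hb' hg)).1 hw.lateralNormal

lemma Admissible.normZ_flat (hb : -1 < b) (hb' : b < 1) (hg : MemH b g)
    (hgc : FlatConormalZero b g) (hw : Admissible b g w) :
    NormZ b (Metric.ball 0 1) (weakGrad w + (-1 : ℝ) • weakGrad g)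
      (weakLap b w + (-1 : ℝ) • weakLap b g) := by
  refine (flatConormalZero_iff hb hb' (hw.triple hb hb' hg)).1 ?_
  rw [sub_eq_add_neg_one_smul]
  exact hw.conormal.add_smul hb hb' hw.memH hg hgc (-1)

/-- Adding a function with homogeneous boundary conditions preserves admissibility. -/
lemma Admissible.add_smul (hb : -1 < b) (hb' : b < 1) (hg : MemH b g) (hw : Admissible b g w)
    (t : Triple b v G h) (l : LatZ v G) (N : NormZ b (Metric.ball 0 1) G h)
    (N' : NormZ b {X | 0 < ycoord X} G h) (c : ℝ) : Admissible b g (w + c • v) := by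
  have hv := t.memH hb hb'
  have hwg := (hw.triple hb hb' hg).memH hb hb'
  have e : w + c • v - g = (w - g) + c • v := add_sub_right_comm _ _ _
  refine ⟨hw.memH.add_smul hb hb' hv c, ?_, ?_, ?_⟩
  · rw [e]
    exact hw.lateral.add_smul hb hb' hwg hv ((lateralZero_iff hb' t).2 l) c
  · rw [e]
    exact hw.lateralNormal.add_smul hb hb' hwg hv ((lateralNormalZero_iff hb hb' t).2 N') c
  · exact hw.conormal.add_smul hb hb' hw.memH hv ((flatConormalZero_iff hb hb' t).2 N) c

lemma DatumHyp.admissible (hb : -1 < b) (hb' : b < 1) (hg : DatumHyp b p g) :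
    Admissible b g g := by
  refine ⟨hg.memH, ?_, ?_, hg.conormal⟩
  · rw [sub_self]
    exact (lateralZero_iff hb' Triple.zero (b := b)).2 fun φ hφ => by simp
  · rw [sub_self]
    exact (lateralNormalZero_iff hb hb' Triple.zero).2 fun φ hφ => by simp

/-- `exists_traceData` covers only functions vanishing on the sphere, so the trace of `w` is built
from the given trace of `g` and that of `w - g`. -/
lemma Admissible.isFlatTrace (hb : -1 < b) (hb' : b < 1) (hg : MemH b g) (hw : Admissible b g w)
    {T τ : Thin n → ℝ} (hT : IsFlatTrace g T)
    (d : TraceData b (w - g) (weakGrad w + (-1 : ℝ) • weakGrad g) τ) :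
    IsFlatTrace w (T + (1 : ℝ) • τ) := by
  have t := hw.triple hb hb' hg
  have h1 := hT.add_smul hb hb' hg (t.memH hb hb') (d.isFlatTrace hb hb' t) 1
  rwa [one_smul ℝ (w - g), add_sub_cancel] at h1

/-- Here the `L^p` trace of the datum and the growth bound are used: `g` is a competitor of finite
energy, so the infimum is finite. -/
lemma DatumHyp.energy_lt_top (hp : 1 ≤ p) (hg : DatumHyp b p g)
    (hf : IsCaratheodory f) (hgr : GrowthHyp p f) : energy b f g < ⊤ := by
  obtain ⟨T, hT, hTp⟩ := hg.trace
  rw [energy_eq (ae_eq_refl _) hT]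
  refine ENNReal.add_lt_top.2 ⟨?_, (integrable_primF hp hf hgr hTp).lintegral_lt_top⟩
  rw [lintegral_enorm_sq_eq hg.memH.lap_memLp]
  exact ENNReal.ofReal_lt_top

lemma eLpNorm_weakLap_le_energy (f : Thin n → ℝ → ℝ) (w : Amb n → ℝ) :
    eLpNorm (weakLap b w) 2 (wMeas n b) ≤ energy b f w ^ (1 / 2 : ℝ) := by
  rw [eLpNorm_two_eq]
  refine ENNReal.rpow_le_rpow (le_trans (le_of_eq ?_) le_self_add) (by norm_num)
  refine lintegral_congr fun X => ?_
  rw [← sq_abs (weakLap b w X), ← Real.norm_eq_abs, ENNReal.ofReal_pow (norm_nonneg _), ofReal_norm]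

lemma WeakTo.add_left {α F : Type*} [MeasurableSpace α] {m : Measure α} [NormedAddCommGroup F]
    [InnerProductSpace ℝ F] {u : ℕ → α → F} {u₀ a : α → F} (ha : MemLp a 2 m)
    (hu : ∀ k, MemLp (u k) 2 m) (h0 : MemLp u₀ 2 m) (h : WeakTo m u u₀) :
    WeakTo m (fun k => a + u k) (a + u₀) := fun Ψ hΨ => by
  simp only [Pi.add_apply, inner_add_left]
  rw [integral_add (integrable_inner_of_memLp ha hΨ) (integrable_inner_of_memLp h0 hΨ)]
  simp_rw [fun k => integral_add (integrable_inner_of_memLp ha hΨ)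
    (integrable_inner_of_memLp (hu k) hΨ)]
  exact (h Ψ hΨ).const_add _

/-- The direct method. -/
theorem exists_isGlobalMin (hb : -1 < b) (hb' : b < 1) (hp : 1 ≤ p) (hg : DatumHyp b p g)
    (hf : IsCaratheodory f) (hgr : GrowthHyp p f) : ∃ u, IsGlobalMin b f g u := by
  have hE := hg.energy_lt_top hp hf hgr
  set E := energy b f g
  -- Only competitors no worse than `g` are kept, so every term of the minimizing sequence has its
  -- Laplacian bounded by `E^(1/2)`.
  let S : Set ℝ≥0∞ := {e | ∃ w, Admissible b g w ∧ energy b f w ≤ E ∧ energy b f w = e}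
  have hgS : E ∈ S := ⟨g, hg.admissible hb hb', le_rfl, rfl⟩
  obtain ⟨e, -, he, heS⟩ := exists_seq_tendsto_sInf (S := S) ⟨E, hgS⟩ (OrderBot.bddBelow S)
  choose w hw hwE hwe using heS
  obtain ⟨T, hT, hTp⟩ := hg.trace
  obtain ⟨v₀, h₀, G₀, s, hs, t₀, l₀, N₀, N₀', wh, htr⟩ := exists_triple_subseq hb hb'
    (fun k => (hw k).triple hb hb' hg.memH) (fun k => (hw k).latZ hb hb' hg.memH)
    (fun k => (hw k).normZ_flat hb hb' hg.memH hg.conormal)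
    (fun k => (hw k).normZ_lateral hb hb' hg.memH)
    (M := E ^ (1 / 2 : ℝ) + E ^ (1 / 2 : ℝ))
    (ENNReal.add_ne_top.2 ⟨ENNReal.rpow_ne_top_of_nonneg (by norm_num) hE.ne,
      ENNReal.rpow_ne_top_of_nonneg (by norm_num) hE.ne⟩) fun k => by
        refine (eLpNorm_add_le (hw k).memH.lap_memLp.1 (hg.memH.lap_memLp.const_smul (-1 : ℝ)).1
          (by norm_num)).trans (add_le_add ?_ ?_)
        · exact (eLpNorm_weakLap_le_energy f _).trans
            (ENNReal.rpow_le_rpow (hwE k) (by norm_num))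
        · rw [neg_one_smul, eLpNorm_neg]
          exact eLpNorm_weakLap_le_energy f _
  choose τ d using fun k => exists_traceData hb hb' ((hw k).triple hb hb' hg.memH).memLp
    ((hw k).triple hb hb' hg.memH).memLp_grad ((hw k).latZ hb hb' hg.memH)
  obtain ⟨τ₀, d₀⟩ := exists_traceData hb hb' t₀.memLp t₀.memLp_grad l₀
  -- Strong `L²` convergence of the traces gives convergence in measure, hence a.e. along a further
  -- subsequence, as Fatou's lemma requires.
  obtain ⟨s', hs', hae⟩ := (tendstoInMeasure_of_tendsto_eLpNorm (by norm_num)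
    (fun k => (d (s k)).memLp.1) d₀.memLp.1 (htr τ τ₀ d d₀)).exists_seq_tendsto_ae
  have hu := (hg.admissible hb hb').add_smul hb hb' hg.memH t₀ l₀ N₀ N₀' 1
  have hv₀ := t₀.memH hb hb'
  have key : energy b f (g + (1 : ℝ) • v₀) ≤ sInf S := by
    have h1 : Tendsto (fun k => energy b f (w (s (s' k)))) atTop (𝓝 (sInf S)) := by
      simp only [hwe]
      exact he.comp (hs.comp hs').tendsto_atTop
    rw [← h1.liminf_eq]
    have hl : weakLap b (g + (1 : ℝ) • v₀) =ᵐ[wMeas n b] weakLap b g + h₀ := by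
      filter_upwards [((hg.memH.triple hb hb').add_smul hb hb' t₀ 1).weakLap_ae_eq hb hb']
        with X hX
      rw [hX, one_smul]
    rw [energy_eq hl (hT.add_smul hb hb' hg.memH hv₀ (d₀.isFlatTrace hb hb' t₀) 1)]
    -- The energy is rewritten with `Δ_b w = Δ_b g + Δ_b (w - g)` and the trace `T + τ`, because
    -- convergence is known only for the differences `w - g`.
    have h2 : ∀ k, energy b f (w (s (s' k))) = (∫⁻ X, ‖(weakLap b g
        + (weakLap b (w (s (s' k))) + (-1 : ℝ) • weakLap b g)) X‖ₑ ^ 2 ∂(wMeas n b))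
          + ∫⁻ x in flatBall n, ENNReal.ofReal (primF f x ((T + (1 : ℝ) • τ (s (s' k))) x)) :=
      fun k => energy_eq (ae_of_all _ fun X => by simp)
        ((hw _).isFlatTrace hb hb' hg.memH hT (d _))
    simp only [h2]
    refine le_trans (add_le_add ?_ ?_) (liminf_add_liminf_le _ _)
    · refine WeakTo.lintegral_le_liminf (fun k => ?_) (hg.memH.lap_memLp.add t₀.memLp_lap)
        ((wh.comp hs').add_left hg.memH.lap_memLp
          (fun k => ((hw _).triple hb hb' hg.memH).memLp_lap) t₀.memLp_lap)
      exact hg.memH.lap_memLp.add ((hw _).triple hb hb' hg.memH).memLp_lap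
    · refine lintegral_primF_le_liminf hf (fun k => ?_) ?_
      · exact hTp.1.aemeasurable.add ((d _).memLp.1.aemeasurable.const_smul (1 : ℝ))
      · filter_upwards [hae] with x hx
        exact (hx.const_smul (1 : ℝ)).const_add (T x)
  refine ⟨_, hu, lt_of_le_of_lt (key.trans (sInf_le hgS)) hE, fun z hz => ?_⟩
  rcases le_total (energy b f z) E with h | h
  · exact key.trans (sInf_le ⟨z, hz, h, rfl⟩)
  · exact (key.trans (sInf_le hgS)).trans h

end Existence

/-! ### Smooth functions with vanishing conormal derivative -/

/-- Integration by parts for two test functions, the product of which is supported in the open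
half ball. -/
lemma IsTest.parts_grad {φ ψ : Amb n → ℝ} (hφ : IsTest (Metric.ball 0 1) φ)
    (hψ : IsTest {X | 0 < ycoord X} ψ) :
    ∫ X in halfBall n, (φ X • ∇ ψ X + ψ X • ∇ φ X) = 0 := by
  have i1 : Integrable fun X => φ X • ∇ ψ X :=
    (hφ.continuous.smul hψ.continuous_gradient).integrable_of_hasCompactSupport
      hφ.compact.smul_right
  have i2 : Integrable fun X => ψ X • ∇ φ X :=
    (hψ.continuous.smul hφ.continuous_gradient).integrable_of_hasCompactSupport
      hψ.compact.smul_right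
  have i3 : Integrable fun X => φ X * ψ X :=
    (hφ.continuous.mul hψ.continuous).integrable_of_hasCompactSupport hφ.compact.mul_right
  -- Off the half ball either `φ` or `ψ` vanishes together with its gradient, so the integral
  -- extends to the whole space.
  rw [setIntegral_eq_integral_of_forall_compl_eq_zero fun X hX => by
    by_cases h1 : X ∈ Metric.ball 0 1
    · have h2 : X ∉ {X | 0 < ycoord X} := fun h2 => hX (by
        rw [halfBall_eq_inter]; exact ⟨h1, h2⟩)
      rw [hψ.zero_of_notMem h2, hψ.gradient_zero_of_notMem h2]; simp
    · rw [hφ.zero_of_notMem h1, hφ.gradient_zero_of_notMem h1]; simp]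
  refine ext_inner_left ℝ fun v => ?_
  have e1 : ∀ X, inner ℝ v (φ X • ∇ ψ X) = φ X * fderiv ℝ ψ X v := fun X => by
    rw [inner_smul_right, real_inner_comm, inner_gradient_left]
  have e2 : ∀ X, inner ℝ v (ψ X • ∇ φ X) = fderiv ℝ φ X v * ψ X := fun X => by
    rw [inner_smul_right, real_inner_comm, inner_gradient_left, mul_comm]
  have j1 := i1.const_inner (𝕜 := ℝ) v
  have j2 := i2.const_inner (𝕜 := ℝ) v
  rw [integral_add i1 i2, inner_add_right, ← integral_inner i1, ← integral_inner i2,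
    inner_zero_right]
  simp only [e1, e2] at j1 j2 ⊢
  rw [integral_mul_fderiv_eq_neg_fderiv_mul_of_integrable j2 j1 i3
    (fun X _ => hφ.differentiable X) fun X _ => hψ.differentiable X, neg_add_cancel]

lemma IsTest.isWeakGrad {φ : Amb n → ℝ} (hφ : IsTest (Metric.ball 0 1) φ) :
    IsWeakGrad φ (∇ φ) where
  locInt_fun := hφ.continuous.locallyIntegrable.locallyIntegrableOn _
  locInt_grad := hφ.continuous_gradient.locallyIntegrable.locallyIntegrableOn _
  parts ψ hψ := by
    have h := hφ.parts_grad (hψ.mono fun X hX => hX.2)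
    rw [integral_add] at h
    · exact eq_neg_of_add_eq_zero_left h
    · exact ((hφ.continuous.smul hψ.continuous_gradient).integrable_of_hasCompactSupport
        hφ.compact.smul_right).integrableOn
    · exact ((hψ.continuous.smul hφ.continuous_gradient).integrable_of_hasCompactSupport
        hψ.compact.smul_right).integrableOn

lemma IsCore.weakGrad_ae_eq {φ : Amb n → ℝ} (hφ : IsCore b φ) :
    weakGrad φ =ᵐ[wMeas n b] ∇ φ :=
  ae_eq_wMeas_iff.2 ((isWeakGrad_weakGrad ⟨_, hφ.test.isWeakGrad⟩).ae_eq hφ.test.isWeakGrad)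

lemma IsCore.triple (hb : -1 < b) (hb' : b < 1) {φ : Amb n → ℝ} (hφ : IsCore b φ) :
    Triple b φ (∇ φ) (weakLap b φ) :=
  (hφ.memH.triple hb hb').congr (ae_eq_refl _) hφ.weakGrad_ae_eq (ae_eq_refl _)

lemma IsCore.latZ {φ : Amb n → ℝ} (hφ : IsCore b φ) : LatZ φ (∇ φ) :=
  fun _ hψ => hφ.test.parts_grad hψ

/-- A function vanishing near the sphere satisfies the lateral Neumann condition. -/
lemma IsCore.normZ_lateral (hb : -1 < b) (hb' : b < 1) {φ : Amb n → ℝ} (hφ : IsCore b φ) :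
    NormZ b {X | 0 < ycoord X} (∇ φ) (weakLap b φ) := by
  have t := hφ.triple hb hb'
  obtain ⟨η, hη, hη1⟩ := exists_cutoff hφ.test.compact hφ.test.supp
  have e : ∀ ψ : Amb n → ℝ, Differentiable ℝ ψ → ∀ X,
      inner ℝ (∇ φ X) (∇ (fun X => η X * ψ X) X) = inner ℝ (∇ φ X) (∇ ψ X) := fun ψ hψ X => by
    by_cases hX : X ∈ tsupport φ
    · have h1 : (fun X => η X * ψ X) =ᶠ[𝓝 X] ψ := by
        filter_upwards [hη1 X hX] with Z hZ
        simp [hZ]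
      simp only [gradient, h1.fderiv_eq]
    · rw [gradient_eq_zero_of_notMem_tsupport hX, inner_zero_left, inner_zero_left]
  -- The cutoff turns `ψ` into a test function of the open half ball without changing `∇ψ` where
  -- `∇φ` lives; the price is the factor `η` on `weakLap b φ`.
  have key : ∀ ψ : Amb n → ℝ, IsTest {X | 0 < ycoord X} ψ →
      ∫ X, (inner ℝ (∇ φ X) (∇ ψ X) + (η X * weakLap b φ X) * ψ X) ∂(wMeas n b) = 0 :=
    fun ψ hψ => by
      have ht : IsTest (halfBall n) fun X => η X * ψ X := by
        rw [halfBall_eq_inter]; exact hη.mul hψ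
      rw [← t.parts_lap _ ht]
      congr 1; ext1 X
      rw [e ψ hψ.differentiable]
      ring
  have hη' : MemLp η ⊤ (wMeas n b) := hη.continuous.memLp_top_of_hasCompactSupport hη.compact _
  have hm : MemLp (fun X => η X * weakLap b φ X) 2 (wMeas n b) := t.memLp_lap.mul' hη'
  -- By `key`, `η · weakLap b φ` is also a weak Laplacian of `φ`, so uniqueness removes `η`.
  have t' : Triple b φ (∇ φ) (fun X => η X * weakLap b φ X) :=
    ⟨t.memLp, t.memLp_grad, hm, t.parts_grad, fun ψ hψ => key ψ (hψ.mono fun X hX => hX.2)⟩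
  exact NormZ.congr (h := fun X => η X * weakLap b φ X) key (ae_eq_refl _)
    (t'.weakLap_ae_eq hb hb').symm

/-- The conormal derivative of a smooth function tends to `0` at a uniform rate if it tends to
`0`. -/
lemma exists_conormal_le (hb : -1 < b) {φ : Amb n → ℝ} (hφ : IsTest (Metric.ball 0 1) φ)
    (hc : ∀ x ∈ flatBall n,
      Tendsto (fun y : ℝ => y ^ b * ycoord (∇ φ (pt x y))) (𝓝[>] 0) (𝓝 0)) :
    ∃ C β : ℝ, 0 ≤ C ∧ 0 < β ∧
      ∀ X ∈ halfBall n, ycoord X ^ b * |ycoord (∇ φ X)| ≤ C * ycoord X ^ β := by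
  have hcd : Continuous fun X => ycoord (∇ φ X) := continuous_ycoord.comp hφ.continuous_gradient
  -- For `b > 0` a bounded gradient suffices, with rate `β = b`.
  rcases lt_or_ge 0 b with h | h
  · obtain ⟨C, hC⟩ := hφ.continuous_gradient.bounded_above_of_compact_support
      hφ.hasCompactSupport_gradient
    refine ⟨C, b, (norm_nonneg _).trans (hC 0), h, fun X hX => ?_⟩
    rw [mul_comm]
    have := Real.rpow_nonneg hX.2.le b
    gcongr
    exact (abs_ycoord_le _).trans (hC X)
  · have hd : ∃ K, LipschitzWith K (fderiv ℝ φ) :=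
      (hφ.smooth.fderiv_right (m := 1) (by norm_cast)).lipschitzWith_of_hasCompactSupport
        (hφ.compact.fderiv ℝ) one_ne_zero |> fun h => ⟨_, h.choose_spec⟩
    obtain ⟨K, hK⟩ := hd
    refine ⟨K, b + 1, K.2, by linarith, fun X hX => ?_⟩
    obtain ⟨x, y, rfl⟩ := exists_pt X
    obtain ⟨hx, hy0, hy1⟩ := mem_flatBall_of_pt_mem hX
    -- For `b ≤ 0` one has `y^b ≥ 1` on `(0, 1)`, so the conormal limit forces `∂_y φ = 0` at height
    -- `0`. The Lipschitz bound on the derivative then gives the rate `β = b + 1`.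
    have hz : ycoord (∇ φ (pt x 0)) = 0 := by
      have h1 : Tendsto (fun y : ℝ => ycoord (∇ φ (pt x y))) (𝓝[>] 0)
          (𝓝 (ycoord (∇ φ (pt x 0)))) :=
        ((hcd.comp (continuous_pt_right x)).tendsto 0).mono_left nhdsWithin_le_nhds
      refine tendsto_nhds_unique h1 (squeeze_zero_norm' ?_ ((hc x hx).norm.trans (by simp)))
      filter_upwards [Ioo_mem_nhdsGT (zero_lt_one' ℝ)] with t ht
      rw [norm_mul]
      refine le_mul_of_one_le_left (norm_nonneg _) ?_
      rw [Real.norm_of_nonneg (Real.rpow_nonneg ht.1.le b)]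
      exact Real.one_le_rpow_of_pos_of_le_one_of_nonpos ht.1 ht.2.le h
    have h2 : |ycoord (∇ φ (pt x y))| ≤ K * y := by
      have h3 : ycoord (∇ φ (pt x y)) =
          (fderiv ℝ φ (pt x y) - fderiv ℝ φ (pt x 0)) (pt 0 1) := by
        rw [sub_apply, ← ycoord_gradient, ← ycoord_gradient, hz, sub_zero]
      rw [h3, ← Real.norm_eq_abs]
      refine (ContinuousLinearMap.le_opNorm _ _).trans ?_
      rw [norm_pt_zero, abs_one, mul_one]
      refine (hK.norm_sub_le _ _).trans (le_of_eq ?_)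
      have h4 : pt x y - pt x 0 = pt 0 y := by
        rw [sub_eq_iff_eq_add, ← pt_add]; simp
      rw [h4, norm_pt_zero, abs_of_pos hy0]
    rw [ycoord_pt, Real.rpow_add_one hy0.ne']
    calc y ^ b * |ycoord (∇ φ (pt x y))| ≤ y ^ b * (K * y) := by
          have := Real.rpow_nonneg hy0.le b
          gcongr
      _ = K * (y ^ b * y) := by ring

/-- A smooth step: `0` for `s ≤ 1` and `1` for `s ≥ 2`. -/
def step (s : ℝ) : ℝ := Real.smoothTransition (s - 1)

lemma contDiff_step : ContDiff ℝ ∞ step :=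
  Real.smoothTransition.contDiff.comp (contDiff_id.sub contDiff_const)

lemma step_of_le {s : ℝ} (h : s ≤ 1) : step s = 0 :=
  Real.smoothTransition.zero_of_nonpos (by linarith)

lemma step_of_ge {s : ℝ} (h : 2 ≤ s) : step s = 1 :=
  Real.smoothTransition.one_of_one_le (by linarith)

lemma abs_step_le (s : ℝ) : |step s| ≤ 1 := by
  rw [step, abs_of_nonneg (Real.smoothTransition.nonneg _)]
  exact Real.smoothTransition.le_one _

lemma deriv_step_of_gt {s : ℝ} (h : 2 < s) : deriv step s = 0 := by
  have h1 : step =ᶠ[𝓝 s] fun _ => 1 := by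
    filter_upwards [lt_mem_nhds h] with t ht
    exact step_of_ge ht.le
  rw [h1.deriv_eq, deriv_const]

lemma deriv_step_of_lt {s : ℝ} (h : s < 1) : deriv step s = 0 := by
  have h1 : step =ᶠ[𝓝 s] fun _ => 0 := by
    filter_upwards [gt_mem_nhds h] with t ht
    exact step_of_le ht.le
  rw [h1.deriv_eq, deriv_const]

/-- A scale-invariant bound: the derivative of `y ↦ step (c y)` is at most `A / y`, whatever `c > 0`
is. -/
lemma exists_deriv_step_le : ∃ A : ℝ, ∀ s, |deriv step s| * |s| ≤ A := by
  have hc : Continuous fun s => deriv step s * s :=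
    (contDiff_step.continuous_deriv (by simp)).mul continuous_id
  obtain ⟨A, hA⟩ := hc.bounded_above_of_compact_support
    (HasCompactSupport.of_support_subset_isCompact (isCompact_Icc (a := (1 : ℝ)) (b := 2))
      fun s hs => by
        by_contra h
        rw [Set.mem_Icc, not_and_or, not_le, not_le] at h
        refine hs ?_
        rcases h with h | h
        · simp [deriv_step_of_lt h]
        · simp [deriv_step_of_gt h])
  exact ⟨A, fun s => by simpa using hA s⟩

lemma inner_gradient_step (c : ℝ) (X v : Amb n) :
    inner ℝ v (∇ (fun X : Amb n => step (c * ycoord X)) X)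
      = deriv step (c * ycoord X) * (c * ycoord v) := by
  have h1 : HasFDerivAt (fun X : Amb n => c * ycoord X) (c • ycoordL n) X :=
    ((ycoordL n).hasFDerivAt).const_mul c
  have h2 := ((contDiff_step.differentiable (by simp)) (c * ycoord X)).hasDerivAt.comp_hasFDerivAt
    X h1
  rw [real_inner_comm, inner_gradient_left]
  rw [show fderiv ℝ (fun X : Amb n => step (c * ycoord X)) X = _ from h2.fderiv]
  rfl

lemma IsTest.mul_step {ψ : Amb n → ℝ} (hψ : IsTest (Metric.ball 0 1) ψ) {c : ℝ} (hc : 0 < c) :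
    IsTest (halfBall n) fun X => step (c * ycoord X) * ψ X := by
  have hs : ContDiff ℝ ∞ fun X : Amb n => step (c * ycoord X) :=
    contDiff_step.comp (contDiff_const.mul (ycoordL n).contDiff)
  have ht := hψ.mul_left hs
  refine ⟨ht.smooth, ht.compact, fun X hX => ?_⟩
  rw [halfBall_eq_inter]
  refine ⟨ht.supp hX, ?_⟩
  have h1 : tsupport (fun X : Amb n => step (c * ycoord X) * ψ X) ⊆ {X | 1 ≤ c * ycoord X} :=
    closure_minimal (fun Z hZ => by
      by_contra h
      exact hZ (by simp [step_of_le (le_of_not_ge h)]))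
      (isClosed_le continuous_const (continuous_const.mul continuous_ycoord))
  have h2 : 1 ≤ c * ycoord X := h1 hX
  by_contra h
  have h3 : ycoord X ≤ 0 := le_of_not_gt h
  nlinarith

/-- Vanishing of the classical conormal derivative implies the weak conormal condition. -/
lemma IsCore.normZ_flat (hb : -1 < b) (hb' : b < 1) {φ : Amb n → ℝ} (hφ : IsCore b φ) :
    NormZ b (Metric.ball 0 1) (∇ φ) (weakLap b φ) := fun ψ hψ => by
  have t := hφ.triple hb hb'
  obtain ⟨C, β, hC, hβ, hCβ⟩ := exists_conormal_le hb hφ.test hφ.conormal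
  obtain ⟨A, hA⟩ := exists_deriv_step_le
  obtain ⟨B, hB⟩ := hψ.continuous.bounded_above_of_compact_support hψ.compact
  have hA0 : 0 ≤ A := le_trans (by positivity) (hA 0)
  have hB0 : 0 ≤ B := (norm_nonneg _).trans (hB 0)
  set P : Amb n → ℝ := fun X => inner ℝ (∇ φ X) (∇ ψ X) + weakLap b φ X * ψ X with hP
  have hPi := integrable_wMeas_iff.1 (integrable_pairing hb t.memLp_grad t.memLp_lap hψ)
  let c : ℕ → ℝ := fun k => k + 1
  have hc : ∀ k, 0 < c k := fun k => by positivity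
  have hct : Tendsto c atTop atTop := tendsto_atTop_add_const_right _ _ tendsto_natCast_atTop_atTop
  -- Testing the interior identity with the truncated `ψ` gives the wanted integrand times the
  -- cutoff, plus an error in which the cutoff's derivative meets `∂_y φ`.
  have e : ∀ k X, inner ℝ (∇ φ X) (∇ (fun X => step (c k * ycoord X) * ψ X) X)
      + weakLap b φ X * (step (c k * ycoord X) * ψ X) = step (c k * ycoord X) * P X
        + ψ X * (deriv step (c k * ycoord X) * (c k * ycoord (∇ φ X))) := fun k X => by
    have hs : ContDiff ℝ ∞ fun X : Amb n => step (c k * ycoord X) :=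
      contDiff_step.comp (contDiff_const.mul (ycoordL n).contDiff)
    rw [gradient_mul (hs.differentiable (by simp) X) (hψ.differentiable X), inner_add_right,
      inner_smul_right, inner_smul_right, inner_gradient_step, hP]
    ring
  have h0 : ∀ k, ∫ X in halfBall n, ycoord X ^ b • (step (c k * ycoord X) * P X
        + ψ X * (deriv step (c k * ycoord X) * (c k * ycoord (∇ φ X)))) = 0 := fun k => by
    rw [← integral_wMeas, ← t.parts_lap _ (hψ.mul_step (hc k))]
    congr 1; ext1 X
    exact (e k X).symm
  have hlim : Tendsto (fun k => ∫ X in halfBall n, ycoord X ^ b • (step (c k * ycoord X) * P X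
        + ψ X * (deriv step (c k * ycoord X) * (c k * ycoord (∇ φ X))))) atTop
      (𝓝 (∫ X in halfBall n, ycoord X ^ b • P X)) := by
    -- The error is dominated by a multiple of `y⁻¹ · y^β`, integrable as `β > 0`. It vanishes at
    -- each point once `c k * y > 2`.
    refine tendsto_integral_of_dominated_convergence
      (fun X => ‖ycoord X ^ b • P X‖ + B * (A * C) * ycoord X ^ (β - 1)) (fun k => ?_)
      (hPi.norm.add ((integrableOn_rpow_halfBall (by linarith)).const_mul _)) (fun k => ?_) ?_
    · have hm : AEStronglyMeasurable (fun X => ycoord X ^ b • P X)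
        (volume.restrict (halfBall n)) := hPi.1
      have m1 : AEStronglyMeasurable (fun X : Amb n => step (c k * ycoord X))
          (volume.restrict (halfBall n)) :=
        (contDiff_step.continuous.comp
          (continuous_const.mul continuous_ycoord)).aestronglyMeasurable
      have m2 : AEStronglyMeasurable (fun X : Amb n => ycoord X ^ b)
          (volume.restrict (halfBall n)) := Measurable.aestronglyMeasurable (by fun_prop)
      have m3 : AEStronglyMeasurable (fun X : Amb n => ψ X * (deriv step (c k * ycoord X)
          * (c k * ycoord (∇ φ X)))) (volume.restrict (halfBall n)) :=
        (hψ.continuous.mul (((contDiff_step.continuous_deriv (by simp)).comp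
          (continuous_const.mul continuous_ycoord)).mul (continuous_const.mul
            (continuous_ycoord.comp hφ.test.continuous_gradient)))).aestronglyMeasurable
      refine ((m1.mul hm).add (m2.mul m3)).congr (ae_of_all _ fun X => ?_)
      simp only [Pi.add_apply, Pi.mul_apply, smul_eq_mul]
      ring
    · filter_upwards [ae_restrict_mem measurableSet_halfBall] with X hX
      have hy : 0 < ycoord X := hX.2
      rw [smul_add]
      refine (norm_add_le _ _).trans (add_le_add ?_ ?_)
      · rw [norm_smul, norm_smul, norm_mul]
        gcongr
        exact mul_le_of_le_one_left (norm_nonneg _) (abs_step_le _)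
      · have h1 := hA (c k * ycoord X)
        have h2 := hCβ X hX
        rw [abs_of_pos (mul_pos (hc k) hy)] at h1
        have h3 : ‖ycoord X ^ b • (ψ X * (deriv step (c k * ycoord X) * (c k * ycoord (∇ φ X))))‖
            = |ψ X| * ((|deriv step (c k * ycoord X)| * (c k * ycoord X)) *
              ((ycoord X ^ b * |ycoord (∇ φ X)|) * (ycoord X)⁻¹)) := by
          rw [norm_smul, norm_mul, norm_mul, norm_mul, Real.norm_of_nonneg (hc k).le,
            Real.norm_of_nonneg (Real.rpow_nonneg hy.le b)]
          simp only [Real.norm_eq_abs]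
          field_simp
        rw [h3, Real.rpow_sub_one hy.ne', mul_assoc B, mul_assoc A, div_eq_mul_inv, ← mul_assoc C]
        have h4 : 0 ≤ ycoord X ^ b := Real.rpow_nonneg hy.le b
        have h5 := hB X
        have h6 := hc k
        rw [Real.norm_eq_abs] at h5
        gcongr
    · filter_upwards [ae_restrict_mem measurableSet_halfBall] with X hX
      have h1 : Tendsto (fun k => c k * ycoord X) atTop atTop := hct.atTop_mul_const hX.2
      refine tendsto_const_nhds.congr' ?_
      filter_upwards [h1.eventually_gt_atTop 2] with k hk
      rw [step_of_ge hk.le, deriv_step_of_gt hk]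
      simp
  simp only [h0] at hlim
  rw [integral_wMeas]
  exact (tendsto_nhds_unique hlim tendsto_const_nhds)

/-! ### The space of admissible variations -/

lemma eLpNorm_le_of_integral_sq_le {α F : Type*} [MeasurableSpace α] {m : Measure α}
    [NormedAddCommGroup F] [InnerProductSpace ℝ F] {u : α → F} (hu : MemLp u 2 m) {S : ℝ}
    (h : ∫ a, ‖u a‖ ^ 2 ∂m ≤ S) : eLpNorm u 2 m ≤ ENNReal.ofReal (Real.sqrt S) := by
  rw [integral_norm_sq_eq hu] at h
  rw [← ENNReal.ofReal_toReal hu.2.ne]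
  exact ENNReal.ofReal_le_ofReal (Real.le_sqrt_of_sq_le h)

lemma MemH.eLpNorm_le_normH {w : Amb n → ℝ} (hw : MemH b w) :
    eLpNorm w 2 (wMeas n b) ≤ ENNReal.ofReal (normH b w) ∧
    eLpNorm (weakGrad w) 2 (wMeas n b) ≤ ENNReal.ofReal (normH b w) ∧
    eLpNorm (weakLap b w) 2 (wMeas n b) ≤ ENNReal.ofReal (normH b w) := by
  have i1 : Integrable (fun X => w X ^ 2) (wMeas n b) := hw.memH1.memLp.integrable_sq
  have i2 : Integrable (fun X => ‖weakGrad w X‖ ^ 2) (wMeas n b) :=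
    hw.memH1.grad_memLp.norm.integrable_sq
  have i3 : Integrable (fun X => weakLap b w X ^ 2) (wMeas n b) := hw.lap_memLp.integrable_sq
  refine ⟨eLpNorm_le_of_integral_sq_le hw.memH1.memLp ?_,
    eLpNorm_le_of_integral_sq_le hw.memH1.grad_memLp ?_,
    eLpNorm_le_of_integral_sq_le hw.lap_memLp ?_⟩
  · simp only [Real.norm_eq_abs, sq_abs]
    exact integral_mono i1 ((i1.add i2).add i3) fun X => by
      nlinarith [sq_nonneg ‖weakGrad w X‖, sq_nonneg (weakLap b w X)]
  · exact integral_mono i2 ((i1.add i2).add i3) fun X => by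
      nlinarith [sq_nonneg (w X), sq_nonneg (weakLap b w X)]
  · simp only [Real.norm_eq_abs, sq_abs]
    exact integral_mono i3 ((i1.add i2).add i3) fun X => by
      nlinarith [sq_nonneg ‖weakGrad w X‖, sq_nonneg (w X)]

/-- Functions in the closure of the smooth ones satisfy the homogeneous boundary conditions. -/
lemma MemH0.boundary (hb : -1 < b) (hb' : b < 1) {φ : Amb n → ℝ} (h : MemH0 b φ) :
    LatZ φ (weakGrad φ) ∧ NormZ b (Metric.ball 0 1) (weakGrad φ) (weakLap b φ) ∧
      NormZ b {X | 0 < ycoord X} (weakGrad φ) (weakLap b φ) := by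
  obtain ⟨hφ, h⟩ := h
  choose ψ hψ hlt using fun k : ℕ => h (1 / ((k : ℝ) + 1)) (by positivity)
  have t := hφ.triple hb hb'
  have tk := fun k => (hψ k).memH.triple hb hb'
  have hd : ∀ k, Triple b (φ - ψ k) (weakGrad φ + (-1 : ℝ) • weakGrad (ψ k))
      (weakLap b φ + (-1 : ℝ) • weakLap b (ψ k)) := fun k => by
    rw [sub_eq_add_neg_one_smul]
    exact t.add_smul hb hb' (tk k) (-1)
  have hN : Tendsto (fun k => ENNReal.ofReal (normH b (φ - ψ k))) atTop (𝓝 0) := by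
    rw [← ENNReal.ofReal_zero]
    refine ENNReal.tendsto_ofReal ?_
    exact squeeze_zero (fun k => Real.sqrt_nonneg _) (fun k => (hlt k).le)
      tendsto_one_div_add_atTop_nhds_zero_nat
  have wv : WeakTo (wMeas n b) ψ φ := by
    refine weakTo_of_tendsto (fun k => (tk k).memLp) t.memLp
      (tendsto_of_tendsto_of_tendsto_of_le_of_le tendsto_const_nhds hN
        (fun k => zero_le) fun k => ?_)
    rw [eLpNorm_sub_comm]
    exact ((hd k).memH hb hb').eLpNorm_le_normH.1
  have wG : WeakTo (wMeas n b) (fun k => weakGrad (ψ k)) (weakGrad φ) := by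
    refine weakTo_of_tendsto (fun k => (tk k).memLp_grad) t.memLp_grad
      (tendsto_of_tendsto_of_tendsto_of_le_of_le tendsto_const_nhds hN
        (fun k => zero_le) fun k => ?_)
    have h1 := ((hd k).memH hb hb').eLpNorm_le_normH.2.1
    rw [eLpNorm_congr_ae ((hd k).weakGrad_ae_eq hb'), neg_one_smul, ← sub_eq_add_neg] at h1
    rwa [eLpNorm_sub_comm]
  have wh : WeakTo (wMeas n b) (fun k => weakLap b (ψ k)) (weakLap b φ) := by
    refine weakTo_of_tendsto (fun k => (tk k).memLp_lap) t.memLp_lap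
      (tendsto_of_tendsto_of_tendsto_of_le_of_le tendsto_const_nhds hN
        (fun k => zero_le) fun k => ?_)
    have h1 := ((hd k).memH hb hb').eLpNorm_le_normH.2.2
    rw [eLpNorm_congr_ae ((hd k).weakLap_ae_eq hb hb'), neg_one_smul, ← sub_eq_add_neg] at h1
    rwa [eLpNorm_sub_comm]
  -- Convergence in the `ℋ` norm gives weak convergence of all three components, under which the
  -- conditions known for the core are closed.
  refine ⟨fun χ hχ => latZ_of_weakTo hb' (fun k => (tk k).memLp) (fun k => (tk k).memLp_grad)
    t.memLp t.memLp_grad wv wG hχ fun k => ?_,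
    normZ_of_weakTo hb (fun k => (tk k).memLp_grad) (fun k => (tk k).memLp_lap) t.memLp_grad
      t.memLp_lap wG wh fun k => ?_,
    normZ_of_weakTo hb (fun k => (tk k).memLp_grad) (fun k => (tk k).memLp_lap) t.memLp_grad
      t.memLp_lap wG wh fun k => ?_⟩
  · exact LatZ.congr (b := b) (hψ k).latZ (ae_eq_refl _) (hψ k).weakGrad_ae_eq.symm χ hχ
  · exact ((hψ k).normZ_flat hb hb').congr (hψ k).weakGrad_ae_eq.symm (ae_eq_refl _)
  · exact ((hψ k).normZ_lateral hb hb').congr (hψ k).weakGrad_ae_eq.symm (ae_eq_refl _)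

/-! ### The Euler-Lagrange equation -/

section EulerLagrange

variable {f : Thin n → ℝ → ℝ} {p : ℝ} {T S : Thin n → ℝ} {g u φ : Amb n → ℝ}

/-- Expanding the square shows that the integral is a quadratic polynomial in `t`; the derivative is
its linear coefficient. -/
lemma hasDerivAt_integral_sq {α : Type*} [MeasurableSpace α] {m : Measure α} {h k : α → ℝ}
    (hh : MemLp h 2 m) (hk : MemLp k 2 m) :
    HasDerivAt (fun t : ℝ => ∫ a, (h a + t * k a) ^ 2 ∂m) (2 * ∫ a, h a * k a ∂m) 0 := by
  have e : (fun t : ℝ => ∫ a, (h a + t * k a) ^ 2 ∂m) = fun t =>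
      ∫ a, h a ^ 2 ∂m + t * (2 * ∫ a, h a * k a ∂m) + t ^ 2 * ∫ a, k a ^ 2 ∂m := by
    funext t
    have i1 := (integrable_mul_of_memLp hh hk).const_mul (2 : ℝ) |>.const_mul t
    rw [← integral_const_mul, ← integral_const_mul, ← integral_const_mul,
      ← integral_add hh.integrable_sq i1,
      ← integral_add (f := fun a => h a ^ 2 + t * (2 * (h a * k a))) (hh.integrable_sq.add i1)
        (hk.integrable_sq.const_mul _)]
    congr 1; ext1 a
    ring
  rw [e]
  have h1 := (((hasDerivAt_id (0 : ℝ)).mul_const (2 * ∫ a, h a * k a ∂m)).const_add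
    (∫ a, h a ^ 2 ∂m)).add (((hasDerivAt_id (0 : ℝ)).pow 2).mul_const (∫ a, k a ^ 2 ∂m))
  exact h1.congr_deriv (by simp)

lemma MemLp.add_mul (hT : MemLp T (ENNReal.ofReal p) (volume.restrict (flatBall n)))
    (hS : MemLp S (ENNReal.ofReal p) (volume.restrict (flatBall n))) (t : ℝ) :
    MemLp (fun x => T x + t * S x) (ENNReal.ofReal p) (volume.restrict (flatBall n)) :=
  hT.add (hS.const_mul t)

/-- The potential energy is differentiable in the direction of an `L^p` function. -/
lemma hasDerivAt_integral_primF (hp : 1 ≤ p) (hf : IsCaratheodory f) (hgr : GrowthHyp p f)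
    (hT : MemLp T (ENNReal.ofReal p) (volume.restrict (flatBall n)))
    (hS : MemLp S (ENNReal.ofReal p) (volume.restrict (flatBall n))) :
    HasDerivAt (fun t : ℝ => ∫ x in flatBall n, primF f x (T x + t * S x))
      (∫ x in flatBall n, -2 * (f x (T x) * S x)) 0 := by
  obtain ⟨C, hC, h⟩ := hgr.exists_nonneg
  have hR : MemLp (fun x => |T x| + |S x|) (ENNReal.ofReal p) (volume.restrict (flatBall n)) :=
    hT.norm.add hS.norm
  have key := hasDerivAt_integral_of_dominated_loc_of_deriv_le
    (μ := volume.restrict (flatBall n)) (F := fun (t : ℝ) x => primF f x (T x + t * S x))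
    (F' := fun t x => -2 * (f x (T x + t * S x) * S x)) (x₀ := 0)
    -- For `|t| < 1`, `|T + tS| ≤ |T| + |S|`, and `rpow_sub_one_mul_le` absorbs the factor `|S|`.
    -- The `4` is the `2` of that lemma times the `2` of `primF`.
    (bound := fun x => 4 * C * (1 + |(|T x| + |S x|)| ^ p)) (Metric.ball_mem_nhds 0 one_pos)
    (Eventually.of_forall fun t =>
      (hf.aemeasurable_primF (MemLp.add_mul hT hS t).1.aemeasurable).aestronglyMeasurable)
    (integrable_primF hp hf hgr (MemLp.add_mul hT hS 0))
    (((hf.aemeasurable_comp (MemLp.add_mul hT hS 0).1.aemeasurable).mul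
      hS.1.aemeasurable).const_mul _).aestronglyMeasurable ?_
    (((integrable_const 1).add (integrable_abs_rpow hp hR)).const_mul _) ?_
  · simpa using key.2
  · filter_upwards [h] with x hx t ht
    have ht1 : |t| ≤ 1 := by
      rw [mem_ball_zero_iff] at ht; exact ht.le
    have h1 : |T x + t * S x| ≤ |T x| + |S x| := by
      refine (abs_add_le _ _).trans ?_
      rw [abs_mul]
      gcongr
      exact mul_le_of_le_one_left (abs_nonneg _) ht1
    have h2 := rpow_sub_one_mul_le hp (abs_nonneg _) (by positivity) h1
    have h3 : |f x (T x + t * S x)| * |S x| ≤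
        C * ((1 + |T x + t * S x| ^ (p - 1)) * (|T x| + |S x|)) := by
      rw [← mul_assoc]
      gcongr
      · exact hx _
      · exact le_add_of_nonneg_left (abs_nonneg _)
    rw [Real.norm_eq_abs, abs_mul, abs_mul, abs_neg, abs_two,
      abs_of_nonneg (by positivity : 0 ≤ |T x| + |S x|)]
    nlinarith
  · filter_upwards [hf.cont] with x hx t _
    have h1 : HasDerivAt (fun t : ℝ => T x + t * S x) (S x) t := by
      simpa using ((hasDerivAt_id t).mul_const (S x)).const_add (T x)
    have h2 := (hasDerivAt_primF hx (T x + t * S x)).comp t h1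
    rw [mul_assoc] at h2
    exact h2

/-- The boundary conditions give a measurable trace; finiteness of the energy and coercivity of `F`
place it in `L^p`. -/
lemma IsGlobalMin.exists_trace (hb : -1 < b) (hb' : b < 1) (hp : 1 ≤ p) (hg : DatumHyp b p g)
    (hco : CoercHyp p f) (hu : IsGlobalMin b f g u) : TraceMemLp p u := by
  obtain ⟨T, hT, hTp⟩ := hg.trace
  have t := hu.adm.triple hb hb' hg.memH
  obtain ⟨τ, d⟩ := exists_traceData hb hb' t.memLp t.memLp_grad (hu.adm.latZ hb hb' hg.memH)
  have hTu := hu.adm.isFlatTrace hb hb' hg.memH hT d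
  refine ⟨_, hTu, hco.memLp hp (hTp.1.add (d.memLp.1.const_smul (1 : ℝ))) ?_⟩
  have h := hu.finite
  rw [energy_eq (ae_eq_refl _) hTu] at h
  exact lt_of_le_of_lt le_add_self h

/-- Minimizers satisfy the Euler-Lagrange equation. -/
theorem IsGlobalMin.euler_lagrange (hb : -1 < b) (hb' : b < 1) (hp : 1 ≤ p)
    (hg : DatumHyp b p g) (hf : IsCaratheodory f) (hgr : GrowthHyp p f) (hco : CoercHyp p f)
    (hu : IsGlobalMin b f g u) (hφ : MemH0 b φ) (hφT : TraceMemLp p φ) :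
    ∫ X, weakLap b u X * weakLap b φ X ∂(wMeas n b)
      = ∫ x in flatBall n, f x (flatTrace u x) * flatTrace φ x := by
  obtain ⟨T, hT, hTp⟩ := hu.exists_trace hb hb' hp hg hco
  obtain ⟨S, hS, hSp⟩ := hφT
  obtain ⟨l, N, N'⟩ := hφ.boundary hb hb'
  have tu := hu.adm.memH.triple hb hb'
  have tφ := hφ.1.triple hb hb'
  let j : ℝ → ℝ := fun t => ∫ X, (weakLap b u X + t * weakLap b φ X) ^ 2 ∂(wMeas n b)
    + ∫ x in flatBall n, primF f x (T x + t * S x)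
  have hF0 : ∀ t : ℝ, 0 ≤ ∫ x in flatBall n, primF f x (T x + t * S x) := fun t =>
    integral_nonneg_of_ae (hco.primF_nonneg.mono fun x hx => hx _)
  have hj0 : ∀ t, 0 ≤ j t := fun t =>
    add_nonneg (integral_nonneg fun X => sq_nonneg _) (hF0 t)
  have hE : ∀ t : ℝ, energy b f (u + t • φ) = ENNReal.ofReal (j t) := fun t => by
    rw [energy_eq ((tu.add_smul hb hb' tφ t).weakLap_ae_eq hb hb')
      (hT.add_smul hb hb' hu.adm.memH hφ.1 hS t), ENNReal.ofReal_add
      (integral_nonneg fun X => sq_nonneg _) (hF0 t),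
      lintegral_enorm_sq_eq (tu.add_smul hb hb' tφ t).memLp_lap,
      ofReal_integral_eq_lintegral_ofReal (integrable_primF hp hf hgr (MemLp.add_mul hTp hSp t))
        (hco.primF_nonneg.mono fun x hx => hx _)]
    congr 2
    simp
  -- `φ` satisfies all homogeneous boundary conditions, so `u + t • φ` is admissible for every `t`
  -- and `0` is a global minimum of `j`.
  have hmin : IsLocalMin j 0 := Eventually.of_forall fun t => by
    have h1 := hu.le _ (hu.adm.add_smul hb hb' hg.memH tφ l N N' t)
    have h2 := hE 0
    rw [zero_smul, add_zero] at h2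
    rw [h2, hE t] at h1
    exact (ENNReal.ofReal_le_ofReal_iff (hj0 t)).1 h1
  -- The two derivatives are `2 ∫ y^b Δ_b u Δ_b φ` and `-2 ∫ f(x, u) φ`; the normalization `-2` in
  -- `primF` yields the weak equation without extra constants.
  have hd : HasDerivAt j _ 0 := (hasDerivAt_integral_sq tu.memLp_lap tφ.memLp_lap).add
    (hasDerivAt_integral_primF hp hf hgr hTp hSp)
  have h0 := hmin.hasDerivAt_eq_zero hd
  rw [integral_const_mul] at h0
  have e : ∫ x in flatBall n, f x (flatTrace u x) * flatTrace φ x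
      = ∫ x in flatBall n, f x (T x) * S x := by
    refine integral_congr_ae ?_
    filter_upwards [hT.flatTrace_ae_eq, hS.flatTrace_ae_eq] with x h1 h2
    rw [h1, h2]
  rw [e]
  linarith

end EulerLagrange

end WeightedBilaplace

end

theorem mainTheorem10 (n : ℕ) (hn : 2 ≤ n) (b : ℝ) (hb : -1 < b) (hb' : b < 1)
    (p : ℝ) (hp : 1 ≤ p)
    (g : WeightedBilaplace.Amb n → ℝ) (f : WeightedBilaplace.Thin n → ℝ → ℝ)
    (hg : WeightedBilaplace.DatumHyp b p g)
    (hcar : WeightedBilaplace.IsCaratheodory f)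
    (hgrowth : WeightedBilaplace.GrowthHyp p f)
    (hcoer : WeightedBilaplace.CoercHyp p f) :
    (∃ u : WeightedBilaplace.Amb n → ℝ, WeightedBilaplace.IsGlobalMin b f g u) ∧
    ∀ u : WeightedBilaplace.Amb n → ℝ, WeightedBilaplace.IsGlobalMin b f g u →
      WeightedBilaplace.IsWeakSolBVP b p f g u := by
  refine ⟨WeightedBilaplace.exists_isGlobalMin hb hb' hp hg hcar hgrowth, fun u hu => ?_⟩
  exact ⟨⟨hu.adm.memH, hu.exists_trace hb hb' hp hg hcoer, fun φ hφ hφT =>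
    hu.euler_lagrange hb hb' hp hg hcar hgrowth hcoer hφ hφT⟩,
    hu.adm.lateral, hu.adm.lateralNormal, hu.adm.conormal⟩
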